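/- Let $M$ be a smooth $n$-dimensional manifold (Hausdorff, second countable, without boundary) and let $(\mathcal H,g)$ be a regular sub-Riemannian structure on $M$: $\mathcal H\subset TM$ is a smooth distribution of rank $d$ with a smooth Riemannian metric $g=\langle\cdot,\cdot\rangle$; with $\Gamma_0:=\Gamma(\mathcal H)$ and $\Gamma_{j+1}:=\Gamma_j+[\Gamma_0,\Gamma_j]$, for each $x\in M$ there is a $J$ with $\{X(x)\mid X\in\Gamma_J\}=T_xM$ (bracket-generating), and for each $j$ the dimension of $\{X(x)\mid X\in\Gamma_j\}$ does not depend on $x$ (regular). Let $\omega$ be a volume form on $M$, let $M$ be oriented by $\omega$, and define $\operatorname{Div}X$ by $\mathcal L_X\omega=(\operatorname{Div}X)\,\omega$. Let $\nabla:\Gamma(\mathcal H)\times\Gamma(\mathcal H)\to\Gamma(\mathcal H)$ be a metric connection on $\mathcal H$ (differentiation only in directions of $\mathcal H$). Let $\mathcal H$ be oriented with a spin structure $P_{\mathrm{Spin}}(\mathcal H)$, let $\Delta$ be an irreducible complex representation of the Clifford algebra $\mathcal Cl(d)$ of $\mathbb R^d$ (with $v\cdot v=-|v|^2$), equipped with a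 hermitian inner product for which Clifford multiplication by vectors is antisymmetric, and let $S=P_{\mathrm{Spin}}(\mathcal H)\times_{\mathrm{Spin}(d)}\Delta$ be the spinor bundle. The sub-Dirac operator is $$D=\sum_{i=1}^d s_i\cdot\nabla^S_{s_i},\qquad \nabla^S_X\varphi=X(\varphi)+\tfrac12\sum_{i<j}g(\nabla_Xs_i,s_j)\,s_i\cdot s_j\cdot\varphi,$$ for local oriented orthonormal frames $s_1,\dots,s_d$ of $\mathcal H$ lifted to $P_{\mathrm{Spin}}(\mathcal H)$. It is called symmetric if $(D\varphi,\psi)=(\varphi,D\psi)$ for all compactly supported smooth sections $\varphi,\psi$ of $S$, where $(\varphi,\psi)=\int_M\langle\varphi,\psi\rangle\,\omega$. (1) The following are equivalent: (a) $D$ is symmetric; (b) for every local orthonormal frame $s_1,\dots,s_d$ of $\mathcal H$ over an open set $U\subset M$, the equation $$\operatorname{Div}X=\sum_{i=1}^d\langle\nabla_{s_i}X,s_i\rangle\qquad(\ast)$$ holds on $U$ for all $X\in\Gamma(\mathcal H)$; (c) every point of $M$ has an open neighbourhood $U$ and one local orthonormal frame of $\mathcal H$ over $U$ for which $(\ast)$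 holds on $U$ for all $X\in\Gamma(\mathcal H)$. (2) Suppose in addition that $\mathcal V\subset TM$ is a smooth distribution of rank $l=n-d\ge1$ with $TM=\mathcal H\oplus\mathcal V$, let $\operatorname{proj}:TM\to\mathcal H$ be the projection along $\mathcal V$, and suppose that $\nabla$ is given by the Koszul formula $$2g(\nabla_XY,Z)=X(g(Y,Z))+Y(g(X,Z))-Z(g(X,Y))+g(\operatorname{proj}[X,Y],Z)-g(\operatorname{proj}[X,Z],Y)-g(\operatorname{proj}[Y,Z],X)$$ for $X,Y,Z\in\Gamma(\mathcal H)$. Call $(s_1,\dots,s_d,\xi_1,\dots,\xi_l)$ an adapted frame over an open set $U$ if $s_1,\dots,s_d$ is an orthonormal frame of $\mathcal H$ over $U$ and $\xi_1,\dots,\xi_l$ are smooth sections of $\mathcal V$ over $U$ with $\omega(s_1,\dots,s_d,\xi_1,\dots,\xi_l)=1$; let then $\eta_1,\dots,\eta_l$ be the $1$-forms on $U$ that are zero on $\mathcal H$ and dual to $\xi_1,\dots,\xi_l$. Condition (b) is equivalent to each of the following two conditions: for every adapted frame over an open set $U$, $$\eta_1([X,\xi_1])+\dots+\eta_l([X,\xi_l])=0\quad\text{on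 }U\text{ for all }X\in\Gamma(\mathcal H);\qquad(\ast\ast)$$ respectively, every point of $M$ has an open neighbourhood $U$ with one adapted frame over $U$ satisfying $(\ast\ast)$. (3) In particular, in the situation of (2) with $l=1$, $D$ is symmetric if and only if for every adapted frame $(s_1,\dots,s_d,\xi_1)$ over an open set $U$ and all $X\in\Gamma(\mathcal H)$ the field $[X,\xi_1]$ takes values in $\mathcal H$ on $U$; and also if and only if every point of $M$ has an open neighbourhood $U$ with one such adapted frame over $U$ for which $[X,\xi_1]$ takes values in $\mathcal H$ on $U$ for all $X\in\Gamma(\mathcal H)$. -/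

import Mathlib

open scoped Manifold ContDiff InnerProductSpace Topology

noncomputable section

namespace SubDirac

/-- Euclidean space `ℝⁿ`, the model space of the manifolds considered. -/
abbrev Eu (n : ℕ) : Type := EuclideanSpace ℝ (Fin n)

section Manifold

variable {n : ℕ} {M : Type*} [TopologicalSpace M] [ChartedSpace (Eu n) M]

/-- The derivative `v(f)` of a vector-valued function in the direction of the tangent vector `v`. -/
def dirDeriv {F : Type*} [NormedAddCommGroup F] [NormedSpace ℝ F] (f : M → F) (x : M)
    (v : TangentSpace (𝓡 n) x) : F :=
  mfderiv (𝓡 n) 𝓘(ℝ, F) f x v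

/-- The vector field `X` is smooth on the set `U`. -/
def SmoothVF [IsManifold (𝓡 n) ∞ M] (X : ∀ x : M, TangentSpace (𝓡 n) x) (U : Set M) : Prop :=
  ContMDiffOn (𝓡 n) (𝓡 n).tangent ∞ (fun x => (⟨x, X x⟩ : TangentBundle (𝓡 n) M)) U

variable [IsManifold (𝓡 n) ∞ M]

/-- The vector field on `M` underlying a section of a distribution. -/
def vf {H : ∀ x : M, Submodule ℝ (TangentSpace (𝓡 n) x)} (X : ∀ x, H x) :
    ∀ x : M, TangentSpace (𝓡 n) x :=
  fun x => (X x : TangentSpace (𝓡 n) x)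

/-- `H` is a smooth distribution of rank `d` on `M`: near every point it is spanned by `d`
pointwise linearly independent smooth vector fields. -/
def IsSmoothDistribution (H : ∀ x : M, Submodule ℝ (TangentSpace (𝓡 n) x)) (d : ℕ) : Prop :=
  ∀ p : M, ∃ U : Set M, IsOpen U ∧ p ∈ U ∧ ∃ s : Fin d → ∀ x : M, TangentSpace (𝓡 n) x,
    (∀ i, SmoothVF (s i) U) ∧
    ∀ x ∈ U, LinearIndependent ℝ (fun i => s i x) ∧
      Submodule.span ℝ (Set.range fun i => s i x) = H x

/-- The space `Γ(H)` of global smooth sections of `H`. -/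
def smoothSections (H : ∀ x : M, Submodule ℝ (TangentSpace (𝓡 n) x)) :
    Submodule ℝ (∀ x : M, TangentSpace (𝓡 n) x) where
  carrier := {X | SmoothVF X Set.univ ∧ ∀ x, X x ∈ H x}
  add_mem' := fun hX hY => ⟨hX.1.add_section hY.1, fun x => (H x).add_mem (hX.2 x) (hY.2 x)⟩
  zero_mem' := ⟨(Bundle.contMDiff_zeroSection ℝ (TangentSpace (𝓡 n) : M → Type _)).contMDiffOn,
    fun x => (H x).zero_mem⟩
  smul_mem' := fun c _ hX => ⟨hX.1.const_smul_section, fun x => (H x).smul_mem c (hX.2 x)⟩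

/-- The spaces `Γ₀ = Γ(H)`, `Γ_{j+1} = Γ_j + [Γ₀, Γ_j]` of vector fields on `M`. -/
def bracketFlag (H : ∀ x : M, Submodule ℝ (TangentSpace (𝓡 n) x)) :
    ℕ → Submodule ℝ (∀ x : M, TangentSpace (𝓡 n) x)
  | 0 => smoothSections H
  | j + 1 => bracketFlag H j ⊔
      Submodule.span ℝ {Z | ∃ X ∈ smoothSections H, ∃ Y ∈ bracketFlag H j,
        Z = VectorField.mlieBracket (𝓡 n) X Y}

/-- The space `{X(x) | X ∈ Γ_j}` of values at `x`. -/
def bracketFlagAt (H : ∀ x : M, Submodule ℝ (TangentSpace (𝓡 n) x)) (j : ℕ) (x : M) :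
    Submodule ℝ (TangentSpace (𝓡 n) x) :=
  (bracketFlag H j).map (LinearMap.proj x)

/-- The distribution `H` is bracket-generating. -/
def IsBracketGenerating (H : ∀ x : M, Submodule ℝ (TangentSpace (𝓡 n) x)) : Prop :=
  ∀ x : M, ∃ J : ℕ, bracketFlagAt H J x = ⊤

variable (n M) in
/-- A sub-Riemannian structure `(H, g)` on the `n`-manifold `M`: a smooth bracket-generating
distribution `H` of rank `d` with a smooth Riemannian metric `g` on `H`. -/
structure SubRiemannianStructure (d : ℕ) where
  H : ∀ x : M, Submodule ℝ (TangentSpace (𝓡 n) x)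
  isSmooth : IsSmoothDistribution H d
  bracketGenerating : IsBracketGenerating H
  g : ∀ x : M, H x →ₗ[ℝ] H x →ₗ[ℝ] ℝ
  g_symm : ∀ x (v w : H x), g x v w = g x w v
  g_pos : ∀ x (v : H x), v ≠ 0 → 0 < g x v v
  g_smooth : ∀ (U : Set M) (X Y : ∀ x, H x), IsOpen U → SmoothVF (vf X) U → SmoothVF (vf Y) U →
    ContMDiffOn (𝓡 n) 𝓘(ℝ, ℝ) ∞ (fun x => g x (X x) (Y x)) U

/-- Regularity: for every `j`, the dimension of `{X(x) | X ∈ Γ_j}` does not depend on `x`. -/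
def SubRiemannianStructure.IsRegular {d : ℕ} (S : SubRiemannianStructure n M d) : Prop :=
  ∀ (j : ℕ) (x y : M), Module.finrank ℝ (bracketFlagAt S.H j x) =
    Module.finrank ℝ (bracketFlagAt S.H j y)

/-- `s₁, …, s_d` is a smooth orthonormal frame of `H` over the open set `U`. (The values of the
`s_i` outside `U` are irrelevant.) -/
structure IsOrthonormalFrame {d : ℕ} (S : SubRiemannianStructure n M d) (U : Set M)
    (s : Fin d → ∀ x : M, S.H x) : Prop where
  isOpen : IsOpen U
  smooth : ∀ i, SmoothVF (vf (s i)) U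
  orthonormal : ∀ x ∈ U, ∀ i j, S.g x (s i x) (s j x) = if i = j then 1 else 0

/-- A metric connection on `H`, differentiating in directions of `H` only: `toFun Y x v` is
`∇_v Y` at `x`. It is tensorial in `v` by construction. As the conditions are required for sections
that are smooth on some open set, this is the usual (local) operator `Γ(H) × Γ(H) → Γ(H)`; the
values on sections that are not smooth near `x` are irrelevant. -/
structure MetricConnection {d : ℕ} (S : SubRiemannianStructure n M d) where
  toFun : (∀ x : M, S.H x) → ∀ x : M, S.H x →ₗ[ℝ] S.H x
  add : ∀ (U : Set M) (Y Z : ∀ x, S.H x), IsOpen U → SmoothVF (vf Y) U → SmoothVF (vf Z) U →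
    ∀ x ∈ U, toFun (fun y => Y y + Z y) x = toFun Y x + toFun Z x
  leibniz : ∀ (U : Set M) (f : M → ℝ) (Y : ∀ x, S.H x), IsOpen U →
    ContMDiffOn (𝓡 n) 𝓘(ℝ, ℝ) ∞ f U → SmoothVF (vf Y) U →
    ∀ x ∈ U, ∀ v : S.H x,
      toFun (fun y => f y • Y y) x v = dirDeriv f x (v : TangentSpace (𝓡 n) x) • Y x + f x • toFun Y x v
  smooth : ∀ (U : Set M) (X Y : ∀ x, S.H x), IsOpen U → SmoothVF (vf X) U → SmoothVF (vf Y) U →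
    SmoothVF (vf fun x => toFun Y x (X x)) U
  metric : ∀ (U : Set M) (Y Z : ∀ x, S.H x), IsOpen U → SmoothVF (vf Y) U → SmoothVF (vf Z) U →
    ∀ x ∈ U, ∀ v : S.H x, dirDeriv (fun y => S.g y (Y y) (Z y)) x (v : TangentSpace (𝓡 n) x) =
      S.g x (toFun Y x v) (Z x) + S.g x (Y x) (toFun Z x v)

/-- The projection `TM → H` along the complement `V`. -/
def projH {H V : ∀ x : M, Submodule ℝ (TangentSpace (𝓡 n) x)} (hc : ∀ x, IsCompl (H x) (V x))
    (x : M) : TangentSpace (𝓡 n) x →ₗ[ℝ] H x :=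
  (H x).projectionOnto (V x) (hc x)

/-- The connection is the one given by the Koszul formula for the decomposition `TM = H ⊕ V`. -/
def MetricConnection.IsKoszul {d : ℕ} {S : SubRiemannianStructure n M d} (C : MetricConnection S)
    {V : ∀ x : M, Submodule ℝ (TangentSpace (𝓡 n) x)} (hc : ∀ x, IsCompl (S.H x) (V x)) : Prop :=
  ∀ X Y Z : ∀ x, S.H x, SmoothVF (vf X) Set.univ → SmoothVF (vf Y) Set.univ →
    SmoothVF (vf Z) Set.univ → ∀ x : M,
    2 * S.g x (C.toFun Y x (X x)) (Z x) =
      dirDeriv (fun y => S.g y (Y y) (Z y)) x (vf X x)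
      + dirDeriv (fun y => S.g y (X y) (Z y)) x (vf Y x)
      - dirDeriv (fun y => S.g y (X y) (Y y)) x (vf Z x)
      + S.g x (projH hc x (VectorField.mlieBracket (𝓡 n) (vf X) (vf Y) x)) (Z x)
      - S.g x (projH hc x (VectorField.mlieBracket (𝓡 n) (vf X) (vf Z) x)) (Y x)
      - S.g x (projH hc x (VectorField.mlieBracket (𝓡 n) (vf Y) (vf Z) x)) (X x)

variable (n M) in
/-- A volume form on the `n`-manifold `M`: a smooth nowhere vanishing `n`-form. It also fixes the
orientation of `M`. -/
structure VolumeForm where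
  toFun : ∀ x : M, (TangentSpace (𝓡 n) x) [⋀^Fin n]→ₗ[ℝ] ℝ
  ne_zero : ∀ x, toFun x ≠ 0
  smooth : ∀ (U : Set M) (Y : Fin n → ∀ x : M, TangentSpace (𝓡 n) x), IsOpen U →
    (∀ i, SmoothVF (Y i) U) →
    ContMDiffOn (𝓡 n) 𝓘(ℝ, ℝ) ∞ (fun x => toFun x fun i => Y i x) U

/-- `(L_X Ω)(Y₁, …, Y_n) = X(Ω(Y₁, …, Y_n)) - ∑ᵢ Ω(Y₁, …, [X, Yᵢ], …, Y_n)` at the point `x`. -/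
def VolumeForm.lieDeriv (Ω : VolumeForm n M) (X : ∀ x : M, TangentSpace (𝓡 n) x)
    (Y : Fin n → ∀ x : M, TangentSpace (𝓡 n) x) (x : M) : ℝ :=
  dirDeriv (fun y => Ω.toFun y fun i => Y i y) x (X x)
    - ∑ i, Ω.toFun x
        (Function.update (fun k => Y k x) i (VectorField.mlieBracket (𝓡 n) X (Y i) x))

/-- The divergence of `X`: the number `Div X (x)` is the unique `c` with `(L_X Ω)_x = c • Ω_x`. -/
def VolumeForm.divergence (Ω : VolumeForm n M) (X : ∀ x : M, TangentSpace (𝓡 n) x) (x : M) : ℝ :=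
  Classical.epsilon fun c : ℝ =>
    ∀ (U : Set M) (Y : Fin n → ∀ y : M, TangentSpace (𝓡 n) y), IsOpen U → x ∈ U →
      (∀ i, SmoothVF (Y i) U) → Ω.lieDeriv X Y x = c * Ω.toFun x fun i => Y i x

/-- The density `|Ω(∂₁, …, ∂_n)|` of `Ω` in the chart `e`, as a function of the coordinates. -/
def VolumeForm.chartDensity (Ω : VolumeForm n M) (e : OpenPartialHomeomorph M (Eu n)) (y : Eu n) :
    ENNReal :=
  ENNReal.ofReal |Ω.toFun (e.symm y) fun i =>
    mfderiv (𝓡 n) (𝓡 n) e.symm y (EuclideanSpace.single i (1 : ℝ) : Eu n)|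

/-- The measure on `M` defined by the volume form `Ω` (with `M` oriented by `Ω`): in every chart it
is Lebesgue measure with density `|Ω(∂₁, …, ∂_n)|`. The measures of the charts agree on overlaps,
hence the measure glued from them is their supremum. -/
def VolumeForm.measure [MeasurableSpace M] [BorelSpace M] (Ω : VolumeForm n M) :
    MeasureTheory.Measure M :=
  ⨆ e ∈ atlas (Eu n) M,
    ((MeasureTheory.volume.restrict e.target).withDensity (Ω.chartDensity e)).map e.symm

end Manifold

/-- The negative definite form `v ↦ -|v|²` on `ℝᵈ`. -/
def Qneg (d : ℕ) : QuadraticForm ℝ (Fin d → ℝ) :=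
  QuadraticMap.weightedSumSquares ℝ (fun _ : Fin d => (-1 : ℝ))

/-- The Clifford algebra `Cl(d)`, with `v · v = -|v|²`. -/
abbrev Cl (d : ℕ) : Type := CliffordAlgebra (Qneg d)

/-- The group `Spin(d) ⊆ Cl(d)`. -/
abbrev Spin (d : ℕ) : Type := spinGroup (Qneg d)

/-- The standard basis vector `e_j` of `ℝᵈ`, in the Clifford algebra. -/
def clE {d : ℕ} (j : Fin d) : Cl d := CliffordAlgebra.ι (Qneg d) (Pi.single j 1)

/-- A spinor module `Δ`: an irreducible complex representation of the Clifford algebra `Cl(d)` on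
the finite-dimensional space `Δ`, whose hermitian inner product makes Clifford multiplication by
vectors antisymmetric. -/
structure SpinorModule (d : ℕ) (Δ : Type*) [NormedAddCommGroup Δ] [InnerProductSpace ℂ Δ] where
  rep : Cl d →ₐ[ℝ] Module.End ℂ Δ
  nontrivial : Nontrivial Δ
  irreducible : ∀ W : Submodule ℂ Δ, (∀ c : Cl d, ∀ φ ∈ W, rep c φ ∈ W) → W = ⊥ ∨ W = ⊤
  antisymm : ∀ (v : Fin d → ℝ) (φ ψ : Δ),
    ⟪rep (CliffordAlgebra.ι (Qneg d) v) φ, ψ⟫_ℂ = -⟪φ, rep (CliffordAlgebra.ι (Qneg d) v) ψ⟫_ℂ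

section Spinors

variable {n d : ℕ} {M : Type*} [TopologicalSpace M] [ChartedSpace (Eu n) M]
  [IsManifold (𝓡 n) ∞ M]

/-- A spin structure of `(H, g)`, i.e. a `Spin(d)`-reduction of the bundle of oriented orthonormal
frames of `H`, given by local trivialisations: an open cover `(U_a)` with smooth orthonormal frames
`s^a` over `U_a` (the projections of local sections of the `Spin(d)`-bundle) and a smooth
`Spin(d)`-valued cocycle `t_ab` on `U_a ∩ U_b` that lifts the transition matrices of these frames:
`λ(t_ab) e_j = t_ab e_j t_ab⁻¹ = ∑ᵢ C_ij e_i`, where `s^b_j = ∑ᵢ C_ij s^a_i`. Since `λ(Spin(d))` is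
`SO(d)`, all the frames `s^a` are positively oriented for one orientation of `H`. -/
structure SpinStructure (S : SubRiemannianStructure n M d) (ι : Type*) where
  baseSet : ι → Set M
  indexAt : M → ι
  mem_baseSet_at : ∀ x, x ∈ baseSet (indexAt x)
  frame : ι → Fin d → ∀ x : M, S.H x
  isOrthonormalFrame : ∀ a, IsOrthonormalFrame S (baseSet a) (frame a)
  transition : ι → ι → M → Spin d
  transition_smooth : ∀ a b (l : Module.Dual ℝ (Cl d)),
    ContMDiffOn (𝓡 n) 𝓘(ℝ, ℝ) ∞ (fun x => l (transition a b x : Cl d)) (baseSet a ∩ baseSet b)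
  lift : ∀ a b, ∀ x ∈ baseSet a ∩ baseSet b, ∀ j : Fin d,
    (transition a b x : Cl d) * clE j * star (transition a b x : Cl d) =
      ∑ i, S.g x (frame a i x) (frame b j x) • clE i
  cocycle : ∀ a b c, ∀ x ∈ baseSet a ∩ baseSet b ∩ baseSet c,
    transition a b x * transition b c x = transition a c x

variable {S : SubRiemannianStructure n M d} {ι : Type*}
  {Δ : Type*} [NormedAddCommGroup Δ] [InnerProductSpace ℂ Δ]

/-- A smooth section of the spinor bundle `S = P_Spin ×_{Spin(d)} Δ`: its representatives
`ψ_a : U_a → Δ` in the local trivialisations are smooth and satisfy `ψ_a = t_ab · ψ_b`. -/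
structure SpinorField (P : SpinStructure S ι) (γ : SpinorModule d Δ) where
  toFun : ι → M → Δ
  smooth : ∀ a, ContMDiffOn (𝓡 n) 𝓘(ℝ, Δ) ∞ (toFun a) (P.baseSet a)
  compat : ∀ a b, ∀ x ∈ P.baseSet a ∩ P.baseSet b,
    toFun a x = γ.rep (P.transition a b x : Cl d) (toFun b x)

/-- The spinor field has compact support. -/
def SpinorField.HasCompactSupp {P : SpinStructure S ι} {γ : SpinorModule d Δ}
    (ψ : SpinorField P γ) : Prop :=
  ∃ K : Set M, IsCompact K ∧ ∀ a, ∀ x ∈ P.baseSet a, x ∉ K → ψ.toFun a x = 0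

/-- The spinor connection in the trivialisation with index `a`:
`∇^S_v ψ = v(ψ) + ½ ∑_{i<j} g(∇_v s_i, s_j) s_i · s_j · ψ`. -/
def spinDeriv (C : MetricConnection S) (P : SpinStructure S ι) (γ : SpinorModule d Δ)
    (ψ : ι → M → Δ) (a : ι) (x : M) (v : S.H x) : Δ :=
  dirDeriv (ψ a) x (v : TangentSpace (𝓡 n) x) +
    (1 / 2 : ℝ) • ∑ i, ∑ j ∈ Finset.Ioi i,
      S.g x (C.toFun (P.frame a i) x v) (P.frame a j x) • γ.rep (clE i * clE j) (ψ a x)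

/-- The sub-Dirac operator `Dψ = ∑ᵢ s_i · ∇^S_{s_i} ψ`, in the trivialisation with index `a`. -/
def dirac (C : MetricConnection S) (P : SpinStructure S ι) (γ : SpinorModule d Δ)
    (ψ : SpinorField P γ) (a : ι) (x : M) : Δ :=
  ∑ i, γ.rep (clE i) (spinDeriv C P γ ψ.toFun a x (P.frame a i x))

/-- The `L²`-inner product `∫_M ⟨φ, ψ⟩ Ω` of sections of the spinor bundle, given by their
representatives in the local trivialisations. The pointwise product does not depend on the
trivialisation, because `Spin(d)` acts unitarily on `Δ`. -/
def L2inner [MeasurableSpace M] [BorelSpace M] (Ω : VolumeForm n M) (P : SpinStructure S ι)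
    (φ ψ : ι → M → Δ) : ℂ :=
  ∫ x, ⟪φ (P.indexAt x) x, ψ (P.indexAt x) x⟫_ℂ ∂Ω.measure

/-- The sub-Dirac operator is symmetric on the compactly supported smooth sections. -/
def DiracIsSymmetric [MeasurableSpace M] [BorelSpace M] (Ω : VolumeForm n M)
    (C : MetricConnection S) (P : SpinStructure S ι) (γ : SpinorModule d Δ) : Prop :=
  ∀ φ ψ : SpinorField P γ, φ.HasCompactSupp → ψ.HasCompactSupp →
    L2inner Ω P (dirac C P γ φ) ψ.toFun = L2inner Ω P φ.toFun (dirac C P γ ψ)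

end Spinors

section Conditions

variable {n d : ℕ} {M : Type*} [TopologicalSpace M] [ChartedSpace (Eu n) M]
  [IsManifold (𝓡 n) ∞ M] {S : SubRiemannianStructure n M d}

/-- `Div X = ∑ᵢ g(∇_{s_i} X, s_i)` holds on `U` for all `X ∈ Γ(H)`. -/
def DivCondition (Ω : VolumeForm n M) (C : MetricConnection S) (U : Set M)
    (s : Fin d → ∀ x : M, S.H x) : Prop :=
  ∀ X : ∀ x, S.H x, SmoothVF (vf X) Set.univ → ∀ x ∈ U,
    Ω.divergence (vf X) x = ∑ i, S.g x (C.toFun X x (s i x)) (s i x)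

/-- Over the open set `U`, `s₁, …, s_d` is an orthonormal frame of `H`, and `ξ₁, …, ξ_l` are smooth
sections of `V` with `Ω(s₁, …, s_d, ξ₁, …, ξ_l) = 1`. -/
structure IsAdaptedFrame {l : ℕ} (hdl : d + l = n) (S : SubRiemannianStructure n M d)
    (V : ∀ x : M, Submodule ℝ (TangentSpace (𝓡 n) x)) (Ω : VolumeForm n M) (U : Set M)
    (s : Fin d → ∀ x : M, S.H x) (ξ : Fin l → ∀ x : M, V x) : Prop where
  frame : IsOrthonormalFrame S U s
  smooth : ∀ j, SmoothVF (vf (ξ j)) U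
  volume_eq_one : ∀ x ∈ U,
    Ω.toFun x (fun k : Fin n =>
      Fin.append (fun i => vf (s i) x) (fun j => vf (ξ j) x) (Fin.cast hdl.symm k)) = 1

/-- `∑ⱼ ηⱼ([X, ξⱼ]) = 0` holds on `U` for all `X ∈ Γ(H)`, where the `1`-forms `ηⱼ` on `U` are
zero on `H` and dual to the `ξⱼ`. -/
def BracketTraceCondition {l : ℕ} (S : SubRiemannianStructure n M d)
    {V : ∀ x : M, Submodule ℝ (TangentSpace (𝓡 n) x)} (U : Set M)
    (ξ : Fin l → ∀ x : M, V x) : Prop :=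
  ∃ η : Fin l → ∀ x : M, TangentSpace (𝓡 n) x →ₗ[ℝ] ℝ,
    (∀ x ∈ U, ∀ j, (∀ v ∈ S.H x, η j x v = 0) ∧
      ∀ k, η j x (vf (ξ k) x) = if j = k then 1 else 0) ∧
    ∀ X : ∀ x, S.H x, SmoothVF (vf X) Set.univ → ∀ x ∈ U,
      ∑ j, η j x (VectorField.mlieBracket (𝓡 n) (vf X) (vf (ξ j)) x) = 0

/-- `[X, ξ]` takes values in `H` on `U`, for all `X ∈ Γ(H)`. -/
def BracketPreserves (S : SubRiemannianStructure n M d)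
    {V : ∀ x : M, Submodule ℝ (TangentSpace (𝓡 n) x)} (U : Set M) (ξ : ∀ x : M, V x) : Prop :=
  ∀ X : ∀ x, S.H x, SmoothVF (vf X) Set.univ → ∀ x ∈ U,
    VectorField.mlieBracket (𝓡 n) (vf X) (vf ξ) x ∈ S.H x

end Conditions

end SubDirac

end

open SubDirac

noncomputable section

namespace SubDirac

/-! ### Clifford algebra: central even elements, the spin Lie algebra, the spinor module -/

section Clifford

variable {d : ℕ}

/-! For `X` in `Γ(H)` consider its defect, the difference of `Div X` and the trace of `v ↦ ∇_v X` on
`H`; in an orthonormal frame this trace is the right side of the divergence condition. Both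
divergences satisfy div(fX) = f div X + X(f), so the defect is linear over functions
(`defect_sum_smul`). Its vanishing involves no frame, which is why one local frame near every point
is as good as all frames.

Two spinor fields φ, ψ and a real linear form τ on ℂ define the section Z = ∑ₖ τ⟨s_k·φ, ψ⟩ s_k of
`H`. Its connection divergence is τ(⟨Dφ,ψ⟩ - ⟨φ,Dψ⟩) (`inner_dirac_sub`, `div_current`): Clifford
multiplication is antisymmetric, and the commutators of the e_i with the connection forms supply
exactly the divergences of the frame fields. For compactly supported spinors the divergence theorem
gives ∫ Div Z = 0, hence τ((Dφ,ψ) - (φ,Dψ)) = -∫ defect(Z) (`clm_L2inner_dirac_sub`). Zero defect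
therefore implies symmetry. Conversely, φ = χφ₀, ψ = χ e_k·φ₀ and τ = Re give Z = χ²|φ₀|² s_k; if
the continuous function defect(s_k) were nonzero at a point, a bump χ there would make the integral
nonzero.

These integrals make sense because the pointwise products do not depend on the trivialisation picked
at each point, that is, because D is covariant under the transition functions t. This reduces to dt
= t Γ_b - Γ_a t for the connection forms Γ. The element t⁻¹dt - Γ_b + t⁻¹Γ_a t is even, skew under
`star` and commutes with all vectors, and such an element is zero
(`eq_zero_of_even_of_commute_of_skew`).

For the Koszul connection the trace of ∇X is -∑ᵢ g(proj[X,sᵢ], sᵢ). Evaluating L_X Ω on an adapted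
frame, where Ω is constantly 1, gives Div X as the same sum minus ∑ⱼ ηⱼ([X,ξⱼ]). So the defect is
-∑ⱼ ηⱼ([X,ξⱼ]); for l = 1 it vanishes exactly when [X,ξ₁] lies in ker η₁ = `H`. -/

instance finiteDimensional_cl : FiniteDimensional ℝ (Cl d) := by
  have : Invertible (2 : ℝ) := invertibleOfNonzero two_ne_zero
  have : Module.Finite ℝ (ExteriorAlgebra ℝ (Fin d → ℝ)) :=
    Module.Finite.of_basis (Pi.basisFun ℝ (Fin d)).ExteriorAlgebra
  exact Module.Finite.equiv (CliffordAlgebra.equivExterior (Qneg d)).symm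

theorem qneg_apply (v : Fin d → ℝ) : Qneg d v = -∑ i, v i * v i := by
  simp [Qneg, QuadraticMap.weightedSumSquares_apply]

theorem clE_mul_self (i : Fin d) : clE i * clE i = -1 := by
  rw [clE, CliffordAlgebra.ι_sq_scalar, qneg_apply]
  simp [Pi.single_apply]

theorem clE_mul_comm {i j : Fin d} (h : i ≠ j) : clE i * clE j = -(clE j * clE i) := by
  refine CliffordAlgebra.ι_mul_ι_comm_of_isOrtho ?_
  rw [QuadraticMap.isOrtho_def]
  simp only [qneg_apply, Pi.add_apply, Pi.single_apply]
  rw [← neg_add, ← Finset.sum_add_distrib]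
  congr 1
  refine Finset.sum_congr rfl fun k _ => ?_
  by_cases hi : k = i <;> by_cases hj : k = j <;> simp_all

theorem clE_mul_clE_add (i j : Fin d) :
    clE i * clE j + clE j * clE i = (if i = j then (-2 : ℝ) else 0) • (1 : Cl d) := by
  split_ifs with h
  · subst h
    rw [clE_mul_self, neg_smul, two_smul]
    abel
  · rw [clE_mul_comm h]
    simp

theorem ι_eq_sum_clE (v : Fin d → ℝ) :
    CliffordAlgebra.ι (Qneg d) v = ∑ i, v i • clE i := by
  conv_lhs => rw [pi_eq_sum_univ' v]
  simp [clE]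

theorem star_clE (i : Fin d) : star (clE i) = -clE i := CliffordAlgebra.star_ι _

/-- The product of a word in the standard basis vectors. -/
def clWord (L : List (Fin d)) : Cl d := (L.map clE).prod

theorem clWord_cons (i : Fin d) (L : List (Fin d)) : clWord (i :: L) = clE i * clWord L := by
  simp [clWord]

theorem clWord_append (K L : List (Fin d)) : clWord (K ++ L) = clWord K * clWord L := by
  simp [clWord]

/-- Passing a letter costs a sign unless the letter is `j`; the number of signs, length minus count,
has the parity of length plus count. -/
theorem clE_mul_clWord (j : Fin d) (L : List (Fin d)) :
    clE j * clWord L = ((-1 : ℝ) ^ (L.length + L.count j)) • (clWord L * clE j) := by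
  induction L with
  | nil => simp [clWord]
  | cons i L ih =>
    rw [clWord_cons, ← mul_assoc]
    by_cases h : i = j
    · subst h
      conv_lhs => rw [mul_assoc, ih, mul_smul_comm, ← mul_assoc]
      rw [List.length_cons, List.count_cons_self]
      congr 1
      rw [show L.length + 1 + (L.count i + 1) = L.length + L.count i + 2 by ring,
        pow_add _ (L.length + L.count i) 2]
      norm_num
    · rw [clE_mul_comm (Ne.symm h), List.length_cons, List.count_cons_of_ne (by simpa using h),
        neg_mul, mul_assoc, ih, mul_smul_comm, ← neg_smul, mul_assoc]
      congr 1
      rw [show L.length + 1 + L.count j = L.length + L.count j + 1 by ring, pow_succ]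
      ring

/-- The first letter occurs a second time; moving it there cancels the pair up to sign and shortens
the word by two. -/
theorem clWord_mem_of_count_even (L : List (Fin d)) (h : ∀ j, Even (L.count j)) :
    clWord L ∈ Submodule.span ℝ {(1 : Cl d)} := by
  induction hN : L.length using Nat.strong_induction_on generalizing L with
  | _ N ih =>
  cases L with
  | nil => exact Submodule.subset_span (by simp [clWord])
  | cons i L =>
    have hi : i ∈ L := by
      by_contra hi
      have := h i
      rw [List.count_cons_self, List.count_eq_zero_of_not_mem hi] at this
      simp at this
    obtain ⟨A, B, rfl⟩ := List.append_of_mem hi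
    have hAB : clWord (i :: (A ++ i :: B)) =
        (-(-1 : ℝ) ^ (A.length + A.count i)) • clWord (A ++ B) := by
      rw [clWord_cons, clWord_append, clWord_cons, ← mul_assoc, clE_mul_clWord, smul_mul_assoc,
        mul_assoc, ← mul_assoc (clE i), clE_mul_self, clWord_append]
      simp
    rw [hAB]
    refine Submodule.smul_mem _ _ (ih (A ++ B).length ?_ _ ?_ rfl)
    · rw [← hN]
      simp
    · intro j
      have := h j
      simp only [List.count_cons, List.count_append] at this ⊢
      by_cases hj : i = j
      · subst hj
        simp only [beq_self_eq_true, if_true] at this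
        rw [show A.count i + (B.count i + 1) + 1 = A.count i + B.count i + 2 by ring] at this
        exact (Nat.even_add.1 this).2 even_two
      · simpa [hj] using this

theorem even_mem_span_clWord {x : Cl d} (hx : x ∈ CliffordAlgebra.evenOdd (Qneg d) 0) :
    x ∈ Submodule.span ℝ {y | ∃ L : List (Fin d), Even L.length ∧ y = clWord L} := by
  induction x, hx using CliffordAlgebra.even_induction with
  | algebraMap r =>
    rw [Algebra.algebraMap_eq_smul_one]
    exact Submodule.smul_mem _ _ (Submodule.subset_span ⟨[], by simp, by simp [clWord]⟩)
  | add x y hx hy ihx ihy => exact Submodule.add_mem _ ihx ihy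
  | ι_mul_ι_mul v w x hx ih =>
    rw [ι_eq_sum_clE v, ι_eq_sum_clE w, Finset.sum_mul_sum, Finset.sum_mul]
    refine Submodule.sum_mem _ fun i _ => ?_
    rw [Finset.sum_mul]
    refine Submodule.sum_mem _ fun j _ => ?_
    rw [smul_mul_smul_comm, smul_mul_assoc]
    refine Submodule.smul_mem _ _ ?_
    have key := Submodule.mem_map_of_mem (f := LinearMap.mulLeft ℝ (clE i * clE j)) ih
    rw [LinearMap.mulLeft_apply] at key
    refine (Submodule.map_span_le _ _ _).2 ?_ key
    rintro _ ⟨L, hL, rfl⟩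
    refine Submodule.subset_span ⟨i :: j :: L, ?_, ?_⟩
    · simpa [Nat.even_add_one] using hL
    · simp [clWord_cons]

/-- Since e_k² = -1, an element commuting with e_k is fixed by y ↦ ½(y - e_k y e_k). On a word of
even length this map is the identity or zero according to the parity of the number of letters `k`.
Applying it for every `k` leaves only words in which all letters occur an even number of times, and
these are scalars. -/
theorem mem_span_one_of_even_of_commute {x : Cl d}
    (hx : x ∈ CliffordAlgebra.evenOdd (Qneg d) 0) (hc : ∀ j, clE j * x = x * clE j) :
    x ∈ Submodule.span ℝ {(1 : Cl d)} := by
  have key : ∀ s : Finset (Fin d), x ∈ Submodule.span ℝ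
      {y | ∃ L : List (Fin d), Even L.length ∧ (∀ j ∈ s, Even (L.count j)) ∧ y = clWord L} := by
    intro s
    induction s using Finset.induction_on with
    | empty => simpa using even_mem_span_clWord hx
    | insert k s hk ih =>
      let f : Cl d →ₗ[ℝ] Cl d := (1 / 2 : ℝ) • (LinearMap.id -
        (LinearMap.mulLeft ℝ (clE k)).comp (LinearMap.mulRight ℝ (clE k)))
      have hf : ∀ y, f y = (1 / 2 : ℝ) • (y - clE k * (y * clE k)) := fun y => rfl
      have hfx : f x = x := by
        rw [hf, ← mul_assoc, hc, mul_assoc, clE_mul_self, mul_neg, mul_one, sub_neg_eq_add,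
          ← two_smul ℝ x, smul_smul]
        norm_num
      rw [← hfx]
      refine (Submodule.map_span_le f _ _).2 ?_ (Submodule.mem_map_of_mem ih)
      rintro _ ⟨L, hL, hs, rfl⟩
      rw [hf, ← mul_assoc, clE_mul_clWord, smul_mul_assoc, mul_assoc, clE_mul_self]
      by_cases hkL : Even (L.count k)
      · refine Submodule.smul_mem _ _ (Submodule.sub_mem _ ?_ (Submodule.smul_mem _ _ ?_))
        · refine Submodule.subset_span ⟨L, hL, ?_, rfl⟩
          intro j hj
          rcases Finset.mem_insert.1 hj with rfl | hj
          exacts [hkL, hs j hj]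
        · rw [mul_neg, mul_one]
          refine Submodule.neg_mem _ (Submodule.subset_span ⟨L, hL, ?_, rfl⟩)
          intro j hj
          rcases Finset.mem_insert.1 hj with rfl | hj
          exacts [hkL, hs j hj]
      · have : Odd (L.length + L.count k) := hL.add_odd (Nat.not_even_iff_odd.1 hkL)
        rw [this.neg_one_pow]
        simp
  refine Submodule.span_le.2 ?_ (key Finset.univ)
  rintro _ ⟨L, -, hL, rfl⟩
  exact clWord_mem_of_count_even L fun j => hL j (Finset.mem_univ j)

/-- An even element that commutes with all vectors and is skew for Clifford conjugation is zero. -/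
theorem eq_zero_of_even_of_commute_of_skew {x : Cl d}
    (hx : x ∈ CliffordAlgebra.evenOdd (Qneg d) 0) (hc : ∀ j, clE j * x = x * clE j)
    (hs : star x = -x) : x = 0 := by
  obtain ⟨r, rfl⟩ := Submodule.mem_span_singleton.1 (mem_span_one_of_even_of_commute hx hc)
  rw [CliffordAlgebra.star_smul, star_one] at hs
  have h2 : (2 : ℝ) • (r • (1 : Cl d)) = 0 := by
    rw [two_smul]
    nth_rewrite 1 [hs]
    simp
  exact (smul_eq_zero.1 h2).resolve_left two_ne_zero

/-- The element `½ ∑_{i<j} w_ij e_i e_j`. -/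
def spinElt (w : Fin d → Fin d → ℝ) : Cl d :=
  (1 / 2 : ℝ) • ∑ i, ∑ j ∈ Finset.Ioi i, w i j • (clE i * clE j)

/-- The unordered form is easier to commute with vectors. Each pair i < j is counted twice, because
both `w` and e_i e_j change sign under the swap, and the diagonal vanishes; hence ½ becomes ¼. -/
theorem spinElt_eq (w : Fin d → Fin d → ℝ) (hw : ∀ i j, w i j = -w j i) :
    spinElt w = (1 / 4 : ℝ) • ∑ i, ∑ j, w i j • (clE i * clE j) := by
  have h := Finset.sum_sum_Ioi_add_eq_sum_sum_off_diag
    (fun j i : Fin d => w i j • (clE i * clE j))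
  have h1 : ∑ i, ∑ j ∈ Finset.Ioi i, (w i j • (clE i * clE j) + w j i • (clE j * clE i)) =
      (2 : ℝ) • ∑ i, ∑ j ∈ Finset.Ioi i, w i j • (clE i * clE j) := by
    simp only [Finset.smul_sum]
    refine Finset.sum_congr rfl fun i _ => Finset.sum_congr rfl fun j hj => ?_
    rw [hw j i, clE_mul_comm (Finset.mem_Ioi.1 hj).ne', smul_neg, neg_smul, neg_neg, two_smul]
  have h2 : ∀ i, ∑ j ∈ ({i}ᶜ : Finset (Fin d)), w i j • (clE i * clE j) =
      ∑ j, w i j • (clE i * clE j) := by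
    intro i
    rw [← Finset.sum_compl_add_sum ({i} : Finset (Fin d))]
    have : w i i = 0 := by linarith [hw i i]
    simp [this]
  rw [h1] at h
  simp only [h2] at h
  rw [spinElt, ← h, smul_smul]
  norm_num

theorem spinElt_mem_even (w : Fin d → Fin d → ℝ) :
    spinElt w ∈ CliffordAlgebra.evenOdd (Qneg d) 0 :=
  Submodule.smul_mem _ _ <| Submodule.sum_mem _ fun _ _ => Submodule.sum_mem _ fun _ _ =>
    Submodule.smul_mem _ _ (CliffordAlgebra.ι_mul_ι_mem_evenOdd_zero _ _ _)

theorem star_spinElt (w : Fin d → Fin d → ℝ) : star (spinElt w) = -spinElt w := by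
  simp only [spinElt, CliffordAlgebra.star_smul, star_sum, star_mul, star_clE, neg_mul_neg]
  rw [← smul_neg, ← Finset.sum_neg_distrib]
  congr 1
  refine Finset.sum_congr rfl fun i _ => ?_
  rw [← Finset.sum_neg_distrib]
  refine Finset.sum_congr rfl fun j hj => ?_
  rw [clE_mul_comm (Finset.mem_Ioi.1 hj).ne', smul_neg]

/-- The infinitesimal form of the covering Spin(d) → SO(d): bracketing with ½∑ w_ij e_i e_j acts on
vectors through the skew matrix `w`. Moving e_i through e_j e_k leaves only the contractions i = j
and i = k. -/
theorem clE_mul_spinElt_sub (w : Fin d → Fin d → ℝ) (hw : ∀ i j, w i j = -w j i) (i : Fin d) :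
    clE i * spinElt w - spinElt w * clE i = -∑ k, w i k • clE k := by
  have h1 : ∀ j k : Fin d, clE i * (clE j * clE k) - clE j * clE k * clE i =
      (if i = j then (-2 : ℝ) else 0) • clE k - (if i = k then (-2 : ℝ) else 0) • clE j := by
    intro j k
    have e1 : clE i * (clE j * clE k) =
        (if i = j then (-2 : ℝ) else 0) • clE k - clE j * (clE i * clE k) := by
      rw [← mul_assoc, ← mul_assoc, eq_sub_iff_add_eq, ← add_mul, clE_mul_clE_add, smul_mul_assoc,
        one_mul]
    have e2 : clE j * clE k * clE i =
        (if i = k then (-2 : ℝ) else 0) • clE j - clE j * (clE i * clE k) := by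
      rw [mul_assoc, eq_sub_iff_add_eq, ← mul_add, add_comm, clE_mul_clE_add, mul_smul_comm,
        mul_one]
    rw [e1, e2]
    abel
  rw [spinElt_eq w hw, mul_smul_comm, smul_mul_assoc, ← smul_sub, Finset.mul_sum, Finset.sum_mul,
    ← Finset.sum_sub_distrib]
  have h2 : ∀ j, clE i * ∑ k, w j k • (clE j * clE k) - (∑ k, w j k • (clE j * clE k)) * clE i =
      (if i = j then (-2 : ℝ) else 0) • ∑ k, w j k • clE k + (2 * w j i) • clE j := by
    intro j
    rw [Finset.mul_sum, Finset.sum_mul, ← Finset.sum_sub_distrib]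
    simp only [mul_smul_comm, smul_mul_assoc, ← smul_sub, h1]
    simp only [smul_sub, Finset.sum_sub_distrib, ite_smul, zero_smul, smul_ite, smul_zero]
    simp only [Finset.sum_ite_eq, Finset.mem_univ, if_true, sub_eq_add_neg]
    congr 1
    · split_ifs
      · rw [Finset.smul_sum]
        exact Finset.sum_congr rfl fun k _ => smul_comm _ _ _
      · simp
    · rw [smul_smul, ← neg_smul]
      congr 1
      ring
  simp only [h2, Finset.sum_add_distrib, ite_smul, zero_smul, Finset.sum_ite_eq, Finset.mem_univ,
    if_true]
  have h3 : ∑ j, (2 * w j i) • (clE j : Cl d) = (-2 : ℝ) • ∑ k, w i k • clE k := by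
    rw [Finset.smul_sum]
    refine Finset.sum_congr rfl fun k _ => ?_
    rw [hw k i, smul_smul]
    congr 1
    ring
  rw [h3, ← add_smul, smul_smul, ← neg_one_smul ℝ (∑ k, w i k • (clE k : Cl d))]
  norm_num

variable {Δ : Type*} [NormedAddCommGroup Δ] [InnerProductSpace ℂ Δ]

/-- Antisymmetry on vectors propagates to the whole algebra, because `star` is the anti-automorphism
that negates vectors. -/
theorem SpinorModule.inner_rep_left (γ : SpinorModule d Δ) (x : Cl d) (φ ψ : Δ) :
    ⟪γ.rep x φ, ψ⟫_ℂ = ⟪φ, γ.rep (star x) ψ⟫_ℂ := by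
  induction x using CliffordAlgebra.induction generalizing φ ψ with
  | algebraMap r =>
    rw [CliffordAlgebra.star_algebraMap, AlgHom.commutes, Module.algebraMap_end_apply,
      Module.algebraMap_end_apply, ← Complex.coe_smul, ← Complex.coe_smul, inner_smul_left,
      inner_smul_right, Complex.conj_ofReal]
  | ι v =>
    rw [CliffordAlgebra.star_ι, map_neg, LinearMap.neg_apply, inner_neg_right]
    exact γ.antisymm v φ ψ
  | mul a b ha hb =>
    rw [star_mul, map_mul, map_mul, Module.End.mul_apply, Module.End.mul_apply, ha, hb]
  | add a b ha hb =>
    rw [star_add, map_add, map_add, LinearMap.add_apply, LinearMap.add_apply, inner_add_left,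
      inner_add_right, ha, hb]

theorem SpinorModule.inner_clE_left (γ : SpinorModule d Δ) (i : Fin d) (φ ψ : Δ) :
    ⟪γ.rep (clE i) φ, ψ⟫_ℂ = -⟪φ, γ.rep (clE i) ψ⟫_ℂ :=
  γ.antisymm _ φ ψ

theorem SpinorModule.inner_spin (γ : SpinorModule d Δ) (t : Spin d) (φ ψ : Δ) :
    ⟪γ.rep (t : Cl d) φ, γ.rep (t : Cl d) ψ⟫_ℂ = ⟪φ, ψ⟫_ℂ := by
  rw [γ.inner_rep_left, ← Module.End.mul_apply, ← map_mul, spinGroup.coe_star_mul_self, map_one,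
    Module.End.one_apply]

/-- The real part is symmetric in `i` and `k`, so twice it is given by the anticommutator, a scalar.
This orthogonality is what isolates a single frame field in the current of the test spinors. -/
theorem SpinorModule.re_inner_clE_clE (γ : SpinorModule d Δ) (i k : Fin d) (φ : Δ) :
    (⟪γ.rep (clE i) φ, γ.rep (clE k) φ⟫_ℂ).re = if i = k then ‖φ‖ ^ 2 else 0 := by
  have h : ⟪γ.rep (clE i) φ, γ.rep (clE k) φ⟫_ℂ + ⟪γ.rep (clE k) φ, γ.rep (clE i) φ⟫_ℂ =
      -⟪φ, γ.rep (clE i * clE k + clE k * clE i) φ⟫_ℂ := by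
    rw [γ.inner_clE_left, γ.inner_clE_left, map_add, LinearMap.add_apply, inner_add_right,
      map_mul, map_mul, Module.End.mul_apply, Module.End.mul_apply]
    ring
  have h' := congrArg Complex.re h
  have hsymm : (⟪γ.rep (clE k) φ, γ.rep (clE i) φ⟫_ℂ).re =
      (⟪γ.rep (clE i) φ, γ.rep (clE k) φ⟫_ℂ).re :=
    inner_re_symm (𝕜 := ℂ) (γ.rep (clE k) φ) (γ.rep (clE i) φ)
  rw [Complex.add_re, hsymm] at h'
  rw [clE_mul_clE_add, map_smul, map_one, LinearMap.smul_apply, Module.End.one_apply,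
    ← Complex.coe_smul, inner_smul_right] at h'
  have hn : (⟪φ, φ⟫_ℂ) = ((‖φ‖ ^ 2 : ℝ) : ℂ) := by
    rw [inner_self_eq_norm_sq_to_K]
    simp
  rw [hn, Complex.neg_re, ← Complex.ofReal_mul, Complex.ofReal_re] at h'
  split_ifs at h' ⊢ with hik
  · linarith
  · linarith

end Clifford

/-! ### Vector fields and directional derivatives in charts -/

section Coordinates

variable {n : ℕ} {M : Type*} [TopologicalSpace M] [ChartedSpace (Eu n) M]

section
variable [IsManifold (𝓡 n) ∞ M]

/-- The vector field `X` is smooth near the point `x`. -/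
def SmoothVFAt (X : ∀ x : M, TangentSpace (𝓡 n) x) (x : M) : Prop :=
  ContMDiffAt (𝓡 n) (𝓡 n).tangent ∞ (fun x => (⟨x, X x⟩ : TangentBundle (𝓡 n) M)) x

theorem SmoothVF.at {X : ∀ x : M, TangentSpace (𝓡 n) x} {U : Set M} (h : SmoothVF X U)
    (hU : IsOpen U) {x : M} (hx : x ∈ U) : SmoothVFAt X x :=
  ContMDiffOn.contMDiffAt h (hU.mem_nhds hx)

theorem smoothVF_of_at {X : ∀ x : M, TangentSpace (𝓡 n) x} {U : Set M}
    (h : ∀ x ∈ U, SmoothVFAt X x) : SmoothVF X U :=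
  fun x hx => (h x hx).contMDiffWithinAt

theorem SmoothVFAt.mdifferentiableAt {X : ∀ x : M, TangentSpace (𝓡 n) x} {x : M}
    (h : SmoothVFAt X x) :
    MDifferentiableAt (𝓡 n) (𝓡 n).tangent (fun x => (⟨x, X x⟩ : TangentBundle (𝓡 n) M)) x :=
  ContMDiffAt.mdifferentiableAt h (by simp)

theorem SmoothVFAt.congr {X Y : ∀ x : M, TangentSpace (𝓡 n) x} {x : M}
    (h : SmoothVFAt X x) (hXY : ∀ᶠ y in 𝓝 x, Y y = X y) : SmoothVFAt Y x :=
  ContMDiffAt.congr_of_eventuallyEq h (hXY.mono fun y hy => by simp [hy])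

theorem SmoothVFAt.add {X Y : ∀ x : M, TangentSpace (𝓡 n) x} {x : M}
    (hX : SmoothVFAt X x) (hY : SmoothVFAt Y x) : SmoothVFAt (fun y => X y + Y y) x :=
  ContMDiffAt.add_section hX hY

theorem SmoothVFAt.smul {f : M → ℝ} {X : ∀ x : M, TangentSpace (𝓡 n) x} {x : M}
    (hf : ContMDiffAt (𝓡 n) 𝓘(ℝ, ℝ) ∞ f x) (hX : SmoothVFAt X x) :
    SmoothVFAt (fun y => f y • X y) x :=
  ContMDiffAt.smul_section hf hX

theorem smoothVFAt_zero (x : M) : SmoothVFAt (fun y : M => (0 : TangentSpace (𝓡 n) y)) x :=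
  (Bundle.contMDiff_zeroSection ℝ (TangentSpace (𝓡 n) : M → Type _)).contMDiffAt

theorem SmoothVFAt.sum {κ : Type*} {s : Finset κ} {X : κ → ∀ x : M, TangentSpace (𝓡 n) x} {x : M}
    (hX : ∀ i ∈ s, SmoothVFAt (X i) x) : SmoothVFAt (fun y => ∑ i ∈ s, X i y) x :=
  ContMDiffAt.sum_section hX

/-- The vector field `X` in the coordinates of the chart `e`. -/
def coordVF (e : OpenPartialHomeomorph M (Eu n)) (X : ∀ x : M, TangentSpace (𝓡 n) x) :
    Eu n → Eu n :=
  VectorField.mpullback (𝓡 n) (𝓡 n) e.symm X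

variable {e : OpenPartialHomeomorph M (Eu n)} (he : e ∈ atlas (Eu n) M)
include he

theorem contMDiffAt_chart_symm {y : Eu n} (hy : y ∈ e.target) :
    ContMDiffAt (𝓡 n) (𝓡 n) ∞ e.symm y :=
  contMDiffAt_symm_of_mem_maximalAtlas (IsManifold.subset_maximalAtlas he) hy

theorem contMDiffAt_chart {x : M} (hx : x ∈ e.source) :
    ContMDiffAt (𝓡 n) (𝓡 n) ∞ e x :=
  contMDiffAt_of_mem_maximalAtlas (IsManifold.subset_maximalAtlas he) hx

theorem isInvertible_mfderiv_chart_symm {y : Eu n} (hy : y ∈ e.target) :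
    (mfderiv (𝓡 n) (𝓡 n) e.symm y).IsInvertible :=
  have h : e.MDifferentiable (𝓡 n) (𝓡 n) := mdifferentiable_of_mem_atlas he
  ⟨h.symm.mfderiv hy, rfl⟩

theorem isInvertible_mfderiv_chart {x : M} (hx : x ∈ e.source) :
    (mfderiv (𝓡 n) (𝓡 n) e x).IsInvertible :=
  have h : e.MDifferentiable (𝓡 n) (𝓡 n) := mdifferentiable_of_mem_atlas he
  ⟨h.mfderiv hx, rfl⟩

theorem mfderiv_symm_coordVF (X : ∀ x : M, TangentSpace (𝓡 n) x) {y : Eu n} (hy : y ∈ e.target) :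
    mfderiv (𝓡 n) (𝓡 n) e.symm y (coordVF e X y) = X (e.symm y) :=
  (isInvertible_mfderiv_chart_symm he hy).self_apply_inverse _

theorem SmoothVFAt.contDiffAt_coordVF {X : ∀ x : M, TangentSpace (𝓡 n) x} {y : Eu n}
    (hy : y ∈ e.target) (hX : SmoothVFAt X (e.symm y)) : ContDiffAt ℝ ∞ (coordVF e X) y :=
  contMDiffAt_vectorSpace_iff_contDiffAt.1 <|
    ContMDiffAt.mpullback_vectorField_preimage hX (contMDiffAt_chart_symm he hy)
      (isInvertible_mfderiv_chart_symm he hy) (by simp)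

theorem coordVF_mlieBracket {X Y : ∀ x : M, TangentSpace (𝓡 n) x} {y : Eu n}
    (hy : y ∈ e.target) (hX : SmoothVFAt X (e.symm y)) (hY : SmoothVFAt Y (e.symm y)) :
    coordVF e (VectorField.mlieBracket (𝓡 n) X Y) y =
      fderiv ℝ (coordVF e Y) y (coordVF e X y) - fderiv ℝ (coordVF e X) y (coordVF e Y y) := by
  have h3 : IsManifold (𝓡 n) (minSmoothness ℝ 3) M :=
    IsManifold.of_le (n := ∞) (by simpa using ENat.LEInfty.out)
  rw [coordVF, VectorField.mpullback_mlieBracket hX.mdifferentiableAt hY.mdifferentiableAt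
    (contMDiffAt_chart_symm he hy) (by simpa using ENat.LEInfty.out)]
  rw [← VectorField.mlieBracketWithin_univ, VectorField.mlieBracketWithin_eq_lieBracketWithin]
  change VectorField.lieBracketWithin ℝ (coordVF e X) (coordVF e Y) Set.univ y = _
  rw [VectorField.lieBracketWithin_univ]
  rfl

theorem dirDeriv_eq_fderiv {F : Type*} [NormedAddCommGroup F] [NormedSpace ℝ F] {f : M → F}
    {y : Eu n} (hy : y ∈ e.target) (hf : MDifferentiableAt (𝓡 n) 𝓘(ℝ, F) f (e.symm y))
    (X : ∀ x : M, TangentSpace (𝓡 n) x) :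
    dirDeriv f (e.symm y) (X (e.symm y)) = fderiv ℝ (f ∘ e.symm) y (coordVF e X y) := by
  rw [dirDeriv, ← mfderiv_symm_coordVF he X hy, ← mfderiv_eq_fderiv,
    mfderiv_comp y hf ((contMDiffAt_chart_symm he hy).mdifferentiableAt (by simp))]
  rfl

end

end Coordinates

/-! ### Volume forms and their Lie derivatives in charts -/

section Coordinates

variable {n : ℕ}

/-- The standard basis of `ℝⁿ`. -/
abbrev stdBasis (n : ℕ) : Module.Basis (Fin n) ℝ (Eu n) := (EuclideanSpace.basisFun (Fin n) ℝ).toBasis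

theorem stdBasis_apply (i : Fin n) : stdBasis n i = EuclideanSpace.single i (1 : ℝ) := by
  simp [stdBasis]

/-- With V the matrix of `v`, Cramer's rule makes the i-th summand the i-th diagonal entry of adj(V)
A V. Cyclicity of the trace and V adj(V) = det V give the result. -/
theorem sum_det_update (A : Eu n →ₗ[ℝ] Eu n) (v : Fin n → Eu n) :
    ∑ i, (stdBasis n).det (Function.update v i (A (v i))) =
      LinearMap.trace ℝ _ A * (stdBasis n).det v := by
  set b := stdBasis n
  have h : ∀ i, b.det (Function.update v i (A (v i))) =
      ((b.toMatrix v).adjugate * LinearMap.toMatrix b b A * b.toMatrix v) i i := by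
    intro i
    rw [Module.Basis.det_apply, Module.Basis.toMatrix_update, ← Matrix.cramer_apply,
      Matrix.cramer_eq_adjugate_mulVec, ← LinearMap.toMatrix_mulVec_repr b b A (v i),
      Matrix.mulVec_mulVec]
    rfl
  simp only [h]
  change Matrix.trace _ = _
  rw [Matrix.trace_mul_comm, ← mul_assoc, Matrix.mul_adjugate, smul_mul_assoc, one_mul,
    Matrix.trace_smul, LinearMap.trace_eq_matrix_trace ℝ b A, Module.Basis.det_apply, smul_eq_mul,
    mul_comm]

theorem continuous_stdBasis_det : Continuous fun v : Fin n → Eu n => (stdBasis n).det v := by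
  simp only [Module.Basis.det_apply]
  refine Continuous.matrix_det ?_
  refine continuous_matrix fun i j => ?_
  simp [Module.Basis.toMatrix_apply, stdBasis]
  fun_prop

theorem hasFDerivAt_det {Y : Fin n → Eu n → Eu n} {Y' : Fin n → Eu n →L[ℝ] Eu n} {y : Eu n}
    (hY : ∀ i, HasFDerivAt (Y i) (Y' i) y) (v : Eu n) :
    ∃ L : Eu n →L[ℝ] ℝ, HasFDerivAt (fun z => (stdBasis n).det fun i => Y i z) L y ∧
      L v = ∑ i, (stdBasis n).det (Function.update (fun k => Y k y) i (Y' i v)) := by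
  let f : ContinuousMultilinearMap ℝ (fun _ : Fin n => Eu n) ℝ :=
    ⟨(stdBasis n).det.toMultilinearMap, continuous_stdBasis_det⟩
  refine ⟨_, HasFDerivAt.multilinear_comp f hY, ?_⟩
  simp [f, ContinuousMultilinearMap.toContinuousLinearMap]

variable {M : Type*} [TopologicalSpace M] [ChartedSpace (Eu n) M] [IsManifold (𝓡 n) ∞ M]

/-- The coefficient of the volume form in the coordinates of the chart `e`. -/
def VolumeForm.coef (Ω : VolumeForm n M) (e : OpenPartialHomeomorph M (Eu n)) (y : Eu n) : ℝ :=
  Ω.toFun (e.symm y) fun i =>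
    mfderiv (𝓡 n) (𝓡 n) e.symm y (EuclideanSpace.single i (1 : ℝ) : Eu n)

theorem VolumeForm.chartDensity_eq (Ω : VolumeForm n M) (e : OpenPartialHomeomorph M (Eu n))
    (y : Eu n) : Ω.chartDensity e y = ENNReal.ofReal |Ω.coef e y| := rfl

theorem VolumeForm.apply_mfderiv (Ω : VolumeForm n M) (e : OpenPartialHomeomorph M (Eu n))
    (y : Eu n) (v : Fin n → Eu n) :
    Ω.toFun (e.symm y) (fun i => mfderiv (𝓡 n) (𝓡 n) e.symm y (v i)) =
      Ω.coef e y * (stdBasis n).det v := by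
  let L : Eu n →ₗ[ℝ] TangentSpace (𝓡 n) (e.symm y) := (mfderiv (𝓡 n) (𝓡 n) e.symm y).toLinearMap
  have h := congrArg (fun f => f v)
    (((Ω.toFun (e.symm y)).compLinearMap L).eq_smul_basis_det (stdBasis n))
  have h2 : (((Ω.toFun (e.symm y)).compLinearMap L) (stdBasis n)) = Ω.coef e y := by
    rw [AlternatingMap.compLinearMap_apply, VolumeForm.coef]
    congr 1
    funext i
    rw [stdBasis_apply]
    rfl
  rw [h2] at h
  exact h

variable {e : OpenPartialHomeomorph M (Eu n)} (he : e ∈ atlas (Eu n) M)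
include he

theorem VolumeForm.apply_eq_coef_mul_det (Ω : VolumeForm n M) {y : Eu n} (hy : y ∈ e.target)
    (Y : Fin n → ∀ x : M, TangentSpace (𝓡 n) x) :
    Ω.toFun (e.symm y) (fun i => Y i (e.symm y)) =
      Ω.coef e y * (stdBasis n).det fun i => coordVF e (Y i) y := by
  rw [← VolumeForm.apply_mfderiv]
  congr 1
  funext i
  exact (mfderiv_symm_coordVF he (Y i) hy).symm

theorem VolumeForm.coef_ne_zero (Ω : VolumeForm n M) {y : Eu n} (hy : y ∈ e.target) :
    Ω.coef e y ≠ 0 := by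
  intro h
  apply Ω.ne_zero (e.symm y)
  ext v
  have := VolumeForm.apply_mfderiv Ω e y fun i => (mfderiv (𝓡 n) (𝓡 n) e.symm y).inverse (v i)
  rw [h, zero_mul] at this
  rw [AlternatingMap.zero_apply, ← this]
  congr 1
  funext i
  exact ((isInvertible_mfderiv_chart_symm he hy).self_apply_inverse _).symm

theorem smoothVFAt_mpullback_chart {X : Eu n → Eu n} {x : M} (hx : x ∈ e.source)
    (hX : ContDiffAt ℝ ∞ X (e x)) :
    SmoothVFAt (VectorField.mpullback (𝓡 n) (𝓡 n) e X) x :=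
  ContMDiffAt.mpullback_vectorField_preimage (V := X) (contMDiffAt_vectorSpace_iff_contDiffAt.2 hX)
    (contMDiffAt_chart he hx) (isInvertible_mfderiv_chart he hx) (by simp)

theorem mpullback_chart_symm (X : Eu n → Eu n) {y : Eu n} (hy : y ∈ e.target) :
    VectorField.mpullback (𝓡 n) (𝓡 n) e X (e.symm y) =
      mfderiv (𝓡 n) (𝓡 n) e.symm y (X y) := by
  have hd : e.MDifferentiable (𝓡 n) (𝓡 n) := mdifferentiable_of_mem_atlas he
  have hi := isInvertible_mfderiv_chart he (e.map_target hy)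
  have h2 := congrArg (fun L => L (X y)) (hd.comp_symm_deriv hy)
  have h3 : mfderiv (𝓡 n) (𝓡 n) e (e.symm y) (mfderiv (𝓡 n) (𝓡 n) e.symm y (X y)) =
      X (e (e.symm y)) := h2.trans (congrArg X (e.right_inv hy)).symm
  exact (congrArg (mfderiv (𝓡 n) (𝓡 n) e (e.symm y)).inverse h3.symm).trans
    (hi.inverse_apply_self _)

/-- Smoothness of a volume form is given on vector fields, so the coordinate fields are produced as
pullbacks of constant fields along the chart. -/
theorem VolumeForm.contDiffOn_coef (Ω : VolumeForm n M) : ContDiffOn ℝ ∞ (Ω.coef e) e.target := by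
  have h := Ω.smooth e.source
    (fun i => VectorField.mpullback (𝓡 n) (𝓡 n) e (fun _ => EuclideanSpace.single i (1 : ℝ)))
    e.open_source fun i => smoothVF_of_at fun x hx => smoothVFAt_mpullback_chart he hx contDiffAt_const
  have h2 : ContMDiffOn (𝓡 n) 𝓘(ℝ, ℝ) ∞ (Ω.coef e) e.target := by
    refine (h.comp (contMDiffOn_symm_of_mem_maximalAtlas (IsManifold.subset_maximalAtlas he))
      fun y hy => e.map_target hy).congr fun y hy => ?_
    rw [VolumeForm.coef, Function.comp_apply]
    congr 1
    funext i
    exact (mpullback_chart_symm he (fun _ => EuclideanSpace.single i (1 : ℝ)) hy).symm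
  exact contMDiffOn_iff_contDiffOn.1 h2

theorem VolumeForm.contDiffAt_coef (Ω : VolumeForm n M) {y : Eu n} (hy : y ∈ e.target) :
    ContDiffAt ℝ ∞ (Ω.coef e) y :=
  (Ω.contDiffOn_coef he).contDiffAt (e.open_target.mem_nhds hy)

/-- The divergence of `X` in the coordinates of the chart `e`. -/
def VolumeForm.coordDiv (Ω : VolumeForm n M) (e : OpenPartialHomeomorph M (Eu n))
    (X : ∀ x : M, TangentSpace (𝓡 n) x) (y : Eu n) : ℝ :=
  LinearMap.trace ℝ _ (fderiv ℝ (coordVF e X) y).toLinearMap +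
    fderiv ℝ (Ω.coef e) y (coordVF e X y) / Ω.coef e y

/-- In the chart Ω = ρ det and [X, Yᵢ] = DYᵢ(X) - DX(Yᵢ). The terms DYᵢ(X) cancel against the
product rule for det; what remains is Dρ(X) det(Y) plus ρ times the sum evaluated by
`sum_det_update`. -/
theorem VolumeForm.lieDeriv_eq (Ω : VolumeForm n M) {X : ∀ x : M, TangentSpace (𝓡 n) x}
    {Y : Fin n → ∀ x : M, TangentSpace (𝓡 n) x} {y : Eu n} (hy : y ∈ e.target)
    (hX : SmoothVFAt X (e.symm y)) (hY : ∀ i, SmoothVFAt (Y i) (e.symm y))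
    (hΩ : MDifferentiableAt (𝓡 n) 𝓘(ℝ, ℝ) (fun x => Ω.toFun x fun i => Y i x) (e.symm y)) :
    Ω.lieDeriv X Y (e.symm y) =
      Ω.coordDiv e X y * Ω.toFun (e.symm y) fun i => Y i (e.symm y) := by
  have hYd : ∀ i, HasFDerivAt (coordVF e (Y i)) (fderiv ℝ (coordVF e (Y i)) y) y := fun i =>
    (((hY i).contDiffAt_coordVF he hy).differentiableAt (by simp)).hasFDerivAt
  have hρ : HasFDerivAt (Ω.coef e) (fderiv ℝ (Ω.coef e) y) y :=
    ((Ω.contDiffAt_coef he hy).differentiableAt (by simp)).hasFDerivAt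
  obtain ⟨L, hL, hLv⟩ := hasFDerivAt_det hYd (coordVF e X y)
  have h1 : dirDeriv (fun x => Ω.toFun x fun i => Y i x) (e.symm y) (X (e.symm y)) =
      Ω.coef e y * L (coordVF e X y) +
        (stdBasis n).det (fun i => coordVF e (Y i) y) * fderiv ℝ (Ω.coef e) y (coordVF e X y) := by
    rw [dirDeriv_eq_fderiv he hy hΩ X]
    have heq : ((fun x => Ω.toFun x fun i => Y i x) ∘ e.symm) =ᶠ[𝓝 y]
        fun z => Ω.coef e z * (stdBasis n).det fun i => coordVF e (Y i) z := by
      filter_upwards [e.open_target.mem_nhds hy] with z hz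
      exact Ω.apply_eq_coef_mul_det he hz Y
    rw [heq.fderiv_eq, (hρ.fun_mul hL).fderiv]
    simp
  have h2 : ∀ i, Ω.toFun (e.symm y) (Function.update (fun k => Y k (e.symm y)) i
      (VectorField.mlieBracket (𝓡 n) X (Y i) (e.symm y))) = Ω.coef e y *
        ((stdBasis n).det (Function.update (fun k => coordVF e (Y k) y) i
          (fderiv ℝ (coordVF e (Y i)) y (coordVF e X y))) -
        (stdBasis n).det (Function.update (fun k => coordVF e (Y k) y) i
          (fderiv ℝ (coordVF e X) y (coordVF e (Y i) y)))) := by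
    intro i
    rw [← AlternatingMap.map_update_sub, ← coordVF_mlieBracket he hy hX (hY i)]
    have := Ω.apply_eq_coef_mul_det he hy
      (Function.update Y i (VectorField.mlieBracket (𝓡 n) X (Y i)))
    convert this using 2
    · funext k
      by_cases hk : k = i
      · subst hk
        simp
      · simp [hk]
    · congr 1
      funext k
      by_cases hk : k = i
      · subst hk
        simp
      · simp [hk]
  rw [VolumeForm.lieDeriv, h1, hLv, Ω.apply_eq_coef_mul_det he hy, VolumeForm.coordDiv]
  simp only [h2]
  rw [← Finset.mul_sum, Finset.sum_sub_distrib]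
  have h3 := sum_det_update (fderiv ℝ (coordVF e X) y).toLinearMap fun k => coordVF e (Y k) y
  simp only [ContinuousLinearMap.coe_coe] at h3
  rw [h3]
  field_simp [Ω.coef_ne_zero he hy]
  ring

end Coordinates

/-! ### Divergence of vector fields: locality, additivity, Leibniz rule, continuity -/

section Divergence

theorem eventually_chart_symm {n : ℕ} {M : Type*} [TopologicalSpace M]
    {e : OpenPartialHomeomorph M (Eu n)} {x : M} (hx : x ∈ e.source)
    {p : M → Prop} (hp : ∀ᶠ y in 𝓝 x, p y) : ∀ᶠ z in 𝓝 (e x), p (e.symm z) := by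
  have h := e.continuousAt_symm (e.map_source hx)
  rw [ContinuousAt, e.left_inv hx] at h
  exact h.eventually hp

variable {n : ℕ} {M : Type*} [TopologicalSpace M] [ChartedSpace (Eu n) M] [IsManifold (𝓡 n) ∞ M]
  (Ω : VolumeForm n M)

theorem VolumeForm.lieDeriv_eq_coordDiv {e : OpenPartialHomeomorph M (Eu n)}
    (he : e ∈ atlas (Eu n) M) {X : ∀ x : M, TangentSpace (𝓡 n) x}
    {Y : Fin n → ∀ x : M, TangentSpace (𝓡 n) x} {x : M} (hx : x ∈ e.source)
    (hX : SmoothVFAt X x) {U : Set M} (hU : IsOpen U) (hxU : x ∈ U)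
    (hY : ∀ i, SmoothVF (Y i) U) :
    Ω.lieDeriv X Y x = Ω.coordDiv e X (e x) * Ω.toFun x fun i => Y i x := by
  have hΩ := ((Ω.smooth U Y hU hY).contMDiffAt (hU.mem_nhds hxU)).mdifferentiableAt (by simp)
  have hY' := fun i => (hY i).at hU hxU
  have h := e.left_inv hx
  have hy := e.map_source hx
  -- Writing the point as the image of a free coordinate `y` allows the substitution, since `x`
  -- occurs in the types of the tangent vectors.
  generalize e x = y at h hy
  subst h
  exact Ω.lieDeriv_eq he hy hX hY' hΩ

theorem VolumeForm.exists_frame_ne_zero {e : OpenPartialHomeomorph M (Eu n)}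
    (he : e ∈ atlas (Eu n) M) : ∃ Y : Fin n → ∀ x : M, TangentSpace (𝓡 n) x,
      (∀ i, SmoothVF (Y i) e.source) ∧ ∀ x ∈ e.source, Ω.toFun x (fun i => Y i x) ≠ 0 := by
  refine ⟨fun i => VectorField.mpullback (𝓡 n) (𝓡 n) e (fun _ => EuclideanSpace.single i (1 : ℝ)),
    fun i => smoothVF_of_at fun x hx => smoothVFAt_mpullback_chart he hx contDiffAt_const,
    fun x hx => ?_⟩
  have h := e.left_inv hx
  have hy := e.map_source hx
  generalize e x = y at h hy
  subst h
  convert Ω.coef_ne_zero he hy using 1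
  rw [VolumeForm.coef]
  congr 1
  funext i
  exact mpullback_chart_symm he (fun _ => EuclideanSpace.single i (1 : ℝ)) hy

/-- The coordinate expression witnesses the property chosen by `Classical.epsilon`, and a local
frame on which Ω does not vanish makes the number unique. -/
theorem VolumeForm.divergence_eq_coordDiv {e : OpenPartialHomeomorph M (Eu n)}
    (he : e ∈ atlas (Eu n) M) {X : ∀ x : M, TangentSpace (𝓡 n) x} {x : M} (hx : x ∈ e.source)
    (hX : SmoothVFAt X x) : Ω.divergence X x = Ω.coordDiv e X (e x) := by
  have hex : ∃ c : ℝ, ∀ (U : Set M) (Y : Fin n → ∀ y : M, TangentSpace (𝓡 n) y), IsOpen U →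
      x ∈ U → (∀ i, SmoothVF (Y i) U) → Ω.lieDeriv X Y x = c * Ω.toFun x fun i => Y i x :=
    ⟨_, fun U Y hU hxU hY => Ω.lieDeriv_eq_coordDiv he hx hX hU hxU hY⟩
  obtain ⟨Y, hY, hne⟩ := Ω.exists_frame_ne_zero he
  have h1 := Classical.epsilon_spec hex e.source Y e.open_source hx hY
  have h2 := Ω.lieDeriv_eq_coordDiv he hx hX e.open_source hx hY
  exact mul_right_cancel₀ (hne x hx) (h1.symm.trans h2)

theorem VolumeForm.lieDeriv_eq_divergence {X : ∀ x : M, TangentSpace (𝓡 n) x}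
    {Y : Fin n → ∀ x : M, TangentSpace (𝓡 n) x} {x : M}
    (hX : SmoothVFAt X x) {U : Set M} (hU : IsOpen U) (hxU : x ∈ U)
    (hY : ∀ i, SmoothVF (Y i) U) :
    Ω.lieDeriv X Y x = Ω.divergence X x * Ω.toFun x fun i => Y i x := by
  rw [Ω.divergence_eq_coordDiv (chart_mem_atlas (Eu n) x) (mem_chart_source _ x) hX]
  exact Ω.lieDeriv_eq_coordDiv (chart_mem_atlas (Eu n) x) (mem_chart_source _ x) hX hU hxU hY

theorem VolumeForm.divergence_congr {X X' : ∀ x : M, TangentSpace (𝓡 n) x} {x : M}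
    (hX : SmoothVFAt X x) (h : ∀ᶠ y in 𝓝 x, X' y = X y) :
    Ω.divergence X' x = Ω.divergence X x := by
  rw [Ω.divergence_eq_coordDiv (chart_mem_atlas (Eu n) x) (mem_chart_source _ x) hX,
    Ω.divergence_eq_coordDiv (chart_mem_atlas (Eu n) x) (mem_chart_source _ x) (hX.congr h)]
  have h' : coordVF (chartAt (Eu n) x) X' =ᶠ[𝓝 (chartAt (Eu n) x x)]
      coordVF (chartAt (Eu n) x) X := by
    filter_upwards [eventually_chart_symm (mem_chart_source _ x) h] with z hz
    rw [coordVF, coordVF, VectorField.mpullback_apply, VectorField.mpullback_apply, hz]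
  rw [VolumeForm.coordDiv, VolumeForm.coordDiv, h'.fderiv_eq, h'.eq_of_nhds]

theorem VolumeForm.divergence_add {X Y : ∀ x : M, TangentSpace (𝓡 n) x} {x : M}
    (hX : SmoothVFAt X x) (hY : SmoothVFAt Y x) :
    Ω.divergence (fun y => X y + Y y) x = Ω.divergence X x + Ω.divergence Y x := by
  have hc := chart_mem_atlas (Eu n) x
  have hs := mem_chart_source (Eu n) x
  rw [Ω.divergence_eq_coordDiv hc hs hX, Ω.divergence_eq_coordDiv hc hs hY,
    Ω.divergence_eq_coordDiv hc hs (hX.add hY)]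
  have hy := (chartAt (Eu n) x).map_source hs
  rw [← (chartAt (Eu n) x).left_inv hs] at hX hY
  have h' : coordVF (chartAt (Eu n) x) (fun y => X y + Y y) =
      fun z => coordVF (chartAt (Eu n) x) X z + coordVF (chartAt (Eu n) x) Y z := by
    funext z
    exact map_add _ _ _
  have dX := (hX.contDiffAt_coordVF hc hy).differentiableAt (by simp)
  have dY := (hY.contDiffAt_coordVF hc hy).differentiableAt (by simp)
  rw [VolumeForm.coordDiv, VolumeForm.coordDiv, VolumeForm.coordDiv, h', fderiv_fun_add dX dY,
    map_add, ContinuousLinearMap.toLinearMap_add, map_add]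
  ring

/-- The derivative of fX differs from f DX by the rank-one map v ↦ Df(v) X, whose trace is X(f). -/
theorem VolumeForm.divergence_smul {f : M → ℝ} {X : ∀ x : M, TangentSpace (𝓡 n) x} {x : M}
    (hf : ContMDiffAt (𝓡 n) 𝓘(ℝ, ℝ) ∞ f x) (hX : SmoothVFAt X x) :
    Ω.divergence (fun y => f y • X y) x = f x * Ω.divergence X x + dirDeriv f x (X x) := by
  have hc := chart_mem_atlas (Eu n) x
  have hs := mem_chart_source (Eu n) x
  rw [Ω.divergence_eq_coordDiv hc hs hX, Ω.divergence_eq_coordDiv hc hs (hX.smul hf)]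
  have hy := (chartAt (Eu n) x).map_source hs
  have hl := (chartAt (Eu n) x).left_inv hs
  generalize chartAt (Eu n) x x = y at hl hy
  generalize chartAt (Eu n) x = e at *
  subst hl
  have h' : coordVF e (fun y => f y • X y) = fun z => (f ∘ e.symm) z • coordVF e X z := by
    funext z
    exact map_smul _ _ _
  have dX := (hX.contDiffAt_coordVF hc hy).differentiableAt (by simp)
  have df : DifferentiableAt ℝ (f ∘ e.symm) y :=
    (ContMDiffAt.comp y hf (contMDiffAt_chart_symm hc hy)).contDiffAt.differentiableAt (by simp)
  rw [dirDeriv_eq_fderiv hc hy (hf.mdifferentiableAt (by simp)), VolumeForm.coordDiv,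
    VolumeForm.coordDiv, h', fderiv_fun_smul df dX]
  have ht : LinearMap.trace ℝ (Eu n)
      ((fderiv ℝ (f ∘ e.symm) y).smulRight (coordVF e X y)).toLinearMap =
        fderiv ℝ (f ∘ e.symm) y (coordVF e X y) := by
    exact LinearMap.trace_smulRight _ _
  rw [ContinuousLinearMap.toLinearMap_add, map_add, ht, ContinuousLinearMap.toLinearMap_smul,
    map_smul, map_smul]
  simp only [Function.comp_apply, smul_eq_mul]
  ring

theorem VolumeForm.divergence_zero (x : M) :
    Ω.divergence (fun y : M => (0 : TangentSpace (𝓡 n) y)) x = 0 := by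
  have := Ω.divergence_add (smoothVFAt_zero x) (smoothVFAt_zero x)
  simp only [add_zero] at this
  linarith

theorem VolumeForm.divergence_sum {κ : Type*} (s : Finset κ)
    {X : κ → ∀ x : M, TangentSpace (𝓡 n) x} {x : M} (hX : ∀ i ∈ s, SmoothVFAt (X i) x) :
    Ω.divergence (fun y => ∑ i ∈ s, X i y) x = ∑ i ∈ s, Ω.divergence (X i) x := by
  classical
  induction s using Finset.induction_on with
  | empty => simpa using Ω.divergence_zero x
  | insert i s hi ih =>
    have h := Ω.divergence_add (hX i (Finset.mem_insert_self i s))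
      (SmoothVFAt.sum fun j hj => hX j (Finset.mem_insert_of_mem hj))
    simp only [Finset.sum_insert hi]
    rw [h, ih fun j hj => hX j (Finset.mem_insert_of_mem hj)]

theorem VolumeForm.continuousAt_coordDiv {e : OpenPartialHomeomorph M (Eu n)}
    (he : e ∈ atlas (Eu n) M) {X : ∀ x : M, TangentSpace (𝓡 n) x} {y : Eu n} (hy : y ∈ e.target)
    (hX : SmoothVFAt X (e.symm y)) : ContinuousAt (Ω.coordDiv e X) y := by
  have h1 := hX.contDiffAt_coordVF he hy
  have h2 : ContinuousAt (fderiv ℝ (coordVF e X)) y :=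
    (h1.fderiv_right (m := 0) (by simp)).continuousAt
  have h3 := Ω.contDiffAt_coef he hy
  have h4 : ContinuousAt (fderiv ℝ (Ω.coef e)) y :=
    (h3.fderiv_right (m := 0) (by simp)).continuousAt
  have h5 : Continuous fun A : Eu n →L[ℝ] Eu n => LinearMap.trace ℝ (Eu n) A.toLinearMap := by
    have : Continuous ((LinearMap.trace ℝ (Eu n)).comp (ContinuousLinearMap.coeLM ℝ)) :=
      LinearMap.continuous_of_finiteDimensional _
    exact this
  exact (h5.continuousAt.comp h2).add ((h4.clm_apply h1.continuousAt).div h3.continuousAt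
    (Ω.coef_ne_zero he hy))

theorem VolumeForm.continuousOn_divergence {X : ∀ x : M, TangentSpace (𝓡 n) x} {U : Set M}
    (hU : IsOpen U) (hX : SmoothVF X U) : ContinuousOn (Ω.divergence X) U := by
  intro x hx
  refine ContinuousAt.continuousWithinAt ?_
  have hc := chart_mem_atlas (Eu n) x
  have hs := mem_chart_source (Eu n) x
  have h1 : ContinuousAt (Ω.coordDiv (chartAt (Eu n) x) X ∘ chartAt (Eu n) x) x := by
    refine ContinuousAt.comp (Ω.continuousAt_coordDiv hc ((chartAt (Eu n) x).map_source hs) ?_)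
      ((chartAt (Eu n) x).continuousAt hs)
    rw [(chartAt (Eu n) x).left_inv hs]
    exact hX.at hU hx
  refine h1.congr ?_
  filter_upwards [hU.mem_nhds hx, (chartAt (Eu n) x).open_source.mem_nhds hs] with z hz hz'
  exact (Ω.divergence_eq_coordDiv hc hz' (hX.at hU hz)).symm

end Divergence

/-! ### The measure of a volume form -/

section Measure

open MeasureTheory

variable {n : ℕ} {M : Type*} [TopologicalSpace M] [ChartedSpace (Eu n) M] [IsManifold (𝓡 n) ∞ M]
  (Ω : VolumeForm n M)

/-- The value of a volume form on the images of the standard basis vectors under the differential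
of `g` only depends on the germ of `g`. -/
theorem VolumeForm.apply_mfderiv_congr {g h : Eu n → M} {y : Eu n} (hgh : g =ᶠ[𝓝 y] h)
    (v : Fin n → Eu n) :
    Ω.toFun (g y) (fun i => mfderiv (𝓡 n) (𝓡 n) g y (v i)) =
      Ω.toFun (h y) (fun i => mfderiv (𝓡 n) (𝓡 n) h y (v i)) := by
  have h1 : ∀ (a b : M) (w w' : Fin n → Eu n), a = b → w = w' →
      (Ω.toFun a : (Fin n → Eu n) → ℝ) w = (Ω.toFun b : (Fin n → Eu n) → ℝ) w' := by
    rintro a b w w' rfl rfl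
    rfl
  refine h1 _ _ _ _ hgh.eq_of_nhds ?_
  funext i
  have h2 : (mfderiv (𝓡 n) (𝓡 n) g y : Eu n → Eu n) = mfderiv (𝓡 n) (𝓡 n) h y :=
    congrArg (fun L : Eu n →L[ℝ] Eu n => (L : Eu n → Eu n)) hgh.mfderiv_eq
  exact congrFun h2 (v i)

variable {e e' : OpenPartialHomeomorph M (Eu n)}

theorem contDiffAt_transition (he : e ∈ atlas (Eu n) M) (he' : e' ∈ atlas (Eu n) M) {y : Eu n}
    (hy : y ∈ e.target) (hy' : e.symm y ∈ e'.source) : ContDiffAt ℝ ∞ (e' ∘ e.symm) y :=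
  (ContMDiffAt.comp y (contMDiffAt_chart he' hy') (contMDiffAt_chart_symm he hy)).contDiffAt

theorem VolumeForm.coef_transition (he : e ∈ atlas (Eu n) M) (he' : e' ∈ atlas (Eu n) M) {y : Eu n}
    (hy : y ∈ e.target) (hy' : e.symm y ∈ e'.source) :
    Ω.coef e y = Ω.coef e' (e' (e.symm y)) * (fderiv ℝ (e' ∘ e.symm) y).det := by
  have hgerm : e.symm =ᶠ[𝓝 y] e'.symm ∘ (e' ∘ e.symm) := by
    filter_upwards [(e.continuousAt_symm hy).eventually (e'.open_source.mem_nhds hy')] with z hz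
    exact (e'.left_inv hz).symm
  have hz' : e' (e.symm y) ∈ e'.target := e'.map_source hy'
  have hτ : MDifferentiableAt (𝓡 n) (𝓡 n) (e' ∘ e.symm) y :=
    (ContMDiffAt.comp y (contMDiffAt_chart he' hy')
      (contMDiffAt_chart_symm he hy)).mdifferentiableAt (by simp)
  have hs : MDifferentiableAt (𝓡 n) (𝓡 n) e'.symm ((e' ∘ e.symm) y) :=
    (contMDiffAt_chart_symm he' hz').mdifferentiableAt (by simp)
  have h1 := Ω.apply_mfderiv_congr hgerm fun i => EuclideanSpace.single i (1 : ℝ)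
  have h2 := Ω.apply_mfderiv e' (e' (e.symm y))
    fun i => fderiv ℝ (e' ∘ e.symm) y (EuclideanSpace.single i (1 : ℝ))
  rw [VolumeForm.coef, h1, mfderiv_comp y hs hτ]
  refine Eq.trans ?_ (h2.trans ?_)
  · rw [← mfderiv_eq_fderiv]
    rfl
  · congr 1
    have h3 := (stdBasis n).det_comp (fderiv ℝ (e' ∘ e.symm) y).toLinearMap (stdBasis n)
    rw [Module.Basis.det_self, mul_one] at h3
    refine Eq.trans ?_ h3
    congr 1
    funext i
    rw [Function.comp_apply, stdBasis_apply]
    rfl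

variable [MeasurableSpace M] [BorelSpace M]

/-- The measure of the volume form in the chart `e`, as a measure on `M`. -/
def VolumeForm.chartMeasure (e : OpenPartialHomeomorph M (Eu n)) : Measure M :=
  ((volume.restrict e.target).withDensity (Ω.chartDensity e)).map e.symm

/-- The inverse chart is continuous only on its target, so measurability is obtained on the subtype
and transported back. -/
theorem measurableSet_target_inter (e : OpenPartialHomeomorph M (Eu n)) {A : Set M}
    (hA : MeasurableSet A) : MeasurableSet (e.target ∩ e.symm ⁻¹' A) := by
  have h := (continuousOn_iff_continuous_domRestrict.1 e.continuousOn_symm).measurable hA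
  have h2 := e.open_target.measurableSet.subtype_image h
  convert h2 using 1
  ext y
  simp [Set.mem_image, and_comm]

theorem VolumeForm.aemeasurable_symm (e : OpenPartialHomeomorph M (Eu n)) :
    AEMeasurable e.symm ((volume.restrict e.target).withDensity (Ω.chartDensity e)) :=
  (e.continuousOn_symm.aemeasurable e.open_target.measurableSet).mono_ac
    (withDensity_absolutelyContinuous _ _)

theorem VolumeForm.chartMeasure_apply (e : OpenPartialHomeomorph M (Eu n)) {A : Set M}
    (hA : MeasurableSet A) :
    Ω.chartMeasure e A = ∫⁻ y in e.target ∩ e.symm ⁻¹' A, Ω.chartDensity e y := by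
  rw [VolumeForm.chartMeasure, Measure.map_apply_of_aemeasurable (Ω.aemeasurable_symm e) hA]
  set ν := (volume.restrict e.target).withDensity (Ω.chartDensity e)
  have h0 : ν e.targetᶜ = 0 :=
    withDensity_absolutelyContinuous _ _ (by simp [Measure.restrict_apply'
      e.open_target.measurableSet])
  have h1 : ν (e.symm ⁻¹' A) = ν (e.target ∩ e.symm ⁻¹' A) := by
    refine measure_congr ?_
    have : ∀ᵐ y ∂ν, y ∈ e.target := by
      rw [ae_iff]
      exact h0
    filter_upwards [this] with y hy
    exact propext ⟨fun h => ⟨hy, h⟩, fun h => h.2⟩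
  rw [h1, withDensity_apply _ (measurableSet_target_inter e hA),
    Measure.restrict_restrict (measurableSet_target_inter e hA)]
  congr 2
  ext y
  simp +contextual

/-- Change of variables along the transition map: its Jacobian is exactly the factor by which the
two densities differ. -/
theorem VolumeForm.chartMeasure_eq_on_inter (he : e ∈ atlas (Eu n) M) (he' : e' ∈ atlas (Eu n) M)
    {A : Set M} (hA : MeasurableSet A) (hAe : A ⊆ e.source) (hAe' : A ⊆ e'.source) :
    Ω.chartMeasure e' A = Ω.chartMeasure e A := by
  rw [Ω.chartMeasure_apply e hA, Ω.chartMeasure_apply e' hA]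
  have himg : e'.target ∩ e'.symm ⁻¹' A = (e' ∘ e.symm) '' (e.target ∩ e.symm ⁻¹' A) := by
    ext z
    constructor
    · rintro ⟨hz, hzA⟩
      refine ⟨e (e'.symm z), ⟨e.map_source (hAe hzA), ?_⟩, ?_⟩
      · rw [Set.mem_preimage, e.left_inv (hAe hzA)]
        exact hzA
      · rw [Function.comp_apply, e.left_inv (hAe hzA), e'.right_inv hz]
    · rintro ⟨y, ⟨hy, hyA⟩, rfl⟩
      refine ⟨e'.map_source (hAe' hyA), ?_⟩
      rw [Set.mem_preimage, Function.comp_apply, e'.left_inv (hAe' hyA)]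
      exact hyA
  have hinj : Set.InjOn (e' ∘ e.symm) (e.target ∩ e.symm ⁻¹' A) := by
    rintro y ⟨hy, hyA⟩ z ⟨hz, hzA⟩ hyz
    exact e.symm.injOn hy hz (e'.injOn (hAe' hyA) (hAe' hzA) hyz)
  rw [himg, lintegral_image_eq_lintegral_abs_det_fderiv_mul volume
    (measurableSet_target_inter e hA) (f' := fderiv ℝ (e' ∘ e.symm)) (fun y hy =>
      ((contDiffAt_transition he he' hy.1 (hAe' hy.2)).differentiableAt
        (by simp)).hasFDerivAt.hasFDerivWithinAt) hinj]
  refine setLIntegral_congr_fun (measurableSet_target_inter e hA) fun y hy => ?_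
  simp only [Ω.chartDensity_eq, Function.comp_apply]
  rw [Ω.coef_transition he he' hy.1 (hAe' hy.2), abs_mul, ← ENNReal.ofReal_mul (abs_nonneg _),
    mul_comm]

theorem VolumeForm.measure_eq : Ω.measure = ⨆ e ∈ atlas (Eu n) M, Ω.chartMeasure e := rfl

/-- For the upper bound, every chart measure is dominated by that of `e` plus the largest measure
restricted to the complement of `e.source`; this bounds the supremum, and the added term does not
see `A`. -/
theorem VolumeForm.measure_apply (he : e ∈ atlas (Eu n) M) {A : Set M} (hA : MeasurableSet A)
    (hAe : A ⊆ e.source) : Ω.measure A = Ω.chartMeasure e A := by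
  refine le_antisymm ?_ ?_
  · have h : Ω.measure ≤ Ω.chartMeasure e + (⊤ : Measure M).restrict e.sourceᶜ := by
      rw [Ω.measure_eq]
      refine iSup₂_le fun e' he' => ?_
      refine Measure.le_iff.2 fun B hB => ?_
      rw [Measure.add_apply, Measure.restrict_apply hB, ← measure_inter_add_sdiff B
        e.open_source.measurableSet]
      refine add_le_add ?_ ?_
      -- The measure of the chart `e'` is concentrated on `e'.source`, so only the overlap counts.
      · have h1 : Ω.chartMeasure e' (B ∩ e.source) =
            Ω.chartMeasure e' (B ∩ e.source ∩ e'.source) := by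
          rw [Ω.chartMeasure_apply e' (hB.inter e.open_source.measurableSet),
            Ω.chartMeasure_apply e' ((hB.inter e.open_source.measurableSet).inter
              e'.open_source.measurableSet)]
          congr 2
          ext y
          constructor
          · rintro ⟨hy, hyB⟩
            exact ⟨hy, hyB, e'.map_target hy⟩
          · rintro ⟨hy, hyB, -⟩
            exact ⟨hy, hyB⟩
        rw [h1, Ω.chartMeasure_eq_on_inter he he' ((hB.inter e.open_source.measurableSet).inter
              e'.open_source.measurableSet) (fun x hx => hx.1.2) fun x hx => hx.2]
        exact measure_mono fun x hx => hx.1.1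
      · rw [Set.sdiff_eq]
        exact Measure.le_iff'.1 le_top _
    have h2 := Measure.le_iff'.1 h A
    rw [Measure.add_apply, Measure.restrict_apply hA, (Set.disjoint_compl_right_iff_subset.2
      hAe).inter_eq, measure_empty, add_zero] at h2
    exact h2
  · have h : Ω.chartMeasure e ≤ Ω.measure := by
      rw [Ω.measure_eq]
      exact le_iSup₂_of_le e he le_rfl
    exact Measure.le_iff'.1 h A

theorem VolumeForm.measure_restrict (he : e ∈ atlas (Eu n) M) :
    Ω.measure.restrict e.source = Ω.chartMeasure e := by
  ext A hA
  rw [Measure.restrict_apply hA, Ω.measure_apply he (hA.inter e.open_source.measurableSet)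
    Set.inter_subset_right, Ω.chartMeasure_apply e hA, Ω.chartMeasure_apply e
    (hA.inter e.open_source.measurableSet)]
  congr 2
  ext y
  constructor
  · rintro ⟨hy, hyB, -⟩
    exact ⟨hy, hyB⟩
  · rintro ⟨hy, hyB⟩
    exact ⟨hy, hyB, e.map_target hy⟩

/-- The density is continuous, hence bounded on a small coordinate ball. Continuous functions with
compact support are therefore integrable, the only source of integrability used below. -/
theorem VolumeForm.isLocallyFiniteMeasure : IsLocallyFiniteMeasure Ω.measure := by
  refine ⟨fun x => ?_⟩
  set e := chartAt (Eu n) x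
  have he : e ∈ atlas (Eu n) M := chart_mem_atlas (Eu n) x
  have hx : x ∈ e.source := mem_chart_source (Eu n) x
  have hc : ContinuousAt (fun y => |Ω.coef e y|) (e x) :=
    (Ω.contDiffAt_coef he (e.map_source hx)).continuousAt.abs
  have h1 : ∀ᶠ y in 𝓝 (e x), |Ω.coef e y| < |Ω.coef e (e x)| + 1 ∧ y ∈ e.target :=
    (hc.eventually_lt continuousAt_const (by linarith)).and
      (e.open_target.mem_nhds (e.map_source hx))
  obtain ⟨r, hr, hball⟩ := Metric.eventually_nhds_iff_ball.1 h1
  have hopen : IsOpen (e.source ∩ e ⁻¹' Metric.ball (e x) r) :=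
    e.isOpen_inter_preimage Metric.isOpen_ball
  refine ⟨_, hopen.mem_nhds ⟨hx, Metric.mem_ball_self hr⟩, ?_⟩
  rw [Ω.measure_apply he hopen.measurableSet Set.inter_subset_left,
    Ω.chartMeasure_apply e hopen.measurableSet]
  calc _ ≤ ∫⁻ y in Metric.ball (e x) r, Ω.chartDensity e y := by
        refine lintegral_mono_set ?_
        rintro y ⟨hy, -, hy2⟩
        rwa [Set.mem_preimage, e.right_inv hy] at hy2
    _ ≤ ∫⁻ _ in Metric.ball (e x) r, ENNReal.ofReal (|Ω.coef e (e x)| + 1) := by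
        refine setLIntegral_mono measurable_const fun y hy => ?_
        exact ENNReal.ofReal_le_ofReal (hball y hy).1.le
    _ < ⊤ := by
        rw [setLIntegral_const]
        exact ENNReal.mul_lt_top ENNReal.ofReal_lt_top measure_ball_lt_top

/-- The density vanishes nowhere on a chart. The converse direction needs this to conclude that a
nonnegative continuous function which is not zero has positive integral. -/
theorem VolumeForm.isOpenPosMeasure : Ω.measure.IsOpenPosMeasure := by
  refine ⟨fun U hU hne h0 => ?_⟩
  obtain ⟨x, hxU⟩ := hne
  set e := chartAt (Eu n) x
  have he : e ∈ atlas (Eu n) M := chart_mem_atlas (Eu n) x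
  have hx : x ∈ e.source := mem_chart_source (Eu n) x
  have h1 : Ω.measure (U ∩ e.source) = 0 := measure_mono_null Set.inter_subset_left h0
  have hm : MeasurableSet (U ∩ e.source) := (hU.inter e.open_source).measurableSet
  rw [Ω.measure_apply he hm Set.inter_subset_right, Ω.chartMeasure_apply e hm] at h1
  have hW : IsOpen (e.target ∩ e.symm ⁻¹' (U ∩ e.source)) :=
    e.symm.isOpen_inter_preimage (hU.inter e.open_source)
  have hmeas : AEMeasurable (Ω.chartDensity e)
      (volume.restrict (e.target ∩ e.symm ⁻¹' (U ∩ e.source))) := by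
    refine ENNReal.measurable_ofReal.comp_aemeasurable ?_
    refine ContinuousOn.aemeasurable ?_ hW.measurableSet
    exact ((Ω.contDiffOn_coef he).continuousOn.mono Set.inter_subset_left).abs
  rw [setLIntegral_eq_zero_iff' hW.measurableSet hmeas] at h1
  refine (hW.measure_pos volume ⟨e x, e.map_source hx, ?_⟩).ne' ?_
  · rw [Set.mem_preimage, e.left_inv hx]
    exact ⟨hxU, hx⟩
  · refine measure_mono_null (fun y hy => ?_) h1
    intro h2
    have h3 := h2 hy
    rw [Ω.chartDensity_eq, ENNReal.ofReal_eq_zero] at h3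
    exact Ω.coef_ne_zero he hy.1 (abs_nonpos_iff.1 h3)

theorem VolumeForm.integral_eq (he : e ∈ atlas (Eu n) M) {f : M → ℝ}
    (hf : ∀ x, x ∉ e.source → f x = 0) (hfm : AEStronglyMeasurable f Ω.measure) :
    ∫ x, f x ∂Ω.measure = ∫ y in e.target, |Ω.coef e y| * f (e.symm y) := by
  rw [← setIntegral_eq_integral_of_forall_compl_eq_zero hf, Ω.measure_restrict he,
    VolumeForm.chartMeasure, integral_map (Ω.aemeasurable_symm e)]
  · rw [integral_withDensity_eq_integral_toReal_smul₀]
    · refine integral_congr_ae (Filter.Eventually.of_forall fun y => ?_)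
      simp [Ω.chartDensity_eq]
    · refine ENNReal.measurable_ofReal.comp_aemeasurable ?_
      refine ContinuousOn.aemeasurable ?_ e.open_target.measurableSet
      exact (Ω.contDiffOn_coef he).continuousOn.abs
    · exact Filter.Eventually.of_forall fun y => ENNReal.ofReal_lt_top
  · have := hfm.restrict (s := e.source)
    rwa [Ω.measure_restrict he] at this

end Measure

/-! ### The divergence theorem for compactly supported fields -/

section DivergenceTheorem

open MeasureTheory

/-- Integration by parts against the constant function 1. -/
theorem integral_fderiv_eq_zero_of_hasCompactSupport {n : ℕ} {f : Eu n → ℝ} (hf : ContDiff ℝ 1 f)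
    (hs : HasCompactSupport f) (v : Eu n) : ∫ y, fderiv ℝ f y v = 0 := by
  have hint : Integrable (fun y => fderiv ℝ f y v) :=
    ((hf.continuous_fderiv (by simp)).clm_apply continuous_const).integrable_of_hasCompactSupport
      ((hs.fderiv (𝕜 := ℝ)).mono fun y hy h => hy (by simp [h]))
  have h := integral_mul_fderiv_eq_neg_fderiv_mul_of_integrable (𝕜 := ℝ) (μ := volume)
    (f := fun _ : Eu n => (1 : ℝ)) (g := f) (v := v) (by simp)
    (by simpa using hint) (by simpa using hf.continuous.integrable_of_hasCompactSupport hs)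
    (fun x _ => differentiableAt_const _) (fun x _ => hf.differentiable (by simp) x)
  simpa using h

theorem integral_trace_fderiv_eq_zero {n : ℕ} {F : Eu n → Eu n} (hF : ContDiff ℝ 1 F)
    (hs : HasCompactSupport F) :
    ∫ y, LinearMap.trace ℝ (Eu n) (fderiv ℝ F y).toLinearMap = 0 := by
  set b := EuclideanSpace.basisFun (Fin n) ℝ
  have h1 : ∀ i, ContDiff ℝ 1 fun y => ⟪b i, F y⟫_ℝ := fun i => contDiff_const.inner ℝ hF
  have h2 : ∀ i, HasCompactSupport fun y => ⟪b i, F y⟫_ℝ := fun i =>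
    hs.mono fun y hy h => hy (by simp [h])
  have h3 : ∀ i y, fderiv ℝ (fun y => ⟪b i, F y⟫_ℝ) y (b i) = ⟪b i, fderiv ℝ F y (b i)⟫_ℝ := by
    intro i y
    rw [fderiv_inner_apply ℝ (differentiableAt_const _) (hF.differentiable (by simp) y)]
    simp
  have h4 : ∀ y, LinearMap.trace ℝ (Eu n) (fderiv ℝ F y).toLinearMap =
      ∑ i, fderiv ℝ (fun y => ⟪b i, F y⟫_ℝ) y (b i) := by
    intro y
    rw [LinearMap.trace_eq_sum_inner _ b]
    exact Finset.sum_congr rfl fun i _ => (h3 i y).symm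
  simp only [h4]
  rw [integral_finsetSum]
  · exact Finset.sum_eq_zero fun i _ =>
      integral_fderiv_eq_zero_of_hasCompactSupport (h1 i) (h2 i) (b i)
  · intro i _
    exact (((h1 i).continuous_fderiv (by simp)).clm_apply
      continuous_const).integrable_of_hasCompactSupport
      (((h2 i).fderiv (𝕜 := ℝ)).mono fun y hy h => hy (by simp [h]))

variable {n : ℕ} {M : Type*} [TopologicalSpace M] [ChartedSpace (Eu n) M] [IsManifold (𝓡 n) ∞ M]
  [T2Space M] (Ω : VolumeForm n M)

theorem VolumeForm.divergence_eq_zero {X : ∀ x : M, TangentSpace (𝓡 n) x} {K : Set M}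
    (hK : IsClosed K) (h0 : ∀ x, x ∉ K → X x = 0) {x : M} (hx : x ∉ K) :
    Ω.divergence X x = 0 := by
  rw [Ω.divergence_congr (smoothVFAt_zero x) (X' := X)]
  · exact Ω.divergence_zero x
  · filter_upwards [hK.isOpen_compl.mem_nhds hx] with y hy using h0 y hy

variable [MeasurableSpace M] [BorelSpace M]

/-- In coordinates |ρ| Div X is the Euclidean divergence of |ρ| X, and this field, extended by zero,
is C¹ with compact support on all of ℝⁿ. -/
theorem VolumeForm.integral_divergence_of_subset_chart {e : OpenPartialHomeomorph M (Eu n)}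
    (he : e ∈ atlas (Eu n) M) {X : ∀ x : M, TangentSpace (𝓡 n) x} (hX : SmoothVF X Set.univ)
    {K : Set M} (hK : IsCompact K) (hKe : K ⊆ e.source) (h0 : ∀ x, x ∉ K → X x = 0) :
    ∫ x, Ω.divergence X x ∂Ω.measure = 0 := by
  have hXa : ∀ x, SmoothVFAt X x := fun x => hX.at isOpen_univ (Set.mem_univ x)
  have hdiv0 : ∀ x, x ∉ e.source → Ω.divergence X x = 0 := fun x hx =>
    Ω.divergence_eq_zero hK.isClosed h0 fun h => hx (hKe h)
  have hcont : Continuous (Ω.divergence X) :=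
    continuousOn_univ.1 (Ω.continuousOn_divergence isOpen_univ hX)
  rw [Ω.integral_eq he hdiv0 hcont.aestronglyMeasurable]
  set F : Eu n → Eu n := e.target.indicator fun y => |Ω.coef e y| • coordVF e X y with hFdef
  have hK' : IsCompact (e '' K) := hK.image_of_continuousOn (e.continuousOn.mono hKe)
  have hF0 : ∀ y, y ∉ e '' K → F y = 0 := by
    intro y hy
    by_cases hyt : y ∈ e.target
    · have : X (e.symm y) = 0 := h0 _ fun h => hy ⟨_, h, e.right_inv hyt⟩
      have h1 : coordVF e X y = 0 := by
        rw [coordVF, VectorField.mpullback_apply, this]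
        exact map_zero _
      rw [hFdef, Set.indicator_of_mem hyt, h1, smul_zero]
    · exact Set.indicator_of_notMem hyt _
  have hFt : ∀ y ∈ e.target, F =ᶠ[𝓝 y] fun y => |Ω.coef e y| • coordVF e X y := by
    intro y hy
    filter_upwards [e.open_target.mem_nhds hy] with z hz using Set.indicator_of_mem hz _
  have hFz : ∀ y, y ∉ e.target → F =ᶠ[𝓝 y] fun _ => 0 := by
    intro y hy
    have hy' : y ∉ e '' K := by
      rintro ⟨x, hx, rfl⟩
      exact hy (e.map_source (hKe hx))
    filter_upwards [hK'.isClosed.isOpen_compl.mem_nhds hy'] with z hz using hF0 z hz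
  have hFc : ContDiff ℝ 1 F := by
    rw [contDiff_iff_contDiffAt]
    intro y
    by_cases hy : y ∈ e.target
    · refine ContDiffAt.congr_of_eventuallyEq ?_ (hFt y hy)
      have h1 : ContDiffAt ℝ ∞ (fun y => |Ω.coef e y|) y :=
        (contDiffAt_abs (Ω.coef_ne_zero he hy)).comp y (Ω.contDiffAt_coef he hy)
      have h2 : ContDiffAt ℝ ∞ (fun y => |Ω.coef e y| • coordVF e X y) y :=
        h1.smul ((hXa _).contDiffAt_coordVF he hy)
      exact h2.of_le (by simp)
    · exact ContDiffAt.congr_of_eventuallyEq contDiffAt_const (hFz y hy)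
  have hFs : HasCompactSupport F := HasCompactSupport.intro hK' hF0
  have hset : ∫ y in e.target, LinearMap.trace ℝ (Eu n) (fderiv ℝ F y).toLinearMap =
      ∫ y, LinearMap.trace ℝ (Eu n) (fderiv ℝ F y).toLinearMap := by
    refine setIntegral_eq_integral_of_forall_compl_eq_zero fun y hy => ?_
    rw [(hFz y hy).fderiv_eq]
    simp
  rw [← integral_trace_fderiv_eq_zero hFc hFs, ← hset]
  refine setIntegral_congr_fun e.open_target.measurableSet fun y hy => ?_
  have hρ := Ω.coef_ne_zero he hy
  have dX := ((hXa (e.symm y)).contDiffAt_coordVF he hy).differentiableAt (by simp)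
  have dρ : HasFDerivAt (Ω.coef e) (fderiv ℝ (Ω.coef e) y) y :=
    ((Ω.contDiffAt_coef he hy).differentiableAt (by simp)).hasFDerivAt
  -- The absolute value is differentiable here because the coefficient has no zero in the chart; no
  -- orientation of the chart is assumed, so the sign is carried along.
  have dσ : HasFDerivAt (fun y => |Ω.coef e y|)
      ((SignType.sign (Ω.coef e y) : ℝ) • fderiv ℝ (Ω.coef e) y) y :=
    (hasDerivAt_abs hρ).comp_hasFDerivAt y dρ
  have ht : LinearMap.trace ℝ (Eu n) (((SignType.sign (Ω.coef e y) : ℝ) •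
      fderiv ℝ (Ω.coef e) y).smulRight (coordVF e X y)).toLinearMap =
        (SignType.sign (Ω.coef e y) : ℝ) * fderiv ℝ (Ω.coef e) y (coordVF e X y) :=
    LinearMap.trace_smulRight _ _
  rw [(hFt y hy).fderiv_eq, fderiv_fun_smul dσ.differentiableAt dX, dσ.fderiv,
    ContinuousLinearMap.toLinearMap_add, map_add, ht, ContinuousLinearMap.toLinearMap_smul,
    map_smul, Ω.divergence_eq_coordDiv he (e.map_target hy) (hXa _), e.right_inv hy,
    VolumeForm.coordDiv, smul_eq_mul, mul_add, mul_div_assoc']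
  congr 1
  rw [div_eq_iff hρ, ← sign_mul_self (Ω.coef e y)]
  have hs : (SignType.sign (Ω.coef e y) : ℝ) * (SignType.sign (Ω.coef e y) : ℝ) = 1 := by
    rcases lt_or_gt_of_ne hρ with h | h <;> simp [h]
  ring

variable [SecondCountableTopology M]

/-- The divergence theorem for compactly supported smooth vector fields. -/
theorem VolumeForm.integral_divergence {X : ∀ x : M, TangentSpace (𝓡 n) x}
    (hX : SmoothVF X Set.univ) {K : Set M} (hK : IsCompact K) (h0 : ∀ x, x ∉ K → X x = 0) :
    ∫ x, Ω.divergence X x ∂Ω.measure = 0 := by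
  have hlc : LocallyCompactSpace M := ChartedSpace.locallyCompactSpace (Eu n) M
  have := Ω.isLocallyFiniteMeasure
  obtain ⟨ρ, hρ⟩ := SmoothPartitionOfUnity.exists_isSubordinate_chartAt_source (𝓡 n) M
  -- Only finitely many members of the partition meet `K`, so `X` is a finite sum of fields each
  -- supported in one chart.
  have hfin := ρ.locallyFinite.finite_nonempty_inter_compact hK
  set J := hfin.toFinset
  have hsum : ∀ x, X x = ∑ i ∈ J, ρ i x • X x := by
    intro x
    by_cases hx : x ∈ K
    · rw [← Finset.sum_smul, ρ.sum_finsupport' x (Set.mem_univ x), one_smul]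
      intro i hi
      rw [ρ.mem_finsupport] at hi
      exact hfin.mem_toFinset.2 ⟨x, hi, hx⟩
    · simp [h0 x hx]
  have hXa : ∀ x, SmoothVFAt X x := fun x => hX.at isOpen_univ (Set.mem_univ x)
  have hsm : ∀ i x, SmoothVFAt (fun y => ρ i y • X y) x := fun i x =>
    (hXa x).smul (ρ i).contMDiff.contMDiffAt
  have hdiv : ∀ x, Ω.divergence X x = ∑ i ∈ J, Ω.divergence (fun y => ρ i y • X y) x := by
    intro x
    rw [← Ω.divergence_sum J fun i _ => hsm i x]
    congr 1
    funext y
    exact hsum y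
  simp only [hdiv]
  have hKi : ∀ i, IsCompact (K ∩ tsupport (ρ i)) := fun i =>
    hK.inter_right (isClosed_tsupport _)
  have hzero : ∀ i x, x ∉ K ∩ tsupport (ρ i) → ρ i x • X x = 0 := by
    intro i x hx
    by_cases hxK : x ∈ K
    · rw [image_eq_zero_of_notMem_tsupport fun h => hx ⟨hxK, h⟩, zero_smul]
    · rw [h0 x hxK, smul_zero]
  rw [integral_finsetSum]
  · refine Finset.sum_eq_zero fun i _ => ?_
    exact Ω.integral_divergence_of_subset_chart (chart_mem_atlas (Eu n) i)
      (smoothVF_of_at fun x _ => hsm i x) (hKi i) (fun x hx => hρ i hx.2) (hzero i)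
  · intro i _
    refine Continuous.integrable_of_hasCompactSupport ?_ ?_
    · exact continuousOn_univ.1 (Ω.continuousOn_divergence isOpen_univ
        (smoothVF_of_at fun x _ => hsm i x))
    · exact HasCompactSupport.intro (hKi i) fun x hx =>
        Ω.divergence_eq_zero (hKi i).isClosed (hzero i) hx

end DivergenceTheorem

/-! ### Metric connections, their divergence, and the tensorial defect -/

section Connection

variable {n d : ℕ} {M : Type*} [TopologicalSpace M] [ChartedSpace (Eu n) M] [IsManifold (𝓡 n) ∞ M]

theorem SmoothVF.mono {X : ∀ x : M, TangentSpace (𝓡 n) x} {U V : Set M} (h : SmoothVF X U)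
    (hVU : V ⊆ U) : SmoothVF X V :=
  ContMDiffOn.mono h hVU

theorem SmoothVF.smul {f : M → ℝ} {X : ∀ x : M, TangentSpace (𝓡 n) x} {U : Set M}
    (hf : ContMDiffOn (𝓡 n) 𝓘(ℝ, ℝ) ∞ f U) (hX : SmoothVF X U) :
    SmoothVF (fun y => f y • X y) U :=
  ContMDiffOn.smul_section hf hX

theorem SmoothVF.sum {κ : Type*} {s : Finset κ} {X : κ → ∀ x : M, TangentSpace (𝓡 n) x} {U : Set M}
    (hX : ∀ i ∈ s, SmoothVF (X i) U) : SmoothVF (fun y => ∑ i ∈ s, X i y) U :=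
  ContMDiffOn.sum_section hX

theorem dirDeriv_congr {F : Type*} [NormedAddCommGroup F] [NormedSpace ℝ F] {f g : M → F} {x : M}
    (h : f =ᶠ[𝓝 x] g) (v : TangentSpace (𝓡 n) x) : dirDeriv f x v = dirDeriv g x v :=
  congrArg (fun L : Eu n →L[ℝ] F => L v) h.mfderiv_eq

/-- The differential of a real function as a linear form on the tangent space. -/
def dirDerivLinear (f : M → ℝ) (x : M) : TangentSpace (𝓡 n) x →ₗ[ℝ] ℝ where
  toFun v := dirDeriv f x v
  map_add' v w := map_add (mfderiv (𝓡 n) 𝓘(ℝ, ℝ) f x) v w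
  map_smul' c v := map_smul (mfderiv (𝓡 n) 𝓘(ℝ, ℝ) f x) c v

theorem dirDeriv_const {F : Type*} [NormedAddCommGroup F] [NormedSpace ℝ F] (c : F) (x : M)
    (v : TangentSpace (𝓡 n) x) : dirDeriv (fun _ : M => c) x v = 0 := by
  rw [dirDeriv, mfderiv_const]
  rfl

theorem dirDeriv_eq_zero_of_eventuallyEq_const {F : Type*} [NormedAddCommGroup F] [NormedSpace ℝ F]
    {f : M → F} {x : M} {c : F} (h : ∀ᶠ y in 𝓝 x, f y = c) (v : TangentSpace (𝓡 n) x) :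
    dirDeriv f x v = 0 := by
  rw [dirDeriv_congr (g := fun _ => c) h, dirDeriv_const]

variable (S : SubRiemannianStructure n M d)

theorem SubRiemannianStructure.finiteDimensional (x : M) : FiniteDimensional ℝ (S.H x) :=
  haveI : FiniteDimensional ℝ (TangentSpace (𝓡 n) x) := inferInstanceAs (FiniteDimensional ℝ (Eu n))
  inferInstance

theorem IsSmoothDistribution.finrank_eq {H : ∀ x : M, Submodule ℝ (TangentSpace (𝓡 n) x)} {d : ℕ}
    (h : IsSmoothDistribution H d) (x : M) : Module.finrank ℝ (H x) = d := by
  obtain ⟨U, -, hxU, s, -, hs⟩ := h x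
  obtain ⟨hli, hspan⟩ := hs x hxU
  rw [← hspan, finrank_span_eq_card hli, Fintype.card_fin]

variable {S} {U : Set M} {s : Fin d → ∀ x : M, S.H x}

/-- The basis of `H x` given by an orthonormal frame. -/
theorem IsOrthonormalFrame.exists_basis (hs : IsOrthonormalFrame S U s) {x : M} (hx : x ∈ U) :
    ∃ b : Module.Basis (Fin d) ℝ (S.H x), (∀ i, b i = s i x) ∧
      ∀ v i, b.repr v i = S.g x v (s i x) := by
  have := S.finiteDimensional x
  have hg : ∀ (c : Fin d → ℝ) (j : Fin d), S.g x (∑ i, c i • s i x) (s j x) = c j := by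
    intro c j
    simp [hs.orthonormal x hx]
  have hli : LinearIndependent ℝ fun i => s i x := by
    rw [Fintype.linearIndependent_iff]
    intro c hc j
    rw [← hg c j, hc]
    simp
  have hcard : Fintype.card (Fin d) = Module.finrank ℝ (S.H x) := by
    rw [S.isSmooth.finrank_eq x, Fintype.card_fin]
  -- Rank zero is separate: `basisOfLinearIndependentOfCardEqFinrank` needs a nonempty index type.
  rcases isEmpty_or_nonempty (Fin d) with hd | hd
  · have h0 : Module.finrank ℝ (S.H x) = 0 := by simpa using hcard.symm
    have := Module.finrank_zero_iff.1 h0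
    exact ⟨Module.Basis.empty _, fun i => hd.elim i, fun v i => hd.elim i⟩
  · refine ⟨basisOfLinearIndependentOfCardEqFinrank hli hcard, fun i => by simp, fun v i => ?_⟩
    set b := basisOfLinearIndependentOfCardEqFinrank hli hcard
    have hb : ∀ i, b i = s i x := fun i => by simp [b]
    conv_rhs => rw [← b.sum_repr v]
    simp only [hb]
    exact (hg _ i).symm

theorem IsOrthonormalFrame.sum_smul (hs : IsOrthonormalFrame S U s) {x : M} (hx : x ∈ U)
    (v : S.H x) : ∑ i, S.g x v (s i x) • s i x = v := by
  obtain ⟨b, hb, hr⟩ := hs.exists_basis hx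
  conv_rhs => rw [← b.sum_repr v]
  simp [hb, hr]

theorem IsOrthonormalFrame.trace_eq (hs : IsOrthonormalFrame S U s) {x : M} (hx : x ∈ U)
    (T : S.H x →ₗ[ℝ] S.H x) :
    LinearMap.trace ℝ (S.H x) T = ∑ i, S.g x (T (s i x)) (s i x) := by
  obtain ⟨b, hb, hr⟩ := hs.exists_basis hx
  rw [LinearMap.trace_eq_matrix_trace ℝ b T, Matrix.trace]
  refine Finset.sum_congr rfl fun i _ => ?_
  rw [Matrix.diag_apply, LinearMap.toMatrix_apply, hr, hb]

theorem IsOrthonormalFrame.mono (hs : IsOrthonormalFrame S U s) {V : Set M} (hV : IsOpen V)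
    (hVU : V ⊆ U) : IsOrthonormalFrame S V s :=
  ⟨hV, fun i => (hs.smooth i).mono hVU, fun x hx => hs.orthonormal x (hVU hx)⟩

/-- A bump function at `p` with compact support in a given neighbourhood. -/
theorem exists_bump [T2Space M] {p : M} {U : Set M} (hU : U ∈ 𝓝 p) :
    ∃ (χ : M → ℝ) (K : Set M), ContMDiff (𝓡 n) 𝓘(ℝ, ℝ) ∞ χ ∧ (∀ᶠ y in 𝓝 p, χ y = 1) ∧
      IsCompact K ∧ K ⊆ U ∧ (∀ x, x ∉ K → χ x = 0) ∧ ∀ x, 0 ≤ χ x := by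
  obtain ⟨f, -, hf⟩ := (SmoothBumpFunction.nhds_basis_tsupport (I := 𝓡 n) p).mem_iff.1 hU
  exact ⟨f, tsupport f, f.contMDiff, f.eventuallyEq_one, f.hasCompactSupport, hf,
    fun x hx => image_eq_zero_of_notMem_tsupport hx, fun x => f.nonneg⟩

variable (C : MetricConnection S)

/-- Locality follows from the Leibniz rule: for a bump χ that is 1 near `x`, ∇(χZ) = ∇Z at `x`,
while χX and χY are the same global section. -/
theorem MetricConnection.congr [T2Space M] {X Y : ∀ x, S.H x} {U : Set M} (hU : IsOpen U)
    (hX : SmoothVF (vf X) U) (hXY : ∀ y ∈ U, Y y = X y) {x : M} (hx : x ∈ U) :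
    C.toFun Y x = C.toFun X x := by
  have hY : SmoothVF (vf Y) U := ContMDiffOn.congr hX fun y hy => by simp [vf, hXY y hy]
  obtain ⟨χ, K, hχ, h1, hK, hKU, h0, -⟩ := exists_bump (n := n) (hU.mem_nhds hx)
  have heq : (fun y => χ y • Y y) = fun y => χ y • X y := by
    funext y
    by_cases hy : y ∈ K
    · rw [hXY y (hKU hy)]
    · rw [h0 y hy, zero_smul, zero_smul]
  have key : ∀ Z : ∀ x, S.H x, SmoothVF (vf Z) U →
      C.toFun (fun y => χ y • Z y) x = C.toFun Z x := by
    intro Z hZ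
    ext1 v
    rw [C.leibniz U χ Z hU hχ.contMDiffOn hZ x hx v, dirDeriv_eq_zero_of_eventuallyEq_const h1,
      h1.self_of_nhds, zero_smul, one_smul, zero_add]
  rw [← key Y hY, ← key X hX, heq]

/-- The Koszul formula is assumed for global sections only; cutting off by a bump function makes it
applicable to local frame fields. -/
theorem exists_global_extension [T2Space M] {H : ∀ x : M, Submodule ℝ (TangentSpace (𝓡 n) x)}
    {X : ∀ x, H x} {U : Set M} (hU : IsOpen U)
    (hX : SmoothVF (vf X) U) {p : M} (hp : p ∈ U) :
    ∃ (X' : ∀ x, H x) (V : Set M), SmoothVF (vf X') Set.univ ∧ IsOpen V ∧ p ∈ V ∧ V ⊆ U ∧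
      ∀ y ∈ V, X' y = X y := by
  obtain ⟨χ, K, hχ, h1, hK, hKU, h0, -⟩ := exists_bump (n := n) (hU.mem_nhds hp)
  obtain ⟨V, hV, hVo, hpV⟩ := eventually_nhds_iff.1 h1
  refine ⟨fun y => χ y • X y, V ∩ U, smoothVF_of_at fun x _ => ?_, hVo.inter hU, ⟨hpV, hp⟩,
    Set.inter_subset_right, fun y hy => ?_⟩
  · by_cases hx : x ∈ K
    · exact SmoothVFAt.smul hχ.contMDiffAt (hX.at hU (hKU hx))
    · refine (smoothVFAt_zero x).congr ?_
      filter_upwards [hK.isClosed.isOpen_compl.mem_nhds hx] with y hy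
      simp [vf, h0 y hy]
  · simp only
    rw [hV y hy.1, one_smul]

/-- The divergence `∑ᵢ g(∇_{s_i} X, s_i)` defined by the connection. -/
def MetricConnection.div (X : ∀ x, S.H x) (x : M) : ℝ := LinearMap.trace ℝ (S.H x) (C.toFun X x)

theorem MetricConnection.div_eq (hs : IsOrthonormalFrame S U s) (X : ∀ x, S.H x) {x : M}
    (hx : x ∈ U) : C.div X x = ∑ i, S.g x (C.toFun X x (s i x)) (s i x) :=
  hs.trace_eq hx _

theorem MetricConnection.toFun_zero (x : M) : C.toFun (fun _ => 0) x = 0 := by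
  ext1 v
  have h := C.leibniz Set.univ (fun _ => 0) (fun _ => 0) isOpen_univ contMDiffOn_const
    (smoothVF_of_at fun x _ => smoothVFAt_zero x) x (Set.mem_univ x) v
  simpa using h

theorem MetricConnection.toFun_sum {κ : Type*} (J : Finset κ) {X : κ → ∀ x, S.H x} {U : Set M}
    (hU : IsOpen U) (hX : ∀ k, SmoothVF (vf (X k)) U) {x : M} (hx : x ∈ U) :
    C.toFun (fun y => ∑ k ∈ J, X k y) x = ∑ k ∈ J, C.toFun (X k) x := by
  classical
  induction J using Finset.induction_on with
  | empty => simpa using C.toFun_zero x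
  | insert k J hk ih =>
    simp only [Finset.sum_insert hk]
    rw [C.add U _ _ hU (hX k) ?_ x hx, ih]
    have : vf (fun y => ∑ k ∈ J, X k y) = fun y => ∑ k ∈ J, vf (X k) y := by
      funext y
      simp [vf]
    rw [this]
    exact SmoothVF.sum fun k _ => hX k

/-- By the Leibniz rule ∇(z s) is z ∇s plus the rank-one map v ↦ v(z) s, of trace s(z): the same
derivative term as in `VolumeForm.divergence_smul`. -/
theorem MetricConnection.div_sum_smul [T2Space M] {X : ∀ x, S.H x} {z : Fin d → M → ℝ}
    {s : Fin d → ∀ x, S.H x} {U : Set M} (hU : IsOpen U) (hs : ∀ k, SmoothVF (vf (s k)) U)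
    (hz : ∀ k, ContMDiffOn (𝓡 n) 𝓘(ℝ, ℝ) ∞ (z k) U) (hX : ∀ y ∈ U, X y = ∑ k, z k y • s k y)
    {x : M} (hx : x ∈ U) :
    C.div X x = ∑ k, (dirDeriv (z k) x (vf (s k) x) + z k x * C.div (s k) x) := by
  have hsm : ∀ k, SmoothVF (vf fun y => z k y • s k y) U := fun k => SmoothVF.smul (hz k) (hs k)
  have hsum : SmoothVF (vf fun y => ∑ k, z k y • s k y) U := by
    have : vf (fun y => ∑ k, z k y • s k y) = fun y => ∑ k, vf (fun y => z k y • s k y) y := by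
      funext y
      simp [vf]
    rw [this]
    exact SmoothVF.sum fun k _ => hsm k
  have := S.finiteDimensional x
  rw [MetricConnection.div, C.congr hU hsum hX hx, C.toFun_sum Finset.univ hU hsm hx, map_sum]
  refine Finset.sum_congr rfl fun k _ => ?_
  have h : C.toFun (fun y => z k y • s k y) x =
      ((dirDerivLinear (z k) x).comp (S.H x).subtype).smulRight (s k x) +
        z k x • C.toFun (s k) x := by
    ext1 v
    exact C.leibniz U (z k) (s k) hU (hz k) (hs k) x hx v
  rw [h, map_add, LinearMap.trace_smulRight, map_smul]
  rfl

/-- The difference between `Div X` and the divergence of `X` defined by the connection. -/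
def defect (Ω : VolumeForm n M) (X : ∀ x, S.H x) (x : M) : ℝ := Ω.divergence (vf X) x - C.div X x

/-- The derivatives of the coefficients enter both divergences identically and cancel in the
difference. -/
theorem defect_sum_smul [T2Space M] (Ω : VolumeForm n M) {X : ∀ x, S.H x} {z : Fin d → M → ℝ}
    {s : Fin d → ∀ x, S.H x} {U : Set M} (hU : IsOpen U) (hs : ∀ k, SmoothVF (vf (s k)) U)
    (hz : ∀ k, ContMDiffOn (𝓡 n) 𝓘(ℝ, ℝ) ∞ (z k) U) (hX : ∀ y ∈ U, X y = ∑ k, z k y • s k y)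
    {x : M} (hx : x ∈ U) : defect C Ω X x = ∑ k, z k x * defect C Ω (s k) x := by
  have hsm : ∀ k, SmoothVFAt (fun y => z k y • vf (s k) y) x := fun k =>
    SmoothVFAt.smul ((hz k).contMDiffAt (hU.mem_nhds hx)) ((hs k).at hU hx)
  have h1 : Ω.divergence (vf X) x =
      ∑ k, (z k x * Ω.divergence (vf (s k)) x + dirDeriv (z k) x (vf (s k) x)) := by
    rw [Ω.divergence_congr (SmoothVFAt.sum fun k (_ : k ∈ Finset.univ) => hsm k),
      Ω.divergence_sum _ fun k _ => hsm k]
    · exact Finset.sum_congr rfl fun k _ => Ω.divergence_smul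
        ((hz k).contMDiffAt (hU.mem_nhds hx)) ((hs k).at hU hx)
    · filter_upwards [hU.mem_nhds hx] with y hy
      rw [vf, hX y hy]
      simp [vf]
  rw [defect, h1, C.div_sum_smul hU hs hz hX hx, ← Finset.sum_sub_distrib]
  refine Finset.sum_congr rfl fun k _ => ?_
  rw [defect]
  ring

theorem defect_eq_sum_frame [T2Space M] (Ω : VolumeForm n M) (hs : IsOrthonormalFrame S U s)
    {X : ∀ x, S.H x} {V : Set M} (hV : IsOpen V) (hX : SmoothVF (vf X) V) {x : M} (hxU : x ∈ U)
    (hxV : x ∈ V) : defect C Ω X x = ∑ k, S.g x (X x) (s k x) * defect C Ω (s k) x := by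
  have hUV := hs.isOpen.inter hV
  refine defect_sum_smul C Ω hUV (fun k => (hs.smooth k).mono Set.inter_subset_left)
    (z := fun k y => S.g y (X y) (s k y)) (fun k => ?_) (fun y hy => ?_) ⟨hxU, hxV⟩
  · exact S.g_smooth _ _ _ hUV (hX.mono Set.inter_subset_right)
      ((hs.smooth k).mono Set.inter_subset_left)
  · exact (hs.sum_smul hy.1 (X y)).symm

/-- The right side no longer mentions the frame, because the sum over an orthonormal frame is a
trace. -/
theorem divCondition_iff (Ω : VolumeForm n M) (hs : IsOrthonormalFrame S U s) :
    DivCondition Ω C U s ↔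
      ∀ X : ∀ x, S.H x, SmoothVF (vf X) Set.univ → ∀ x ∈ U, defect C Ω X x = 0 := by
  refine forall₂_congr fun X _ => forall₂_congr fun x hx => ?_
  rw [← C.div_eq hs X hx, defect, sub_eq_zero]

end Connection

/-! ### Product and chain rules for directional derivatives -/

section Calculus

variable {n : ℕ} {M : Type*} [TopologicalSpace M] [ChartedSpace (Eu n) M]
  {E F G : Type*} [NormedAddCommGroup E] [NormedSpace ℝ E] [NormedAddCommGroup F] [NormedSpace ℝ F]
  [NormedAddCommGroup G] [NormedSpace ℝ G]

theorem dirDeriv_bilin (B : E →L[ℝ] F →L[ℝ] G) {f : M → E} {g : M → F} {x : M}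
    (hf : MDifferentiableAt (𝓡 n) 𝓘(ℝ, E) f x) (hg : MDifferentiableAt (𝓡 n) 𝓘(ℝ, F) g x)
    (v : TangentSpace (𝓡 n) x) :
    dirDeriv (fun y => B (f y) (g y)) x v =
      B (f x) (dirDeriv g x v) + B (dirDeriv f x v) (g x) := by
  have h1 := hf.hasMFDerivAt
  have h2 := hg.hasMFDerivAt
  -- The second component of `HasMFDerivAt` is an ordinary derivative in the chart, to which the
  -- bilinear product rule applies.
  have h3 := B.hasFDerivWithinAt_of_bilinear h1.2 h2.2
  have h4 : HasMFDerivAt (𝓡 n) 𝓘(ℝ, G) (fun y => B (f y) (g y)) x _ :=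
    ⟨(B.continuous.continuousAt.comp h1.1).clm_apply h2.1, h3⟩
  rw [dirDeriv, h4.mfderiv]
  simp [writtenInExtChartAt, dirDeriv]
  rfl

theorem dirDeriv_clm (L : E →L[ℝ] F) {f : M → E} {x : M}
    (hf : MDifferentiableAt (𝓡 n) 𝓘(ℝ, E) f x) (v : TangentSpace (𝓡 n) x) :
    dirDeriv (fun y => L (f y)) x v = L (dirDeriv f x v) := by
  have h1 := hf.hasMFDerivAt
  have h4 : HasMFDerivAt (𝓡 n) 𝓘(ℝ, F) (fun y => L (f y)) x _ :=
    ⟨L.continuous.continuousAt.comp h1.1, L.hasFDerivAt.comp_hasFDerivWithinAt _ h1.2⟩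
  rw [dirDeriv, h4.mfderiv]
  rfl

theorem contMDiffOn_bilin (B : E →L[ℝ] F →L[ℝ] G) {f : M → E} {g : M → F} {U : Set M}
    (hf : ContMDiffOn (𝓡 n) 𝓘(ℝ, E) ∞ f U) (hg : ContMDiffOn (𝓡 n) 𝓘(ℝ, F) ∞ g U) :
    ContMDiffOn (𝓡 n) 𝓘(ℝ, G) ∞ (fun y => B (f y) (g y)) U :=
  (B.contMDiff.comp_contMDiffOn hf).clm_apply hg

theorem continuousOn_dirDeriv [IsManifold (𝓡 n) ∞ M] {f : M → E} {X : ∀ x : M, TangentSpace (𝓡 n) x}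
    {U : Set M} (hU : IsOpen U) (hf : ContMDiffOn (𝓡 n) 𝓘(ℝ, E) ∞ f U) (hX : SmoothVF X U) :
    ContinuousOn (fun x => dirDeriv f x (X x)) U := by
  intro x hx
  refine ContinuousAt.continuousWithinAt ?_
  have hc := chart_mem_atlas (Eu n) x
  have hs := mem_chart_source (Eu n) x
  set e := chartAt (Eu n) x
  have hy := e.map_source hs
  have h1 : ContDiffAt ℝ ∞ (f ∘ e.symm) (e x) := by
    refine (ContMDiffAt.comp (e x) ?_ (contMDiffAt_chart_symm hc hy)).contDiffAt
    rw [e.left_inv hs]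
    exact hf.contMDiffAt (hU.mem_nhds hx)
  have h2 : ContDiffAt ℝ ∞ (coordVF e X) (e x) := by
    refine SmoothVFAt.contDiffAt_coordVF hc hy ?_
    rw [e.left_inv hs]
    exact hX.at hU hx
  have h3 : ContinuousAt (fun y => fderiv ℝ (f ∘ e.symm) y (coordVF e X y)) (e x) :=
    (h1.fderiv_right (m := 0) (by simp)).continuousAt.clm_apply h2.continuousAt
  refine (ContinuousAt.comp (f := e) (x := x) h3 (e.continuousAt hs)).congr ?_
  filter_upwards [hU.mem_nhds hx, e.open_source.mem_nhds hs] with z hz hz'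
  have h4 := e.left_inv hz'
  have h5 := e.map_source hz'
  have hfz := (hf.contMDiffAt (hU.mem_nhds hz)).mdifferentiableAt (by simp)
  rw [Function.comp_apply]
  generalize e z = w at h4 h5
  subst h4
  exact (dirDeriv_eq_fderiv hc h5 hfz X).symm

end Calculus

/-! ### The hermitian form as a real bilinear map -/

section Inner

variable {Δ : Type*} [NormedAddCommGroup Δ] [InnerProductSpace ℂ Δ] [FiniteDimensional ℂ Δ]

/-- An endomorphism of `Δ` as a real continuous linear map. -/
def realCLM (A : Module.End ℂ Δ) : Δ →L[ℝ] Δ :=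
  haveI : FiniteDimensional ℝ Δ := FiniteDimensional.complexToReal Δ
  LinearMap.toContinuousLinearMap (A.restrictScalars ℝ)

/-- The hermitian form `⟪A φ, ψ⟫` as a real bilinear map. -/
def innerBilin (A : Module.End ℂ Δ) : Δ →L[ℝ] Δ →L[ℝ] ℂ :=
  ((isBoundedBilinearMap_inner (𝕜 := ℂ) (E := Δ)).toContinuousLinearMap).comp (realCLM A)

end Inner

/-! ### The current of two spinor fields and its divergence -/

section SpinorCurrent

variable {n d : ℕ} {M : Type*} [TopologicalSpace M] [ChartedSpace (Eu n) M]
  [IsManifold (𝓡 n) ∞ M] {S : SubRiemannianStructure n M d} (C : MetricConnection S)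

/-- The connection coefficients `g(∇_v s_i, s_j)` of a frame. -/
def connCoeff (s : Fin d → ∀ x : M, S.H x) (x : M) (v : S.H x) (i j : Fin d) : ℝ :=
  S.g x (C.toFun (s i) x v) (s j x)

/-- Metricity applied to g(s_i, s_j), which is constant on `U`. -/
theorem connCoeff_skew {U : Set M} {s : Fin d → ∀ x : M, S.H x} (hs : IsOrthonormalFrame S U s)
    {x : M} (hx : x ∈ U) (v : S.H x) (i j : Fin d) :
    connCoeff C s x v i j = -connCoeff C s x v j i := by
  have h := C.metric U (s i) (s j) hs.isOpen (hs.smooth i) (hs.smooth j) x hx v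
  rw [dirDeriv_eq_zero_of_eventuallyEq_const (c := if i = j then 1 else 0), S.g_symm x (s i x)] at h
  · rw [connCoeff, connCoeff]
    linarith
  · filter_upwards [hs.isOpen.mem_nhds hx] with y hy using hs.orthonormal y hy i j

theorem MetricConnection.div_frame_eq {U : Set M} {s : Fin d → ∀ x : M, S.H x}
    (hs : IsOrthonormalFrame S U s) {x : M} (hx : x ∈ U) (k : Fin d) :
    C.div (s k) x = -∑ i, connCoeff C s x (s i x) i k := by
  rw [C.div_eq hs _ hx, ← Finset.sum_neg_distrib]
  exact Finset.sum_congr rfl fun i _ => connCoeff_skew C hs hx (s i x) k i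

variable {ι : Type*} {Δ : Type*} [NormedAddCommGroup Δ] [InnerProductSpace ℂ Δ]
  {P : SpinStructure S ι} {γ : SpinorModule d Δ}

theorem spinDeriv_eq (ψ : ι → M → Δ) (a : ι) (x : M) (v : S.H x) :
    spinDeriv C P γ ψ a x v = dirDeriv (ψ a) x (v : TangentSpace (𝓡 n) x) +
      γ.rep (spinElt (connCoeff C (P.frame a) x v)) (ψ a x) := by
  simp [spinDeriv, spinElt, connCoeff, LinearMap.sum_apply]

variable [FiniteDimensional ℂ Δ]

theorem SpinorField.contMDiffOn_inner (φ ψ : SpinorField P γ) (A : Module.End ℂ Δ) (a : ι) :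
    ContMDiffOn (𝓡 n) 𝓘(ℝ, ℂ) ∞ (fun y => ⟪A (φ.toFun a y), ψ.toFun a y⟫_ℂ) (P.baseSet a) :=
  contMDiffOn_bilin (innerBilin A) (φ.smooth a) (ψ.smooth a)

theorem SpinorField.mdifferentiableAt (φ : SpinorField P γ) {a : ι} {x : M}
    (hx : x ∈ P.baseSet a) : MDifferentiableAt (𝓡 n) 𝓘(ℝ, Δ) (φ.toFun a) x :=
  ((φ.smooth a).contMDiffAt ((P.isOrthonormalFrame a).isOpen.mem_nhds hx)).mdifferentiableAt
    (by simp)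

/-- The failure of pointwise symmetry is a divergence. The derivatives of φ and ψ combine to
derivatives of ⟨e_k φ, ψ⟩; the connection forms combine to the divergences of the frame fields. -/
theorem inner_dirac_sub (φ ψ : SpinorField P γ) {a : ι} {x : M} (hx : x ∈ P.baseSet a) :
    ⟪dirac C P γ φ a x, ψ.toFun a x⟫_ℂ - ⟪φ.toFun a x, dirac C P γ ψ a x⟫_ℂ =
      ∑ k, (dirDeriv (fun y => ⟪γ.rep (clE k) (φ.toFun a y), ψ.toFun a y⟫_ℂ) x
          (vf (P.frame a k) x) +
        C.div (P.frame a k) x • ⟪γ.rep (clE k) (φ.toFun a x), ψ.toFun a x⟫_ℂ) := by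
  have hs := P.isOrthonormalFrame a
  have hd : ∀ k v, dirDeriv (fun y => ⟪γ.rep (clE k) (φ.toFun a y), ψ.toFun a y⟫_ℂ) x v =
      ⟪γ.rep (clE k) (φ.toFun a x), dirDeriv (ψ.toFun a) x v⟫_ℂ +
        ⟪γ.rep (clE k) (dirDeriv (φ.toFun a) x v), ψ.toFun a x⟫_ℂ := fun k v =>
    dirDeriv_bilin (innerBilin (γ.rep (clE k))) (φ.mdifferentiableAt hx) (ψ.mdifferentiableAt hx) v
  -- The connection form is skew, so moving it across the hermitian product turns the two terms into
  -- a commutator with e_i, again a vector.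
  have hcl : ∀ i, ⟪γ.rep (clE i) (γ.rep (spinElt (connCoeff C (P.frame a) x (P.frame a i x)))
        (φ.toFun a x)), ψ.toFun a x⟫_ℂ +
      ⟪γ.rep (clE i) (φ.toFun a x), γ.rep (spinElt (connCoeff C (P.frame a) x (P.frame a i x)))
        (ψ.toFun a x)⟫_ℂ =
      -∑ k, connCoeff C (P.frame a) x (P.frame a i x) i k •
        ⟪γ.rep (clE k) (φ.toFun a x), ψ.toFun a x⟫_ℂ := by
    intro i
    set w := connCoeff C (P.frame a) x (P.frame a i x)
    have h1 : ⟪γ.rep (clE i) (φ.toFun a x), γ.rep (spinElt w) (ψ.toFun a x)⟫_ℂ =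
        -⟪γ.rep (spinElt w * clE i) (φ.toFun a x), ψ.toFun a x⟫_ℂ := by
      rw [map_mul, Module.End.mul_apply, γ.inner_rep_left (spinElt w), star_spinElt, map_neg,
        LinearMap.neg_apply, inner_neg_right, neg_neg]
    rw [h1, ← Module.End.mul_apply, ← map_mul, ← sub_eq_add_neg, ← inner_sub_left,
      ← LinearMap.sub_apply, ← map_sub,
      clE_mul_spinElt_sub w (fun i j => connCoeff_skew C hs hx _ i j) i]
    simp only [map_neg, LinearMap.neg_apply, inner_neg_left, map_sum, LinearMap.sum_apply,
      sum_inner, map_smul, LinearMap.smul_apply, ← Complex.coe_smul, inner_smul_left,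
      Complex.conj_ofReal, smul_eq_mul]
  simp only [dirac, spinDeriv_eq, sum_inner, inner_sum]
  rw [← Finset.sum_sub_distrib, Finset.sum_add_distrib]
  have h2 : ∑ k, C.div (P.frame a k) x • ⟪γ.rep (clE k) (φ.toFun a x), ψ.toFun a x⟫_ℂ =
      ∑ i, -∑ k, connCoeff C (P.frame a) x (P.frame a i x) i k •
        ⟪γ.rep (clE k) (φ.toFun a x), ψ.toFun a x⟫_ℂ := by
    rw [Finset.sum_neg_distrib, Finset.sum_comm, ← Finset.sum_neg_distrib]
    refine Finset.sum_congr rfl fun k _ => ?_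
    rw [C.div_frame_eq hs hx, neg_smul, Finset.sum_smul]
  rw [h2, ← Finset.sum_add_distrib]
  refine Finset.sum_congr rfl fun i _ => ?_
  rw [← hcl i, hd, map_add, map_add, inner_add_left, inner_add_right]
  have h3 : ∀ χ, ⟪φ.toFun a x, γ.rep (clE i) χ⟫_ℂ = -⟪γ.rep (clE i) (φ.toFun a x), χ⟫_ℂ := by
    intro χ
    rw [γ.inner_clE_left, neg_neg]
  rw [h3, h3]
  simp only [vf]
  ring

/-- The inverse rotation: the matrix between two orthonormal frames is orthogonal, so its inverse is
its transpose. -/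
theorem SpinStructure.star_transition_mul (P : SpinStructure S ι) {a b : ι} {x : M}
    (hx : x ∈ P.baseSet a ∩ P.baseSet b) (k : Fin d) :
    star (P.transition a b x : Cl d) * clE k * (P.transition a b x : Cl d) =
      ∑ j, S.g x (P.frame a k x) (P.frame b j x) • clE j := by
  set t : Spin d := P.transition a b x with ht
  have h1 : (clE k : Cl d) =
      (t : Cl d) * (∑ j, S.g x (P.frame a k x) (P.frame b j x) • clE j) * star (t : Cl d) := by
    have h2 : ∀ j : Fin d, (t : Cl d) * (S.g x (P.frame a k x) (P.frame b j x) • clE j) *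
        star (t : Cl d) = ∑ i, (S.g x (P.frame a k x) (P.frame b j x) *
          S.g x (P.frame a i x) (P.frame b j x)) • clE i := by
      intro j
      rw [mul_smul_comm, smul_mul_assoc, P.lift a b x hx j, Finset.smul_sum]
      simp only [smul_smul]
    rw [Finset.mul_sum, Finset.sum_mul, Finset.sum_congr rfl fun j _ => h2 j, Finset.sum_comm]
    have h3 : ∀ i, ∑ j, S.g x (P.frame a k x) (P.frame b j x) *
        S.g x (P.frame a i x) (P.frame b j x) = if k = i then 1 else 0 := by
      intro i
      rw [← (P.isOrthonormalFrame a).orthonormal x hx.1 k i]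
      conv_rhs => rw [← (P.isOrthonormalFrame b).sum_smul hx.2 (P.frame a i x)]
      simp [mul_comm]
    simp only [← Finset.sum_smul, h3]
    simp
  conv_lhs => rw [h1]
  rw [mul_assoc, mul_assoc, spinGroup.coe_star_mul_self, mul_one, ← mul_assoc,
    spinGroup.coe_star_mul_self, one_mul]

/-- The real vector field `∑ₖ τ⟪s_k · φ, ψ⟫ s_k` defined by two spinor fields. -/
def current (τ : ℂ →L[ℝ] ℝ) (φ ψ : SpinorField P γ) (x : M) : S.H x :=
  ∑ k, τ ⟪γ.rep (clE k) (φ.toFun (P.indexAt x) x), ψ.toFun (P.indexAt x) x⟫_ℂ •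
    P.frame (P.indexAt x) k x

omit [FiniteDimensional ℂ Δ] in
-- Changing the trivialisation conjugates e_k by the transition function, that is, rotates the
-- coefficients by the same orthogonal matrix as the frame, so the vector does not change.
theorem current_eq (τ : ℂ →L[ℝ] ℝ) (φ ψ : SpinorField P γ) {a : ι} {x : M}
    (hx : x ∈ P.baseSet a) : current τ φ ψ x =
      ∑ k, τ ⟪γ.rep (clE k) (φ.toFun a x), ψ.toFun a x⟫_ℂ • P.frame a k x := by
  set b := P.indexAt x with hb
  have hxab : x ∈ P.baseSet a ∩ P.baseSet b := ⟨hx, P.mem_baseSet_at x⟩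
  have h1 : ∀ k, τ ⟪γ.rep (clE k) (φ.toFun a x), ψ.toFun a x⟫_ℂ =
      ∑ j, S.g x (P.frame a k x) (P.frame b j x) *
        τ ⟪γ.rep (clE j) (φ.toFun b x), ψ.toFun b x⟫_ℂ := by
    intro k
    have h2 : ⟪γ.rep (clE k) (φ.toFun a x), ψ.toFun a x⟫_ℂ =
        ⟪γ.rep (star (P.transition a b x : Cl d) * clE k * (P.transition a b x : Cl d))
          (φ.toFun b x), ψ.toFun b x⟫_ℂ := by
      rw [φ.compat a b x hxab, ψ.compat a b x hxab, map_mul, map_mul, Module.End.mul_apply,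
        Module.End.mul_apply, γ.inner_rep_left (star _), star_star]
    rw [h2, P.star_transition_mul hxab]
    simp only [map_sum, LinearMap.sum_apply, sum_inner, map_smul, LinearMap.smul_apply]
    refine Finset.sum_congr rfl fun j _ => ?_
    rw [← Complex.coe_smul, inner_smul_left, Complex.conj_ofReal, ← smul_eq_mul, Complex.coe_smul,
      map_smul, smul_eq_mul]
  simp only [h1, Finset.sum_smul, current, ← hb]
  rw [Finset.sum_comm]
  refine Finset.sum_congr rfl fun j _ => ?_
  conv_lhs => rw [← (P.isOrthonormalFrame a).sum_smul hx (P.frame b j x), Finset.smul_sum]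
  refine Finset.sum_congr rfl fun k _ => ?_
  rw [smul_smul, S.g_symm, mul_comm]

theorem div_current [T2Space M] (τ : ℂ →L[ℝ] ℝ) (φ ψ : SpinorField P γ) {a : ι} {x : M}
    (hx : x ∈ P.baseSet a) : C.div (current τ φ ψ) x =
      τ (⟪dirac C P γ φ a x, ψ.toFun a x⟫_ℂ - ⟪φ.toFun a x, dirac C P γ ψ a x⟫_ℂ) := by
  have hs := P.isOrthonormalFrame a
  have hsm := fun k => φ.contMDiffOn_inner ψ (γ.rep (clE k)) a
  rw [C.div_sum_smul hs.isOpen hs.smooth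
    (fun k => τ.contMDiff.comp_contMDiffOn (hsm k)) (fun y hy => current_eq τ φ ψ hy) hx,
    inner_dirac_sub C φ ψ hx, map_sum]
  refine Finset.sum_congr rfl fun k _ => ?_
  rw [map_add, map_smul, smul_eq_mul, mul_comm]
  congr 1
  exact dirDeriv_clm τ (((hsm k).contMDiffAt (hs.isOpen.mem_nhds hx)).mdifferentiableAt (by simp)) _

/-- The choice `P.indexAt` may jump from point to point; near `x` the current is rewritten in the
single trivialisation chosen at `x`. -/
theorem smoothVF_current (τ : ℂ →L[ℝ] ℝ) (φ ψ : SpinorField P γ) :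
    SmoothVF (vf (current τ φ ψ)) Set.univ := by
  refine smoothVF_of_at fun x _ => ?_
  have hs := P.isOrthonormalFrame (P.indexAt x)
  have hx := P.mem_baseSet_at x
  refine (SmoothVFAt.sum (s := Finset.univ)
    (X := fun k y => τ ⟪γ.rep (clE k) (φ.toFun (P.indexAt x) y), ψ.toFun (P.indexAt x) y⟫_ℂ •
      vf (P.frame (P.indexAt x) k) y) fun k _ => SmoothVFAt.smul ?_
        ((hs.smooth k).at hs.isOpen hx)).congr ?_
  · exact (τ.contMDiff.comp_contMDiffOn
      (φ.contMDiffOn_inner ψ (γ.rep (clE k)) _)).contMDiffAt (hs.isOpen.mem_nhds hx)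
  · filter_upwards [hs.isOpen.mem_nhds hx] with y hy
    rw [vf, current_eq τ φ ψ hy]
    simp [vf]

end SpinorCurrent

/-! ### Differentiating Clifford-algebra-valued maps -/

section CliffordCalculus

variable {n d : ℕ} {M : Type*} [TopologicalSpace M] [ChartedSpace (Eu n) M]
  [IsManifold (𝓡 n) ∞ M]

theorem dirDeriv_sum {κ : Type} (J : Finset κ) {f : κ → M → ℝ} {x : M}
    (hf : ∀ i ∈ J, MDifferentiableAt (𝓡 n) 𝓘(ℝ, ℝ) (f i) x) (v : TangentSpace (𝓡 n) x) :
    dirDeriv (fun y => ∑ i ∈ J, f i y) x v = ∑ i ∈ J, dirDeriv (f i) x v := by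
  have h := HasMFDerivAt.sum fun i hi => (hf i hi).hasMFDerivAt
  have h2 : (fun y => ∑ i ∈ J, f i y) = ∑ i ∈ J, f i := by
    funext y
    simp
  rw [dirDeriv, h2, h.mfderiv]
  have key : ∀ (g : κ → Eu n →L[ℝ] ℝ) (w : Eu n), (∑ i ∈ J, g i) w = ∑ i ∈ J, g i w := by
    intro g w
    simp
  exact key (fun i => mfderiv (𝓡 n) 𝓘(ℝ, ℝ) (f i) x) v

theorem dirDeriv_mul {f g : M → ℝ} {x : M} (hf : MDifferentiableAt (𝓡 n) 𝓘(ℝ, ℝ) f x)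
    (hg : MDifferentiableAt (𝓡 n) 𝓘(ℝ, ℝ) g x) (v : TangentSpace (𝓡 n) x) :
    dirDeriv (fun y => f y * g y) x v = f x * dirDeriv g x v + dirDeriv f x v * g x :=
  dirDeriv_bilin (ContinuousLinearMap.mul ℝ ℝ) hf hg v

/-- Coordinates on the Clifford algebra. -/
def clCoord (d : ℕ) : Cl d ≃ₗ[ℝ] (Fin (Module.finrank ℝ (Cl d)) → ℝ) :=
  (Module.finBasis ℝ (Cl d)).equivFun

variable (n) in
/-- Smoothness near `x` of a map into the Clifford algebra. -/
def ClSmoothAt (t : M → Cl d) (x : M) : Prop :=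
  ∀ l : Module.Dual ℝ (Cl d), ContMDiffAt (𝓡 n) 𝓘(ℝ, ℝ) ∞ (fun y => l (t y)) x

/-- The derivative of a map into the Clifford algebra in the direction of a tangent vector. -/
def clDeriv (t : M → Cl d) (x : M) (v : TangentSpace (𝓡 n) x) : Cl d :=
  (clCoord d).symm (dirDeriv (fun y => clCoord d (t y)) x v)

variable {t : M → Cl d} {x : M} (ht : ClSmoothAt n t x)
include ht

theorem ClSmoothAt.mdifferentiableAt_coord :
    MDifferentiableAt (𝓡 n) 𝓘(ℝ, Fin (Module.finrank ℝ (Cl d)) → ℝ)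
      (fun y => clCoord d (t y)) x :=
  ContMDiffAt.mdifferentiableAt (n := ∞) (contMDiffAt_pi_space.2 fun i =>
    ht ((LinearMap.proj i).comp (clCoord d).toLinearMap)) (by simp)

/-- Derivatives of Clifford-valued maps are defined in coordinates; this lemma allows identities
between them to be tested on linear forms. -/
theorem dirDeriv_dual_cl (l : Module.Dual ℝ (Cl d)) (v : TangentSpace (𝓡 n) x) :
    dirDeriv (fun y => l (t y)) x v = l (clDeriv t x v) := by
  have h := dirDeriv_clm (LinearMap.toContinuousLinearMap (l.comp (clCoord d).symm.toLinearMap))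
    ht.mdifferentiableAt_coord v
  simpa [clDeriv] using h

theorem dirDeriv_bilin_cl {E G : Type*} [NormedAddCommGroup E] [NormedSpace ℝ E]
    [FiniteDimensional ℝ E] [NormedAddCommGroup G] [NormedSpace ℝ G] (B : Cl d →ₗ[ℝ] E →ₗ[ℝ] G)
    {f : M → E} (hf : MDifferentiableAt (𝓡 n) 𝓘(ℝ, E) f x) (v : TangentSpace (𝓡 n) x) :
    dirDeriv (fun y => B (t y) (f y)) x v =
      B (t x) (dirDeriv f x v) + B (clDeriv t x v) (f x) := by
  have h := dirDeriv_bilin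
    (LinearMap.toContinuousBilinearMap (B.comp (clCoord d).symm.toLinearMap))
    ht.mdifferentiableAt_coord hf v
  simpa [clDeriv] using h

theorem dirDeriv_bilin_cl_cl (B : Cl d →ₗ[ℝ] Cl d →ₗ[ℝ] ℝ) {u : M → Cl d} (hu : ClSmoothAt n u x)
    (v : TangentSpace (𝓡 n) x) :
    dirDeriv (fun y => B (t y) (u y)) x v = B (t x) (clDeriv u x v) + B (clDeriv t x v) (u x) := by
  have h := dirDeriv_bilin_cl ht
    (LinearMap.compr₂ₛₗ B (LinearMap.id) |>.compl₂ (clCoord d).symm.toLinearMap)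
    hu.mdifferentiableAt_coord v
  simpa [clDeriv] using h

/-- A vector outside a subspace is detected by a linear form vanishing on the subspace, and along
`t` this form is locally constant. Used with `p` the even part. -/
theorem clDeriv_mem {p : Submodule ℝ (Cl d)} (hp : ∀ᶠ y in 𝓝 x, t y ∈ p)
    (v : TangentSpace (𝓡 n) x) : clDeriv t x v ∈ p := by
  by_contra h
  obtain ⟨l, hl, hpl⟩ := Submodule.exists_le_ker_of_notMem h
  refine hl ?_
  rw [← dirDeriv_dual_cl ht l v]
  refine dirDeriv_eq_zero_of_eventuallyEq_const (c := 0) ?_ v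
  filter_upwards [hp] with y hy using hpl hy

omit ht in
theorem eq_of_dual_eq {a b : Cl d} (h : ∀ l : Module.Dual ℝ (Cl d), l a = l b) : a = b := by
  rw [← sub_eq_zero, ← Module.forall_dual_apply_eq_zero_iff ℝ]
  intro l
  rw [map_sub, h, sub_self]

omit ht in
/-- The involution `star` of the Clifford algebra as a linear map. -/
def starLin (d : ℕ) : Cl d →ₗ[ℝ] Cl d where
  toFun := star
  map_add' := star_add
  map_smul' _ _ := CliffordAlgebra.star_smul _ _

omit ht in
theorem starLin_apply (a : Cl d) : starLin d a = star a := rfl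

end CliffordCalculus

/-! ### Transition functions intertwine the connection forms -/

section Covariance

variable {n d : ℕ} {M : Type*} [TopologicalSpace M] [ChartedSpace (Eu n) M]
  [IsManifold (𝓡 n) ∞ M] {S : SubRiemannianStructure n M d} (C : MetricConnection S)
  {ι : Type*} (P : SpinStructure S ι) {a b : ι} {x : M} (hx : x ∈ P.baseSet a ∩ P.baseSet b)
include hx

theorem SpinStructure.isOpen_inter : P.baseSet a ∩ P.baseSet b ∈ 𝓝 x :=
  ((P.isOrthonormalFrame a).isOpen.inter (P.isOrthonormalFrame b).isOpen).mem_nhds hx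

theorem SpinStructure.clSmoothAt_transition :
    ClSmoothAt n (fun y => (P.transition a b y : Cl d)) x := fun l =>
  (P.transition_smooth a b l).contMDiffAt (P.isOpen_inter hx)

theorem SpinStructure.contMDiffAt_inner (i j : Fin d) : ContMDiffAt (𝓡 n) 𝓘(ℝ, ℝ) ∞
    (fun y => S.g y (P.frame a i y) (P.frame b j y)) x :=
  (S.g_smooth _ _ _ ((P.isOrthonormalFrame a).isOpen.inter (P.isOrthonormalFrame b).isOpen)
    (((P.isOrthonormalFrame a).smooth i).mono Set.inter_subset_left)
    (((P.isOrthonormalFrame b).smooth j).mono Set.inter_subset_right)).contMDiffAt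
    (P.isOpen_inter hx)

/-- The derivative of `star t * t = 1`. -/
theorem SpinStructure.star_clDeriv_transition (v : TangentSpace (𝓡 n) x) :
    star (clDeriv (fun y => (P.transition a b y : Cl d)) x v) * (P.transition a b x : Cl d) =
      -(star (P.transition a b x : Cl d) *
        clDeriv (fun y => (P.transition a b y : Cl d)) x v) := by
  have ht := P.clSmoothAt_transition hx
  rw [eq_neg_iff_add_eq_zero, add_comm]
  refine eq_of_dual_eq fun l => ?_
  have h := dirDeriv_bilin_cl_cl ht (((LinearMap.mul ℝ (Cl d)).comp (starLin d)).compr₂ l) ht v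
  rw [dirDeriv_eq_zero_of_eventuallyEq_const (c := l 1)] at h
  · simpa [starLin_apply] using h.symm
  · refine Filter.Eventually.of_forall fun y => ?_
    simp [starLin_apply]

/-- The derivative of the lifting relation in the form t e_j = ∑ᵢ C_ij e_i t, which avoids
differentiating `star t`. -/
theorem SpinStructure.clDeriv_transition_mul (v : TangentSpace (𝓡 n) x) (j : Fin d) :
    clDeriv (fun y => (P.transition a b y : Cl d)) x v * clE j =
      ∑ i, (S.g x (P.frame a i x) (P.frame b j x) •
          (clE i * clDeriv (fun y => (P.transition a b y : Cl d)) x v) +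
        dirDeriv (fun y => S.g y (P.frame a i y) (P.frame b j y)) x v •
          (clE i * (P.transition a b x : Cl d))) := by
  have ht := P.clSmoothAt_transition hx
  refine eq_of_dual_eq fun l => ?_
  have h1 := dirDeriv_dual_cl ht (l.comp (LinearMap.mulRight ℝ (clE j))) v
  have h2 : ∀ i, MDifferentiableAt (𝓡 n) 𝓘(ℝ, ℝ)
      (fun y => l (clE i * (P.transition a b y : Cl d))) x := fun i =>
    (ht (l.comp (LinearMap.mulLeft ℝ (clE i)))).mdifferentiableAt (by simp)
  have h3 : ∀ i, MDifferentiableAt (𝓡 n) 𝓘(ℝ, ℝ)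
      (fun y => S.g y (P.frame a i y) (P.frame b j y)) x := fun i =>
    (P.contMDiffAt_inner hx i j).mdifferentiableAt (by simp)
  rw [LinearMap.comp_apply, LinearMap.mulRight_apply] at h1
  rw [← h1, dirDeriv_congr (g := fun y => ∑ i, S.g y (P.frame a i y) (P.frame b j y) *
    l (clE i * (P.transition a b y : Cl d))), dirDeriv_sum, map_sum]
  · refine Finset.sum_congr rfl fun i _ => ?_
    rw [dirDeriv_mul (h3 i) (h2 i)]
    have h4 := dirDeriv_dual_cl ht (l.comp (LinearMap.mulLeft ℝ (clE i))) v
    simp only [LinearMap.comp_apply, LinearMap.mulLeft_apply] at h4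
    rw [h4]
    simp
  · intro i _
    have := ((P.contMDiffAt_inner hx i j).mul (ht (l.comp (LinearMap.mulLeft ℝ (clE i)))))
    exact this.mdifferentiableAt (by simp)
  · filter_upwards [P.isOpen_inter hx] with y hy
    have h5 : (P.transition a b y : Cl d) * clE j =
        (∑ i, S.g y (P.frame a i y) (P.frame b j y) • clE i) * (P.transition a b y : Cl d) := by
      rw [← P.lift a b y hy j, mul_assoc, spinGroup.coe_star_mul_self, mul_one]
    rw [LinearMap.comp_apply, LinearMap.mulRight_apply, h5, Finset.sum_mul, map_sum]
    simp

/-- The transition function intertwines the connection forms of the two frames. -/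
theorem SpinStructure.clDeriv_transition_eq (v : S.H x) :
    clDeriv (fun y => (P.transition a b y : Cl d)) x (v : TangentSpace (𝓡 n) x) =
      (P.transition a b x : Cl d) * spinElt (connCoeff C (P.frame b) x v) -
        spinElt (connCoeff C (P.frame a) x v) * (P.transition a b x : Cl d) := by
  have hsa := P.isOrthonormalFrame a
  have hsb := P.isOrthonormalFrame b
  set t : Spin d := P.transition a b x with ht
  set dt := clDeriv (fun y => (P.transition a b y : Cl d)) x (v : TangentSpace (𝓡 n) x) with hdt
  set Γa := spinElt (connCoeff C (P.frame a) x v) with hΓa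
  set Γb := spinElt (connCoeff C (P.frame b) x v) with hΓb
  have htt : star (t : Cl d) * (t : Cl d) = 1 := spinGroup.coe_star_mul_self t
  have htt' : (t : Cl d) * star (t : Cl d) = 1 := spinGroup.coe_mul_star_self t
  have hka := fun i => clE_mul_spinElt_sub (connCoeff C (P.frame a) x v)
    (fun i j => connCoeff_skew C hsa hx.1 v i j) i
  have hkb := fun i => clE_mul_spinElt_sub (connCoeff C (P.frame b) x v)
    (fun i j => connCoeff_skew C hsb hx.2 v i j) i
  rw [← hΓa] at hka
  rw [← hΓb] at hkb
  -- The claim multiplied on the left by t⁻¹. The left side is even, skew and central with respect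
  -- to vectors, hence zero: an infinitesimal spin transformation is determined by the infinitesimal
  -- rotation it induces.
  have hW : star (t : Cl d) * dt - Γb + star (t : Cl d) * Γa * t = 0 := by
    refine eq_zero_of_even_of_commute_of_skew ?_ (fun j => ?_) ?_
    · have hev : ∀ u : Spin d, (u : Cl d) ∈ CliffordAlgebra.even (Qneg d) := fun u =>
        spinGroup.mem_even u.2
      have hst : star (t : Cl d) ∈ CliffordAlgebra.even (Qneg d) := hev (star t)
      have hdte : dt ∈ CliffordAlgebra.even (Qneg d) :=
        clDeriv_mem (p := Subalgebra.toSubmodule (CliffordAlgebra.even (Qneg d)))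
          (P.clSmoothAt_transition hx) (Filter.Eventually.of_forall fun y => hev _) _
      have hae : Γa ∈ CliffordAlgebra.even (Qneg d) := spinElt_mem_even _
      have hbe : Γb ∈ CliffordAlgebra.even (Qneg d) := spinElt_mem_even _
      have h : star (t : Cl d) * dt - Γb + star (t : Cl d) * Γa * t ∈
          CliffordAlgebra.even (Qneg d) :=
        add_mem (sub_mem (mul_mem hst hdte) hbe) (mul_mem (mul_mem hst hae) (hev t))
      exact h
    · have hlift := P.lift a b x hx j
      rw [← ht] at hlift
      have hconj : ∀ z : Cl d, star (t : Cl d) * ((t : Cl d) * clE j * star (t : Cl d)) * z =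
          clE j * (star (t : Cl d) * z) := fun z => by
        simp only [← mul_assoc, htt, one_mul]
      -- The bracket of t⁻¹dt with e_j is governed by the derivative of the transition matrix of the
      -- frames.
      have hA : star (t : Cl d) * dt * clE j = clE j * (star (t : Cl d) * dt) +
          ∑ i, dirDeriv (fun y => S.g y (P.frame a i y) (P.frame b j y)) x
            (v : TangentSpace (𝓡 n) x) • (star (t : Cl d) * clE i * t) := by
        rw [mul_assoc, P.clDeriv_transition_mul hx, ← hconj, hlift, Finset.sum_add_distrib, mul_add]
        simp only [Finset.mul_sum, Finset.sum_mul, mul_smul_comm, smul_mul_assoc, mul_assoc, ht,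
          hdt]
      have hX : clE j * (star (t : Cl d) * Γa * t) - star (t : Cl d) * Γa * t * clE j =
          -∑ i, ∑ k, (S.g x (P.frame a i x) (P.frame b j x) * connCoeff C (P.frame a) x v i k) •
            (star (t : Cl d) * clE k * t) := by
        have h1 : clE j * (star (t : Cl d) * Γa * t) =
            star (t : Cl d) * ((t : Cl d) * clE j * star (t : Cl d)) * (Γa * t) := by
          rw [hconj]
          simp only [mul_assoc]
        have h2 : star (t : Cl d) * Γa * t * clE j =
            star (t : Cl d) * (Γa * ((t : Cl d) * clE j * star (t : Cl d))) * t := by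
          simp only [mul_assoc, htt, mul_one]
        have h3 : ∀ i, star (t : Cl d) * clE i * (Γa * t) - star (t : Cl d) * (Γa * clE i) * t =
            -∑ k, connCoeff C (P.frame a) x v i k • (star (t : Cl d) * clE k * t) := by
          intro i
          have h4 := congrArg (fun z => star (t : Cl d) * z * t) (hka i)
          simp only [mul_sub, sub_mul, mul_neg, neg_mul, Finset.mul_sum, Finset.sum_mul,
            mul_smul_comm, smul_mul_assoc] at h4
          rw [← h4]
          simp only [mul_assoc]
        rw [h1, h2, hlift]
        simp only [Finset.mul_sum, Finset.sum_mul, mul_smul_comm, smul_mul_assoc]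
        rw [← Finset.sum_sub_distrib, ← Finset.sum_neg_distrib]
        refine Finset.sum_congr rfl fun i _ => ?_
        rw [← smul_sub, h3, smul_neg, Finset.smul_sum]
        simp only [smul_smul]
      have hB : ∑ k, connCoeff C (P.frame b) x v j k • (clE k : Cl d) =
          ∑ i, (∑ k, connCoeff C (P.frame b) x v j k * S.g x (P.frame a i x) (P.frame b k x)) •
            (star (t : Cl d) * clE i * t) := by
        have h1 : ∀ k, (clE k : Cl d) = ∑ i, S.g x (P.frame a i x) (P.frame b k x) •
            (star (t : Cl d) * clE i * t) := by
          intro k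
          have h2 : (clE k : Cl d) =
              star (t : Cl d) * ((t : Cl d) * clE k * star (t : Cl d)) * t := by
            simp only [← mul_assoc, htt, one_mul]
            rw [mul_assoc, htt, mul_one]
          conv_lhs => rw [h2, ht, P.lift a b x hx k]
          simp only [Finset.mul_sum, Finset.sum_mul, mul_smul_comm, smul_mul_assoc, ht]
        simp only [Finset.sum_smul]
        rw [Finset.sum_comm]
        refine Finset.sum_congr rfl fun k _ => ?_
        conv_lhs => rw [h1 k, Finset.smul_sum]
        simp only [smul_smul]
      -- Metricity of ∇ expresses this derivative through the connection coefficients of both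
      -- frames, which makes the three brackets with e_j cancel.
      have hC : ∀ i, dirDeriv (fun y => S.g y (P.frame a i y) (P.frame b j y)) x
          (v : TangentSpace (𝓡 n) x) =
          ∑ k, connCoeff C (P.frame b) x v j k * S.g x (P.frame a i x) (P.frame b k x) -
            ∑ m, S.g x (P.frame a m x) (P.frame b j x) * connCoeff C (P.frame a) x v m i := by
        intro i
        rw [C.metric _ _ _ (hsa.isOpen.inter hsb.isOpen) ((hsa.smooth i).mono Set.inter_subset_left)
          ((hsb.smooth j).mono Set.inter_subset_right) x hx v]
        have h1 := congrArg (S.g x (P.frame a i x))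
          (hsb.sum_smul hx.2 (C.toFun (P.frame b j) x v))
        have h2 := congrArg (fun w => S.g x w (P.frame b j x))
          (hsa.sum_smul hx.1 (C.toFun (P.frame a i) x v))
        simp only [map_sum, map_smul, LinearMap.sum_apply, LinearMap.smul_apply, smul_eq_mul]
          at h1 h2
        rw [← h1, ← h2, add_comm, sub_eq_add_neg, ← Finset.sum_neg_distrib]
        congr 1
        refine Finset.sum_congr rfl fun m _ => ?_
        rw [connCoeff_skew C hsa hx.1 v m i, connCoeff]
        ring
      have hX' : ∑ i, ∑ k, (S.g x (P.frame a i x) (P.frame b j x) *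
          connCoeff C (P.frame a) x v i k) • (star (t : Cl d) * clE k * t) =
          ∑ i, (∑ m, S.g x (P.frame a m x) (P.frame b j x) *
            connCoeff C (P.frame a) x v m i) • (star (t : Cl d) * clE i * t) := by
        rw [Finset.sum_comm]
        simp only [Finset.sum_smul]
      have hD : ∑ i, dirDeriv (fun y => S.g y (P.frame a i y) (P.frame b j y)) x
            (v : TangentSpace (𝓡 n) x) • (star (t : Cl d) * clE i * t) =
          ∑ k, connCoeff C (P.frame b) x v j k • (clE k : Cl d) -
          ∑ i, ∑ k, (S.g x (P.frame a i x) (P.frame b j x) *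
            connCoeff C (P.frame a) x v i k) • (star (t : Cl d) * clE k * t) := by
        rw [hB, hX', ← Finset.sum_sub_distrib]
        refine Finset.sum_congr rfl fun i _ => ?_
        rw [hC, sub_smul]
      have hBj := hkb j
      rw [hD] at hA
      rw [← sub_eq_zero, mul_add, mul_sub, add_mul, sub_mul, hA]
      rw [sub_eq_iff_eq_add] at hBj hX
      rw [hBj, hX]
      abel
    · have h := P.star_clDeriv_transition hx (v : TangentSpace (𝓡 n) x)
      rw [← hdt, ← ht] at h
      simp only [star_add, star_sub, star_mul, star_star, h, hΓa, hΓb, star_spinElt]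
      noncomm_ring
  have h := congrArg (fun z => (t : Cl d) * z) hW
  simp only [mul_add, mul_sub, ← mul_assoc, htt', one_mul, mul_zero] at h
  rw [sub_add_eq_add_sub, sub_eq_zero] at h
  rw [← h, add_sub_cancel_right]

end Covariance

/-! ### Covariance of the sub-Dirac operator and the integrated identity -/

section DiracCovariance

variable {n d : ℕ} {M : Type*} [TopologicalSpace M] [ChartedSpace (Eu n) M]
  [IsManifold (𝓡 n) ∞ M] {S : SubRiemannianStructure n M d} (C : MetricConnection S)
  {ι : Type*} {P : SpinStructure S ι}
  {Δ : Type*} [NormedAddCommGroup Δ] [InnerProductSpace ℂ Δ] {γ : SpinorModule d Δ}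

/-- The Clifford action as a real bilinear map. -/
def SpinorModule.repBilin (γ : SpinorModule d Δ) : Cl d →ₗ[ℝ] Δ →ₗ[ℝ] Δ :=
  LinearMap.mk₂ ℝ (fun c φ => γ.rep c φ) (fun a b φ => by simp) (fun r a φ => by simp)
    (fun a φ ψ => by simp)
    (fun r a φ => by rw [← Complex.coe_smul, map_smul, Complex.coe_smul])

theorem SpinorModule.repBilin_apply (γ : SpinorModule d Δ) (c : Cl d) (φ : Δ) :
    γ.repBilin c φ = γ.rep c φ := rfl

/-- The spinor connection as a linear map in the direction of differentiation. -/
def spinDerivLin (C : MetricConnection S) (P : SpinStructure S ι) (γ : SpinorModule d Δ)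
    (ψ : ι → M → Δ) (a : ι) (x : M) : S.H x →ₗ[ℝ] Δ where
  toFun := spinDeriv C P γ ψ a x
  map_add' v w := by
    have h : dirDeriv (ψ a) x ((v + w : S.H x) : TangentSpace (𝓡 n) x) =
        dirDeriv (ψ a) x (v : TangentSpace (𝓡 n) x) + dirDeriv (ψ a) x (w : TangentSpace (𝓡 n) x) :=
      map_add (mfderiv (𝓡 n) 𝓘(ℝ, Δ) (ψ a) x) _ _
    simp only [spinDeriv, h, map_add, LinearMap.add_apply, add_smul, Finset.sum_add_distrib,
      smul_add]
    abel
  map_smul' c v := by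
    have h : dirDeriv (ψ a) x ((c • v : S.H x) : TangentSpace (𝓡 n) x) =
        c • dirDeriv (ψ a) x (v : TangentSpace (𝓡 n) x) :=
      map_smul (mfderiv (𝓡 n) 𝓘(ℝ, Δ) (ψ a) x) _ _
    simp only [spinDeriv, h, map_smul, LinearMap.smul_apply, smul_eq_mul, mul_smul, smul_add,
      Finset.smul_sum, RingHom.id_apply]
    congr 1
    refine Finset.sum_congr rfl fun i _ => Finset.sum_congr rfl fun j _ => ?_
    rw [smul_comm]

theorem spinDerivLin_apply (ψ : ι → M → Δ) (a : ι) (x : M) (v : S.H x) :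
    spinDerivLin C P γ ψ a x v = spinDeriv C P γ ψ a x v := rfl

variable [FiniteDimensional ℂ Δ]

/-- In the derivative of φ_a = t φ_b, the term with dt is exactly what turns Γ_b into Γ_a. -/
theorem spinDeriv_transition (φ : SpinorField P γ) {a b : ι} {x : M}
    (hx : x ∈ P.baseSet a ∩ P.baseSet b) (v : S.H x) :
    spinDeriv C P γ φ.toFun a x v =
      γ.rep (P.transition a b x : Cl d) (spinDeriv C P γ φ.toFun b x v) := by
  have := FiniteDimensional.complexToReal Δ
  rw [spinDeriv_eq, spinDeriv_eq, φ.compat a b x hx,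
    dirDeriv_congr (g := fun y => γ.repBilin (P.transition a b y : Cl d) (φ.toFun b y)),
    dirDeriv_bilin_cl (P.clSmoothAt_transition hx) γ.repBilin (φ.mdifferentiableAt hx.2),
    P.clDeriv_transition_eq C hx]
  · simp only [γ.repBilin_apply, map_sub, map_mul, map_add, LinearMap.sub_apply,
      Module.End.mul_apply]
    abel
  · filter_upwards [P.isOpen_inter hx] with y hy using φ.compat a b y hy

theorem dirac_transition (φ : SpinorField P γ) {a b : ι} {x : M}
    (hx : x ∈ P.baseSet a ∩ P.baseSet b) :
    dirac C P γ φ a x = γ.rep (P.transition a b x : Cl d) (dirac C P γ φ b x) := by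
  have h1 : ∀ i, γ.rep (clE i) (spinDeriv C P γ φ.toFun a x (P.frame a i x)) =
      ∑ j, S.g x (P.frame a i x) (P.frame b j x) • γ.rep (P.transition a b x : Cl d)
        (γ.rep (clE j) (spinDerivLin C P γ φ.toFun b x (P.frame a i x))) := by
    intro i
    have h2 : clE i * (P.transition a b x : Cl d) = (P.transition a b x : Cl d) *
        ∑ j, S.g x (P.frame a i x) (P.frame b j x) • clE j := by
      have htt : (P.transition a b x : Cl d) * star (P.transition a b x : Cl d) = 1 :=
        spinGroup.coe_mul_star_self _
      rw [← P.star_transition_mul hx, ← mul_assoc, ← mul_assoc, htt, one_mul]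
    rw [spinDeriv_transition C φ hx, ← Module.End.mul_apply, ← map_mul, h2]
    simp only [map_mul, map_sum, map_smul, Module.End.mul_apply, LinearMap.sum_apply,
      LinearMap.smul_apply, ← Complex.coe_smul, spinDerivLin_apply]
  have h3 : ∀ j, γ.rep (clE j) (spinDeriv C P γ φ.toFun b x (P.frame b j x)) =
      ∑ i, S.g x (P.frame a i x) (P.frame b j x) •
        γ.rep (clE j) (spinDerivLin C P γ φ.toFun b x (P.frame a i x)) := by
    intro j
    rw [← spinDerivLin_apply]
    conv_lhs => rw [← (P.isOrthonormalFrame a).sum_smul hx.1 (P.frame b j x)]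
    simp only [map_sum, map_smul, ← Complex.coe_smul]
    exact Finset.sum_congr rfl fun i _ => by rw [S.g_symm]
  rw [dirac, dirac, Finset.sum_congr rfl fun i _ => h1 i, Finset.sum_congr rfl fun j _ => h3 j,
    Finset.sum_comm]
  simp only [map_sum, ← Complex.coe_smul, map_smul]

theorem inner_dirac_transition (φ ψ : SpinorField P γ) {a b : ι} {x : M}
    (hx : x ∈ P.baseSet a ∩ P.baseSet b) :
    ⟪dirac C P γ φ a x, ψ.toFun a x⟫_ℂ = ⟪dirac C P γ φ b x, ψ.toFun b x⟫_ℂ := by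
  rw [dirac_transition C φ hx, ψ.compat a b x hx, γ.inner_spin]

theorem continuousOn_dirac (φ : SpinorField P γ) (a : ι) :
    ContinuousOn (dirac C P γ φ a) (P.baseSet a) := by
  have hs := P.isOrthonormalFrame a
  have hφ := (φ.smooth a).continuousOn
  refine continuousOn_finsetSum _ fun i _ =>
    (realCLM (γ.rep (clE i))).continuous.comp_continuousOn ?_
  refine (continuousOn_dirDeriv hs.isOpen (φ.smooth a) (hs.smooth i)).add
    (ContinuousOn.const_smul ?_ _)
  refine continuousOn_finsetSum _ fun j _ => continuousOn_finsetSum _ fun k _ => ?_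
  refine ContinuousOn.smul ?_ ((realCLM (γ.rep (clE j * clE k))).continuous.comp_continuousOn hφ)
  exact Complex.continuous_ofReal.comp_continuousOn (S.g_smooth _ _ _ hs.isOpen
    (C.smooth _ _ _ hs.isOpen (hs.smooth i) (hs.smooth j)) (hs.smooth k)).continuousOn

/-- Covariance is essential here: the integrand is written with an arbitrary choice of
trivialisation at every point, and is continuous only because that choice does not affect it. -/
theorem continuous_inner_dirac (φ ψ : SpinorField P γ) :
    Continuous fun x => ⟪dirac C P γ φ (P.indexAt x) x, ψ.toFun (P.indexAt x) x⟫_ℂ := by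
  refine continuous_iff_continuousAt.2 fun x => ?_
  have hx := P.mem_baseSet_at x
  have hU := (P.isOrthonormalFrame (P.indexAt x)).isOpen.mem_nhds hx
  refine ContinuousAt.congr (((continuousOn_dirac C φ _).continuousAt hU).inner (𝕜 := ℂ)
    ((ψ.smooth _).continuousOn.continuousAt hU)) ?_
  filter_upwards [hU] with y hy
  exact inner_dirac_transition C φ ψ ⟨hy, P.mem_baseSet_at y⟩

variable [T2Space M] [MeasurableSpace M] [BorelSpace M] (Ω : VolumeForm n M)

theorem integrable_inner_dirac [SecondCountableTopology M] (φ : SpinorField P γ)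
    {ψ : SpinorField P γ} (hψ : ψ.HasCompactSupp) :
    MeasureTheory.Integrable
      (fun x => ⟪dirac C P γ φ (P.indexAt x) x, ψ.toFun (P.indexAt x) x⟫_ℂ) Ω.measure := by
  have := Ω.isLocallyFiniteMeasure
  obtain ⟨K, hK, h0⟩ := hψ
  refine (continuous_inner_dirac C φ ψ).integrable_of_hasCompactSupport
    (HasCompactSupport.intro hK fun x hx => ?_)
  rw [h0 _ x (P.mem_baseSet_at x) hx, inner_zero_right]

theorem integrable_inner_dirac_right [SecondCountableTopology M] {φ : SpinorField P γ}
    (ψ : SpinorField P γ) (hφ : φ.HasCompactSupp) :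
    MeasureTheory.Integrable
      (fun x => ⟪φ.toFun (P.indexAt x) x, dirac C P γ ψ (P.indexAt x) x⟫_ℂ) Ω.measure := by
  have h := ContinuousLinearMap.integrable_comp (Complex.conjCLE : ℂ →L[ℝ] ℂ)
    (integrable_inner_dirac C Ω ψ hφ)
  refine h.congr (Filter.Eventually.of_forall fun x => ?_)
  exact inner_conj_symm (𝕜 := ℂ) _ _

theorem continuousOn_div {X : ∀ x, S.H x} {U : Set M} (hU : IsOpen U) (hX : SmoothVF (vf X) U)
    (P : SpinStructure S ι) : ContinuousOn (C.div X) U := by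
  intro x hx
  refine ContinuousAt.continuousWithinAt ?_
  set a := P.indexAt x
  have hxa : x ∈ P.baseSet a := P.mem_baseSet_at x
  have hs := P.isOrthonormalFrame a
  have hW := hs.isOpen.inter hU
  have h1 : ContinuousOn (fun y => ∑ i, S.g y (C.toFun X y (P.frame a i y)) (P.frame a i y))
      (P.baseSet a ∩ U) := by
    refine continuousOn_finsetSum _ fun i _ => ?_
    have hi := (hs.smooth i).mono (Set.inter_subset_left (t := U))
    exact (S.g_smooth _ _ _ hW (C.smooth _ _ _ hW hi (hX.mono Set.inter_subset_right))
      hi).continuousOn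
  refine (h1.continuousAt (hW.mem_nhds ⟨hxa, hx⟩)).congr ?_
  filter_upwards [hW.mem_nhds ⟨hxa, hx⟩] with y hy
  exact (C.div_eq hs X hy.1).symm

theorem continuousOn_defect {X : ∀ x, S.H x} {U : Set M} (hU : IsOpen U) (hX : SmoothVF (vf X) U)
    (P : SpinStructure S ι) : ContinuousOn (defect C Ω X) U :=
  (Ω.continuousOn_divergence hU hX).sub (continuousOn_div C hU hX P)

theorem current_eq_zero (τ : ℂ →L[ℝ] ℝ) (φ : SpinorField P γ) {ψ : SpinorField P γ} {K : Set M}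
    (h0 : ∀ a, ∀ x ∈ P.baseSet a, x ∉ K → ψ.toFun a x = 0) {x : M} (hx : x ∉ K) :
    current τ φ ψ x = 0 := by
  simp [current, h0 _ x (P.mem_baseSet_at x) hx]

/-- The integrand is the connection divergence of the current, and the integral of `Div` of the
current is zero, so minus the defect may be integrated instead. The form τ makes the current a real
vector field. -/
theorem clm_L2inner_dirac_sub [SecondCountableTopology M] (τ : ℂ →L[ℝ] ℝ) {φ ψ : SpinorField P γ}
    (hφ : φ.HasCompactSupp) (hψ : ψ.HasCompactSupp) :
    τ (L2inner Ω P (dirac C P γ φ) ψ.toFun - L2inner Ω P φ.toFun (dirac C P γ ψ)) =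
      -∫ x, defect C Ω (current τ φ ψ) x ∂Ω.measure := by
  have := Ω.isLocallyFiniteMeasure
  have hI : MeasureTheory.Integrable (fun x =>
      ⟪dirac C P γ φ (P.indexAt x) x, ψ.toFun (P.indexAt x) x⟫_ℂ -
        ⟪φ.toFun (P.indexAt x) x, dirac C P γ ψ (P.indexAt x) x⟫_ℂ) Ω.measure :=
    (integrable_inner_dirac C Ω φ hψ).sub (integrable_inner_dirac_right C Ω ψ hφ)
  have hdiv : ∀ x, C.div (current τ φ ψ) x =
      τ (⟪dirac C P γ φ (P.indexAt x) x, ψ.toFun (P.indexAt x) x⟫_ℂ -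
        ⟪φ.toFun (P.indexAt x) x, dirac C P γ ψ (P.indexAt x) x⟫_ℂ) := fun x =>
    div_current C τ φ ψ (P.mem_baseSet_at x)
  have hIdiv : MeasureTheory.Integrable (C.div (current τ φ ψ)) Ω.measure :=
    (ContinuousLinearMap.integrable_comp τ hI).congr
      (Filter.Eventually.of_forall fun x => (hdiv x).symm)
  obtain ⟨K, hK, h0⟩ := hψ
  have hZ := smoothVF_current τ φ ψ
  have hZ0 : ∀ x, x ∉ K → vf (current τ φ ψ) x = 0 := fun x hx => by
    simp [vf, current_eq_zero τ φ h0 hx]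
  have hIDiv : MeasureTheory.Integrable (Ω.divergence (vf (current τ φ ψ))) Ω.measure :=
    (continuousOn_univ.1 (Ω.continuousOn_divergence isOpen_univ hZ)).integrable_of_hasCompactSupport
      (HasCompactSupport.intro hK fun x hx => Ω.divergence_eq_zero hK.isClosed hZ0 hx)
  rw [L2inner, L2inner, ← MeasureTheory.integral_sub (integrable_inner_dirac C Ω φ ⟨K, hK, h0⟩)
    (integrable_inner_dirac_right C Ω ψ hφ), ← ContinuousLinearMap.integral_comp_comm τ hI]
  simp only [defect]
  rw [MeasureTheory.integral_sub hIDiv hIdiv, Ω.integral_divergence hZ hK hZ0, zero_sub, neg_neg]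
  exact MeasureTheory.integral_congr_ae (Filter.Eventually.of_forall fun x => (hdiv x).symm)

/-- If `Div` and the divergence of the connection agree, then the sub-Dirac operator is
symmetric. -/
theorem diracIsSymmetric_of_defect_eq_zero [SecondCountableTopology M]
    (h : ∀ X : ∀ x, S.H x, SmoothVF (vf X) Set.univ → ∀ x, defect C Ω X x = 0) :
    DiracIsSymmetric Ω C P γ := by
  intro φ ψ hφ hψ
  have key : ∀ τ : ℂ →L[ℝ] ℝ,
      τ (L2inner Ω P (dirac C P γ φ) ψ.toFun - L2inner Ω P φ.toFun (dirac C P γ ψ)) = 0 := by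
    intro τ
    rw [clm_L2inner_dirac_sub C Ω τ hφ hψ]
    simp [h _ (smoothVF_current τ φ ψ)]
  exact sub_eq_zero.1 (Complex.ext (key Complex.reCLM) (key Complex.imCLM))

end DiracCovariance

/-! ### Test spinors and the equivalence of symmetry with zero defect -/

section TestSpinors

variable {n d : ℕ} {M : Type*} [TopologicalSpace M] [ChartedSpace (Eu n) M]
  [IsManifold (𝓡 n) ∞ M] {S : SubRiemannianStructure n M d} (C : MetricConnection S)
  {ι : Type*} (P : SpinStructure S ι)
  {Δ : Type*} [NormedAddCommGroup Δ] [InnerProductSpace ℂ Δ] (γ : SpinorModule d Δ)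

theorem SpinStructure.transition_self {a : ι} {x : M} (hx : x ∈ P.baseSet a) :
    P.transition a a x = 1 :=
  mul_eq_left.1 (P.cocycle a a a x ⟨⟨hx, hx⟩, hx⟩)

variable [FiniteDimensional ℂ Δ]

theorem contMDiffAt_rep_apply {t : M → Cl d} {x : M} (ht : ClSmoothAt n t x) (φ : Δ) :
    ContMDiffAt (𝓡 n) 𝓘(ℝ, Δ) ∞ (fun y => γ.rep (t y) φ) x := by
  have h1 : ContMDiffAt (𝓡 n) 𝓘(ℝ, Fin (Module.finrank ℝ (Cl d)) → ℝ) ∞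
      (fun y => clCoord d (t y)) x := contMDiffAt_pi_space.2 fun i =>
    ht ((LinearMap.proj i).comp (clCoord d).toLinearMap)
  have h2 := (LinearMap.toContinuousLinearMap
    ((γ.repBilin.flip φ).comp (clCoord d).symm.toLinearMap)).contMDiff.contMDiffAt.comp x h1
  refine h2.congr_of_eventuallyEq (Filter.Eventually.of_forall fun y => ?_)
  simp [γ.repBilin_apply]

open Classical in
/-- The spinor field that is `χ φ₀` in the trivialisation with index `a`, where `χ` has compact
support in `U_a`. -/
def SpinorField.ofBump (a : ι) {χ : M → ℝ} {K : Set M} (hχ : ContMDiff (𝓡 n) 𝓘(ℝ, ℝ) ∞ χ)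
    (hK : IsClosed K) (hKa : K ⊆ P.baseSet a) (h0 : ∀ x, x ∉ K → χ x = 0) (φ₀ : Δ) :
    SpinorField P γ where
  -- On U_a the representative in every other trivialisation is forced by compatibility; off U_a
  -- zero extends it smoothly, since χ vanishes off the closed set `K ⊆ U_a`.
  toFun b y := if y ∈ P.baseSet a then χ y • γ.rep (P.transition b a y : Cl d) φ₀ else 0
  smooth b := by
    intro x hx
    refine ContMDiffAt.contMDiffWithinAt ?_
    by_cases hxK : x ∈ K
    · have hxa := hKa hxK
      have h := ContMDiffAt.smul (hχ x)
        (contMDiffAt_rep_apply γ (P.clSmoothAt_transition ⟨hx, hxa⟩) φ₀)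
      refine h.congr_of_eventuallyEq ?_
      filter_upwards [(P.isOrthonormalFrame a).isOpen.mem_nhds hxa] with y hy
      rw [if_pos hy, Pi.smul_apply']
    · refine (contMDiffAt_const (c := (0 : Δ))).congr_of_eventuallyEq ?_
      filter_upwards [hK.isOpen_compl.mem_nhds hxK] with y hy
      rw [h0 y hy, zero_smul, ite_self]
  compat b c x hx := by
    split_ifs with h
    · rw [← P.cocycle b c a x ⟨hx, h⟩, Submonoid.coe_mul, map_mul, Module.End.mul_apply,
        ← Complex.coe_smul, ← Complex.coe_smul, map_smul]
    · rw [map_zero]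

variable {P γ} {a : ι} {χ : M → ℝ} {K : Set M} (hχ : ContMDiff (𝓡 n) 𝓘(ℝ, ℝ) ∞ χ)
    (hK : IsClosed K) (hKa : K ⊆ P.baseSet a) (h0 : ∀ x, x ∉ K → χ x = 0) (φ₀ : Δ)

theorem SpinorField.ofBump_apply {x : M} (hx : x ∈ P.baseSet a) :
    (SpinorField.ofBump P γ a hχ hK hKa h0 φ₀).toFun a x = χ x • φ₀ := by
  simp [SpinorField.ofBump, hx, P.transition_self hx]

theorem SpinorField.ofBump_eq_zero (b : ι) {x : M} (hx : x ∉ K) :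
    (SpinorField.ofBump P γ a hχ hK hKa h0 φ₀).toFun b x = 0 := by
  simp [SpinorField.ofBump, h0 x hx]

theorem SpinorField.hasCompactSupp_ofBump (hKc : IsCompact K) :
    (SpinorField.ofBump P γ a hχ hK hKa h0 φ₀).HasCompactSupp :=
  ⟨K, hKc, fun b _ _ hx => SpinorField.ofBump_eq_zero hχ hK hKa h0 φ₀ b hx⟩

/-- The current of the test spinors `χ φ₀` and `χ e_k φ₀` is `χ² |φ₀|² s_k`. -/
theorem current_ofBump (k : Fin d) {x : M} (hx : x ∈ P.baseSet a) :
    current Complex.reCLM (SpinorField.ofBump P γ a hχ hK hKa h0 φ₀)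
      (SpinorField.ofBump P γ a hχ hK hKa h0 (γ.rep (clE k) φ₀)) x =
      (χ x ^ 2 * ‖φ₀‖ ^ 2) • P.frame a k x := by
  rw [current_eq _ _ _ hx, Finset.sum_eq_single k]
  · rw [SpinorField.ofBump_apply hχ hK hKa h0 _ hx, SpinorField.ofBump_apply hχ hK hKa h0 _ hx,
      ← Complex.coe_smul, ← Complex.coe_smul, map_smul, inner_smul_left, inner_smul_right,
      Complex.conj_ofReal, Complex.reCLM_apply, Complex.re_ofReal_mul, Complex.re_ofReal_mul,
      γ.re_inner_clE_clE, if_pos rfl]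
    congr 1
    ring
  · intro i _ hik
    rw [SpinorField.ofBump_apply hχ hK hKa h0 _ hx, SpinorField.ofBump_apply hχ hK hKa h0 _ hx,
      ← Complex.coe_smul, ← Complex.coe_smul, map_smul, inner_smul_left, inner_smul_right,
      Complex.conj_ofReal, Complex.reCLM_apply, Complex.re_ofReal_mul, Complex.re_ofReal_mul,
      γ.re_inner_clE_clE, if_neg hik, mul_zero, mul_zero, zero_smul]
  · simp

variable [T2Space M] [MeasurableSpace M] [BorelSpace M] [SecondCountableTopology M]
  (Ω : VolumeForm n M)

/-- The fundamental lemma of the calculus of variations: symmetry makes the integral of χ²|φ₀|²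
defect(s_k) zero for all bumps χ in U_a, and the defect is continuous. -/
theorem defect_frame_eq_zero_of_diracIsSymmetric (h : DiracIsSymmetric Ω C P γ) (a : ι) (k : Fin d)
    {p : M} (hp : p ∈ P.baseSet a) : defect C Ω (P.frame a k) p = 0 := by
  have hs := P.isOrthonormalFrame a
  have := Ω.isLocallyFiniteMeasure
  have := Ω.isOpenPosMeasure
  have := γ.nontrivial
  obtain ⟨φ₀, hφ₀⟩ := exists_ne (0 : Δ)
  by_contra hne
  set f := defect C Ω (P.frame a k) with hf
  have hfc : ContinuousOn f (P.baseSet a) := continuousOn_defect C Ω hs.isOpen (hs.smooth k) P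
  -- Multiplying by `f p` treats both signs of the defect at `p` at once.
  have hU : {y | y ∈ P.baseSet a ∧ 0 < f p * f y} ∈ 𝓝 p := by
    have h1 : ∀ᶠ y in 𝓝 p, 0 < f p * f y :=
      ((hfc.continuousAt (hs.isOpen.mem_nhds hp)).const_mul (f p)).eventually_const_lt
        (mul_self_pos.2 hne)
    filter_upwards [hs.isOpen.mem_nhds hp, h1] with y hy hy' using ⟨hy, hy'⟩
  obtain ⟨χ, K, hχ, h1, hKc, hKU, h0, -⟩ := exists_bump (n := n) hU
  have hKa : K ⊆ P.baseSet a := fun y hy => (hKU hy).1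
  set φ := SpinorField.ofBump P γ a hχ hKc.isClosed hKa h0 φ₀
  set ψ := SpinorField.ofBump P γ a hχ hKc.isClosed hKa h0 (γ.rep (clE k) φ₀)
  set Z := current Complex.reCLM φ ψ with hZdef
  have hZ : SmoothVF (vf Z) Set.univ := smoothVF_current _ φ ψ
  have hint : ∫ x, defect C Ω Z x ∂Ω.measure = 0 := by
    have h2 := clm_L2inner_dirac_sub C Ω Complex.reCLM
      (SpinorField.hasCompactSupp_ofBump hχ hKc.isClosed hKa h0 φ₀ hKc : φ.HasCompactSupp)
      (SpinorField.hasCompactSupp_ofBump hχ hKc.isClosed hKa h0 _ hKc : ψ.HasCompactSupp)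
    rw [h φ ψ (SpinorField.hasCompactSupp_ofBump hχ hKc.isClosed hKa h0 φ₀ hKc)
      (SpinorField.hasCompactSupp_ofBump hχ hKc.isClosed hKa h0 _ hKc), sub_self, map_zero] at h2
    linarith
  have hin : ∀ y ∈ P.baseSet a, defect C Ω Z y = χ y ^ 2 * ‖φ₀‖ ^ 2 * f y := by
    intro y hy
    have hZy : Z y = (χ y ^ 2 * ‖φ₀‖ ^ 2) • P.frame a k y :=
      current_ofBump hχ hKc.isClosed hKa h0 φ₀ k hy
    rw [defect_eq_sum_frame C Ω hs isOpen_univ hZ hy (Set.mem_univ y), Finset.sum_eq_single k]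
    · rw [hZy, map_smul, LinearMap.smul_apply, hs.orthonormal y hy, if_pos rfl, smul_eq_mul,
        mul_one]
    · intro j _ hjk
      rw [hZy, map_smul, LinearMap.smul_apply, hs.orthonormal y hy, if_neg hjk.symm, smul_zero,
        zero_mul]
    · simp
  have hout : ∀ y, y ∉ K → defect C Ω Z y = 0 := by
    intro y hy
    rw [defect_eq_sum_frame C Ω (P.isOrthonormalFrame (P.indexAt y)) isOpen_univ hZ
      (P.mem_baseSet_at y) (Set.mem_univ y)]
    have hZy : Z y = 0 := current_eq_zero _ φ
      (fun b x _ hx => SpinorField.ofBump_eq_zero hχ hKc.isClosed hKa h0 _ b hx) hy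
    simp [hZy]
  have hcont : Continuous fun y => f p * defect C Ω Z y :=
    (continuousOn_univ.1 (continuousOn_defect C Ω isOpen_univ hZ P)).const_mul _
  have hpos := hcont.integral_pos_of_hasCompactSupport_nonneg_nonzero (μ := Ω.measure) (x := p)
    (HasCompactSupport.intro hKc fun y hy => by rw [hout y hy, mul_zero]) (fun y => ?_) ?_
  · rw [MeasureTheory.integral_const_mul, hint, mul_zero] at hpos
    exact lt_irrefl _ hpos
  · by_cases hy : y ∈ K
    · have h3 := (hKU hy).2
      rw [hin y (hKa hy)]
      have : 0 ≤ χ y ^ 2 * ‖φ₀‖ ^ 2 * (f p * f y) := by positivity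
      simp only [Pi.zero_apply]
      linarith
    · simp [hout y hy]
  · rw [hin p hp, h1.self_of_nhds]
    have := norm_ne_zero_iff.2 hφ₀
    simp [hne, this]

/-- The sub-Dirac operator is symmetric if and only if `Div X` is the divergence defined by the
connection, for all `X ∈ Γ(H)`. -/
theorem diracIsSymmetric_iff : DiracIsSymmetric Ω C P γ ↔
    ∀ X : ∀ x, S.H x, SmoothVF (vf X) Set.univ → ∀ x, defect C Ω X x = 0 := by
  refine ⟨fun h X hX x => ?_, diracIsSymmetric_of_defect_eq_zero C Ω⟩
  rw [defect_eq_sum_frame C Ω (P.isOrthonormalFrame (P.indexAt x)) isOpen_univ hX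
    (P.mem_baseSet_at x) (Set.mem_univ x)]
  refine Finset.sum_eq_zero fun k _ => ?_
  rw [defect_frame_eq_zero_of_diracIsSymmetric C Ω h _ k (P.mem_baseSet_at x), mul_zero]

omit [MeasurableSpace M] [BorelSpace M] [SecondCountableTopology M] in
-- The spin structure enters only as a supply of orthonormal frames around every point.
theorem forall_divCondition_iff (P : SpinStructure S ι) :
    (∀ U s, IsOrthonormalFrame S U s → DivCondition Ω C U s) ↔
      ∀ X : ∀ x, S.H x, SmoothVF (vf X) Set.univ → ∀ x, defect C Ω X x = 0 := by
  refine ⟨fun h X hX x => ?_, fun h U s hs => (divCondition_iff C Ω hs).2 fun X hX x _ => h X hX x⟩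
  have hs := P.isOrthonormalFrame (P.indexAt x)
  exact (divCondition_iff C Ω hs).1 (h _ _ hs) X hX x (P.mem_baseSet_at x)

omit [MeasurableSpace M] [BorelSpace M] [SecondCountableTopology M] in
theorem exists_divCondition_iff (P : SpinStructure S ι) :
    (∀ p : M, ∃ U s, p ∈ U ∧ IsOrthonormalFrame S U s ∧ DivCondition Ω C U s) ↔
      ∀ X : ∀ x, S.H x, SmoothVF (vf X) Set.univ → ∀ x, defect C Ω X x = 0 := by
  refine ⟨fun h X hX x => ?_, fun h p => ?_⟩
  · obtain ⟨U, s, hx, hs, hD⟩ := h x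
    exact (divCondition_iff C Ω hs).1 hD X hX x hx
  · have hs := P.isOrthonormalFrame (P.indexAt p)
    exact ⟨_, _, P.mem_baseSet_at p, hs, (divCondition_iff C Ω hs).2 fun X hX x _ => h X hX x⟩

end TestSpinors

/-! ### Divergence of the Koszul connection -/

section Koszul

variable {n d : ℕ} {M : Type*} [TopologicalSpace M] [ChartedSpace (Eu n) M]
  [IsManifold (𝓡 n) ∞ M] {S : SubRiemannianStructure n M d} (C : MetricConnection S)
  {V : ∀ x : M, Submodule ℝ (TangentSpace (𝓡 n) x)} {hc : ∀ x, IsCompl (S.H x) (V x)}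

/-- In the Koszul formula for 2g(∇_{sᵢ}X, sᵢ) two derivative terms cancel, the third differentiates
the constant g(sᵢ,sᵢ), [sᵢ,sᵢ] = 0, and the remaining two bracket terms coincide. -/
theorem MetricConnection.IsKoszul.div_eq [T2Space M] (hK : C.IsKoszul hc) {U : Set M}
    {s : Fin d → ∀ x : M, S.H x} (hs : IsOrthonormalFrame S U s) {X : ∀ x, S.H x}
    (hX : SmoothVF (vf X) Set.univ) {x : M} (hx : x ∈ U) :
    C.div X x = -∑ i, S.g x
      (projH hc x (VectorField.mlieBracket (𝓡 n) (vf X) (vf (s i)) x)) (s i x) := by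
  rw [C.div_eq hs X hx, ← Finset.sum_neg_distrib]
  refine Finset.sum_congr rfl fun i _ => ?_
  obtain ⟨Z, W, hZ, hW, hxW, hWU, hZs⟩ := exists_global_extension hs.isOpen (hs.smooth i) hx
  have h := hK Z X Z hZ hX hZ x
  have h1 : ∀ v : TangentSpace (𝓡 n) x, dirDeriv (fun y => S.g y (Z y) (Z y)) x v = 0 := fun v =>
    dirDeriv_eq_zero_of_eventuallyEq_const (c := 1) (by
      filter_upwards [hW.mem_nhds hxW] with y hy
      rw [hZs y hy, hs.orthonormal y (hWU hy), if_pos rfl]) v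
  have h2 : (fun y => S.g y (X y) (Z y)) = fun y => S.g y (Z y) (X y) :=
    funext fun y => S.g_symm y _ _
  have h3 : VectorField.mlieBracket (𝓡 n) (vf X) (vf Z) x =
      VectorField.mlieBracket (𝓡 n) (vf X) (vf (s i)) x :=
    Filter.EventuallyEq.mlieBracket_vectorField_eq (Filter.EventuallyEq.refl _ _) (by
      filter_upwards [hW.mem_nhds hxW] with y hy
      rw [vf, hZs y hy]
      rfl)
  rw [VectorField.mlieBracket_swap_apply (V := vf Z) (W := vf X), VectorField.mlieBracket_self,
    h1, h2, h3, hZs x hxW] at h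
  simp only [map_neg, LinearMap.neg_apply, Pi.zero_apply, map_zero, LinearMap.zero_apply] at h
  linarith

end Koszul

/-! ### Adapted frames, their coframes, and the bracket conditions -/

section AdaptedFrames

variable {n d l : ℕ} {M : Type*} [TopologicalSpace M] [ChartedSpace (Eu n) M]
  [IsManifold (𝓡 n) ∞ M] {S : SubRiemannianStructure n M d}
  {V : ∀ x : M, Submodule ℝ (TangentSpace (𝓡 n) x)} (hdl : d + l = n)

/-- The frame `s₁, …, s_d, ξ₁, …, ξ_l` of the tangent bundle. -/
def joinFrame (s : Fin d → ∀ x : M, S.H x) (ξ : Fin l → ∀ x : M, V x) (k : Fin n) (x : M) :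
    TangentSpace (𝓡 n) x :=
  Fin.append (fun i => vf (s i) x) (fun j => vf (ξ j) x) (Fin.cast hdl.symm k)

theorem joinFrame_left (s : Fin d → ∀ x : M, S.H x) (ξ : Fin l → ∀ x : M, V x) (i : Fin d) :
    joinFrame hdl s ξ (Fin.cast hdl (Fin.castAdd l i)) = vf (s i) := by
  funext x
  simp [joinFrame]

theorem joinFrame_right (s : Fin d → ∀ x : M, S.H x) (ξ : Fin l → ∀ x : M, V x) (j : Fin l) :
    joinFrame hdl s ξ (Fin.cast hdl (Fin.natAdd d j)) = vf (ξ j) := by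
  funext x
  simp [joinFrame]

theorem sum_fin_split (f : Fin n → ℝ) : ∑ k, f k =
    ∑ i, f (Fin.cast hdl (Fin.castAdd l i)) + ∑ j, f (Fin.cast hdl (Fin.natAdd d j)) := by
  subst hdl
  exact Fin.sum_univ_add f

theorem forall_fin_split {p : Fin n → Prop} (h1 : ∀ i, p (Fin.cast hdl (Fin.castAdd l i)))
    (h2 : ∀ j, p (Fin.cast hdl (Fin.natAdd d j))) (k : Fin n) : p k := by
  subst hdl
  exact Fin.addCases h1 h2 k

/-- The `k`-th form of the coframe of the fields `Y₁, …, Y_n`, defined by `Ω`. -/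
def coform (Ω : VolumeForm n M) (Y : Fin n → ∀ x : M, TangentSpace (𝓡 n) x) (k : Fin n) (x : M) :
    TangentSpace (𝓡 n) x →ₗ[ℝ] ℝ :=
  (Ω.toFun x).toMultilinearMap.toLinearMap (fun m => Y m x) k

theorem coform_apply (Ω : VolumeForm n M) (Y : Fin n → ∀ x : M, TangentSpace (𝓡 n) x) (k : Fin n)
    (x : M) (w : TangentSpace (𝓡 n) x) :
    coform Ω Y k x w = Ω.toFun x (Function.update (fun m => Y m x) k w) := rfl

theorem coform_frame (Ω : VolumeForm n M) (Y : Fin n → ∀ x : M, TangentSpace (𝓡 n) x)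
    (k m : Fin n) (x : M) :
    coform Ω Y k x (Y m x) = if k = m then Ω.toFun x fun m => Y m x else 0 := by
  rw [coform_apply]
  split_ifs with h
  · subst h
    rw [Function.update_eq_self k (fun m => Y m x)]
  · exact (Ω.toFun x).map_update_self (fun m => Y m x) h

variable {hdl} {Ω : VolumeForm n M} {U : Set M} {s : Fin d → ∀ x : M, S.H x}
  {ξ : Fin l → ∀ x : M, V x}

theorem IsAdaptedFrame.smooth_joinFrame (hA : IsAdaptedFrame hdl S V Ω U s ξ) (k : Fin n) :
    SmoothVF (joinFrame hdl s ξ k) U := by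
  refine forall_fin_split hdl (p := fun k => SmoothVF (joinFrame hdl s ξ k) U) (fun i => ?_)
    (fun j => ?_) k
  · rw [joinFrame_left]
    exact hA.frame.smooth i
  · rw [joinFrame_right]
    exact hA.smooth j

theorem IsAdaptedFrame.volume_joinFrame (hA : IsAdaptedFrame hdl S V Ω U s ξ) {x : M}
    (hx : x ∈ U) : (Ω.toFun x fun k => joinFrame hdl s ξ k x) = 1 :=
  hA.volume_eq_one x hx

theorem IsAdaptedFrame.coform_eq (hA : IsAdaptedFrame hdl S V Ω U s ξ) {x : M} (hx : x ∈ U)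
    (k m : Fin n) : coform Ω (joinFrame hdl s ξ) k x (joinFrame hdl s ξ m x) =
      if k = m then 1 else 0 := by
  rw [coform_frame, hA.volume_joinFrame hx]

theorem IsAdaptedFrame.coform_right_H (hA : IsAdaptedFrame hdl S V Ω U s ξ) {x : M} (hx : x ∈ U)
    (j : Fin l) {v : TangentSpace (𝓡 n) x} (hv : v ∈ S.H x) :
    coform Ω (joinFrame hdl s ξ) (Fin.cast hdl (Fin.natAdd d j)) x v = 0 := by
  have h := congrArg (Subtype.val) (hA.frame.sum_smul hx ⟨v, hv⟩)
  simp only [Submodule.coe_sum, Submodule.coe_smul] at h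
  rw [← h, map_sum]
  refine Finset.sum_eq_zero fun i _ => ?_
  have h2 := hA.coform_eq hx (Fin.cast hdl (Fin.natAdd d j)) (Fin.cast hdl (Fin.castAdd l i))
  rw [joinFrame_left, if_neg] at h2
  · rw [map_smul]
    change _ • coform Ω (joinFrame hdl s ξ) _ x (vf (s i) x) = 0
    rw [h2, smul_zero]
  · intro h3
    have := congrArg Fin.val h3
    simp only [Fin.val_cast, Fin.val_natAdd, Fin.val_castAdd] at this
    omega

theorem IsAdaptedFrame.coform_right_V (hA : IsAdaptedFrame hdl S V Ω U s ξ) {x : M} (hx : x ∈ U)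
    (j k : Fin l) : coform Ω (joinFrame hdl s ξ) (Fin.cast hdl (Fin.natAdd d j)) x (vf (ξ k) x) =
      if j = k then 1 else 0 := by
  have h2 := hA.coform_eq hx (Fin.cast hdl (Fin.natAdd d j)) (Fin.cast hdl (Fin.natAdd d k))
  rw [joinFrame_right] at h2
  rw [h2]
  simp

/-- The sections `ξ₁, …, ξ_l` of an adapted frame span `V`. -/
theorem IsAdaptedFrame.span_eq (hA : IsAdaptedFrame hdl S V Ω U s ξ)
    (hV : IsSmoothDistribution V l) {x : M} (hx : x ∈ U) :
    Submodule.span ℝ (Set.range fun j => vf (ξ j) x) = V x := by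
  have : FiniteDimensional ℝ (TangentSpace (𝓡 n) x) := inferInstanceAs (FiniteDimensional ℝ (Eu n))
  have hli : LinearIndependent ℝ fun j => vf (ξ j) x := by
    rw [Fintype.linearIndependent_iff]
    intro c h j
    have h1 := congrArg (coform Ω (joinFrame hdl s ξ) (Fin.cast hdl (Fin.natAdd d j)) x) h
    simpa [hA.coform_right_V hx] using h1
  refine Submodule.eq_of_le_of_finrank_eq (Submodule.span_le.2 ?_) ?_
  · rintro _ ⟨j, rfl⟩
    exact (ξ j x).2
  · rw [finrank_span_eq_card hli, Fintype.card_fin, hV.finrank_eq x]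

/-- Linear maps that agree on `H` and on the `ξ_j` are equal. -/
theorem IsAdaptedFrame.linearMap_ext (hA : IsAdaptedFrame hdl S V Ω U s ξ)
    (hV : IsSmoothDistribution V l) (hc : ∀ x, IsCompl (S.H x) (V x)) {x : M} (hx : x ∈ U)
    {F : Type*} [AddCommGroup F] [Module ℝ F] {f g : TangentSpace (𝓡 n) x →ₗ[ℝ] F}
    (h1 : ∀ v ∈ S.H x, f v = g v) (h2 : ∀ j, f (vf (ξ j) x) = g (vf (ξ j) x)) : f = g := by
  have h3 : V x ≤ LinearMap.eqLocus f g := by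
    rw [← hA.span_eq hV hx, Submodule.span_le]
    rintro _ ⟨j, rfl⟩
    exact h2 j
  have h4 : (⊤ : Submodule ℝ (TangentSpace (𝓡 n) x)) ≤ LinearMap.eqLocus f g := by
    rw [← (hc x).sup_eq_top]
    exact sup_le h1 h3
  ext1 v
  exact h4 Submodule.mem_top

/-- Both sides vanish on `V` and are dual to the `s_i` on `H`. This identifies the horizontal terms
of L_X Ω with those of the Koszul divergence. -/
theorem IsAdaptedFrame.coform_left (hA : IsAdaptedFrame hdl S V Ω U s ξ)
    (hV : IsSmoothDistribution V l) (hc : ∀ x, IsCompl (S.H x) (V x)) {x : M} (hx : x ∈ U)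
    (i : Fin d) (w : TangentSpace (𝓡 n) x) :
    coform Ω (joinFrame hdl s ξ) (Fin.cast hdl (Fin.castAdd l i)) x w =
      S.g x (projH hc x w) (s i x) := by
  have key : coform Ω (joinFrame hdl s ξ) (Fin.cast hdl (Fin.castAdd l i)) x =
      ((S.g x).flip (s i x)).comp (projH hc x) := by
    refine hA.linearMap_ext hV hc hx (fun v hv => ?_) fun j => ?_
    · have hp : projH hc x v = ⟨v, hv⟩ :=
        Submodule.projectionOnto_apply_left (hc x) ⟨v, hv⟩
      have h := congrArg (Subtype.val) (hA.frame.sum_smul hx ⟨v, hv⟩)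
      simp only [Submodule.coe_sum, Submodule.coe_smul] at h
      rw [LinearMap.comp_apply, LinearMap.flip_apply, hp]
      conv_lhs => rw [← h, map_sum]
      rw [Finset.sum_eq_single i]
      · have h2 := hA.coform_eq hx (Fin.cast hdl (Fin.castAdd l i)) (Fin.cast hdl (Fin.castAdd l i))
        rw [joinFrame_left, if_pos rfl] at h2
        rw [map_smul]
        change _ • coform Ω (joinFrame hdl s ξ) _ x (vf (s i) x) = _
        rw [h2, smul_eq_mul, mul_one]
      · intro k _ hki
        have h2 := hA.coform_eq hx (Fin.cast hdl (Fin.castAdd l i)) (Fin.cast hdl (Fin.castAdd l k))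
        rw [joinFrame_left, if_neg (by simpa using hki.symm)] at h2
        rw [map_smul]
        change _ • coform Ω (joinFrame hdl s ξ) _ x (vf (s k) x) = _
        rw [h2, smul_zero]
      · simp
    · have hp : projH hc x (vf (ξ j) x) = 0 :=
        Submodule.projectionOnto_apply_right (hc x) (ξ j x)
      have h2 := hA.coform_eq hx (Fin.cast hdl (Fin.castAdd l i)) (Fin.cast hdl (Fin.natAdd d j))
      rw [joinFrame_right, if_neg] at h2
      · rw [h2, LinearMap.comp_apply, hp, map_zero]
      · intro h3
        have := congrArg Fin.val h3
        simp only [Fin.val_cast, Fin.val_natAdd, Fin.val_castAdd] at this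
        omega
  rw [key]
  rfl

/-- The forms that are zero on `H` and dual to the `ξ_j` are unique. -/
theorem IsAdaptedFrame.coform_right_unique (hA : IsAdaptedFrame hdl S V Ω U s ξ)
    (hV : IsSmoothDistribution V l) (hc : ∀ x, IsCompl (S.H x) (V x)) {x : M} (hx : x ∈ U)
    {j : Fin l} {η : TangentSpace (𝓡 n) x →ₗ[ℝ] ℝ} (h1 : ∀ v ∈ S.H x, η v = 0)
    (h2 : ∀ k, η (vf (ξ k) x) = if j = k then 1 else 0) :
    η = coform Ω (joinFrame hdl s ξ) (Fin.cast hdl (Fin.natAdd d j)) x :=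
  hA.linearMap_ext hV hc hx (fun v hv => by rw [h1 v hv, hA.coform_right_H hx j hv])
    fun k => by rw [h2, hA.coform_right_V hx]

/-- On the adapted frame Ω is constantly 1, so L_X Ω has no derivative term and reduces to minus the
sum of the diagonal coframe components of the brackets with `X`. -/
theorem IsAdaptedFrame.divergence_eq (hA : IsAdaptedFrame hdl S V Ω U s ξ)
    (hV : IsSmoothDistribution V l) (hc : ∀ x, IsCompl (S.H x) (V x))
    {X : ∀ x : M, TangentSpace (𝓡 n) x} (hX : SmoothVF X Set.univ) {x : M} (hx : x ∈ U) :
    Ω.divergence X x =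
      -∑ i, S.g x (projH hc x (VectorField.mlieBracket (𝓡 n) X (vf (s i)) x)) (s i x) -
        ∑ j, coform Ω (joinFrame hdl s ξ) (Fin.cast hdl (Fin.natAdd d j)) x
          (VectorField.mlieBracket (𝓡 n) X (vf (ξ j)) x) := by
  have h := Ω.lieDeriv_eq_divergence (hX.at isOpen_univ (Set.mem_univ x)) hA.frame.isOpen hx
    hA.smooth_joinFrame
  rw [hA.volume_joinFrame hx, mul_one, VolumeForm.lieDeriv,
    dirDeriv_eq_zero_of_eventuallyEq_const (c := 1), zero_sub] at h
  · rw [← h]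
    have h2 := sum_fin_split hdl fun k => coform Ω (joinFrame hdl s ξ) k x
      (VectorField.mlieBracket (𝓡 n) X (joinFrame hdl s ξ k) x)
    simp only [joinFrame_left, joinFrame_right, hA.coform_left hV hc hx] at h2
    simp only [coform_apply] at h2 ⊢
    rw [h2, neg_add, sub_eq_add_neg]
  · filter_upwards [hA.frame.isOpen.mem_nhds hx] with y hy using hA.volume_joinFrame hy

variable [T2Space M]

/-- The horizontal sums in the two divergences agree, so the defect is -∑ⱼ ηⱼ([X,ξⱼ]). The ηⱼ are
determined on `U`, hence quantifying existentially over them loses nothing. -/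
theorem IsAdaptedFrame.bracketTraceCondition_iff {C : MetricConnection S}
    (hA : IsAdaptedFrame hdl S V Ω U s ξ) (hV : IsSmoothDistribution V l)
    {hc : ∀ x, IsCompl (S.H x) (V x)} (hK : C.IsKoszul hc) :
    BracketTraceCondition S U ξ ↔
      ∀ X : ∀ x, S.H x, SmoothVF (vf X) Set.univ → ∀ x ∈ U, defect C Ω X x = 0 := by
  have key : ∀ X : ∀ x, S.H x, SmoothVF (vf X) Set.univ → ∀ x ∈ U, defect C Ω X x =
      -∑ j, coform Ω (joinFrame hdl s ξ) (Fin.cast hdl (Fin.natAdd d j)) x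
          (VectorField.mlieBracket (𝓡 n) (vf X) (vf (ξ j)) x) := by
    intro X hX x hx
    rw [defect, hA.divergence_eq hV hc hX hx, hK.div_eq C hA.frame hX hx]
    ring
  constructor
  · rintro ⟨η, h1, h2⟩ X hX x hx
    rw [key X hX x hx, neg_eq_zero, ← h2 X hX x hx]
    refine Finset.sum_congr rfl fun j _ => ?_
    rw [hA.coform_right_unique hV hc hx (h1 x hx j).1 (h1 x hx j).2]
  · intro h
    refine ⟨fun j x => coform Ω (joinFrame hdl s ξ) (Fin.cast hdl (Fin.natAdd d j)) x,
      fun x hx j => ⟨fun v hv => hA.coform_right_H hx j hv, fun k => hA.coform_right_V hx j k⟩,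
      fun X hX x hx => ?_⟩
    rw [← neg_eq_zero, ← key X hX x hx, h X hX x hx]

theorem IsAdaptedFrame.bracketPreserves_iff {ξ : Fin 1 → ∀ x : M, V x} {hdl : d + 1 = n}
    (hA : IsAdaptedFrame hdl S V Ω U s ξ) (hV : IsSmoothDistribution V 1)
    (hc : ∀ x, IsCompl (S.H x) (V x)) :
    BracketPreserves S U (ξ 0) ↔ BracketTraceCondition S U ξ := by
  constructor
  · intro h
    refine ⟨fun j x => coform Ω (joinFrame hdl s ξ) (Fin.cast hdl (Fin.natAdd d j)) x,
      fun x hx j => ⟨fun v hv => hA.coform_right_H hx j hv, fun k => hA.coform_right_V hx j k⟩,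
      fun X hX x hx => ?_⟩
    rw [Fin.sum_univ_one]
    exact hA.coform_right_H hx 0 (h X hX x hx)
  · rintro ⟨η, h1, h2⟩ X hX x hx
    set w := VectorField.mlieBracket (𝓡 n) (vf X) (vf (ξ 0)) x
    have h3 : η 0 x w = 0 := by simpa using h2 X hX x hx
    -- With a single ξ every tangent vector is its projection to `H` plus η(w) ξ, so η(w) = 0 puts
    -- `w` in `H`.
    have h4 : LinearMap.id = (S.H x).subtype.comp (projH hc x) +
        (η 0 x).smulRight (vf (ξ 0) x) := by
      refine hA.linearMap_ext hV hc hx (fun v hv => ?_) fun j => ?_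
      · have hp : projH hc x v = ⟨v, hv⟩ :=
          Submodule.projectionOnto_apply_left (hc x) ⟨v, hv⟩
        simp [hp, (h1 x hx 0).1 v hv]
      · have hp : projH hc x (vf (ξ j) x) = 0 :=
          Submodule.projectionOnto_apply_right (hc x) (ξ j x)
        obtain rfl := Subsingleton.elim j 0
        simp [hp, (h1 x hx 0).2 0]
    have h5 := congrArg (fun f => f w) h4
    simp only [LinearMap.id_apply, LinearMap.add_apply, LinearMap.smulRight_apply, h3, zero_smul,
      add_zero] at h5
    rw [h5]
    exact (projH hc x w).2

open Classical in
-- Any local frame of `V` joined to an orthonormal frame of `H` has nonzero volume; dividing one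
-- vertical field by that volume normalises it. This is where l ≥ 1 is needed.
theorem exists_isAdaptedFrame {ι : Type*} (P : SpinStructure S ι) (Ω : VolumeForm n M)
    (hdl : d + l = n) (hV : IsSmoothDistribution V l) (hc : ∀ x, IsCompl (S.H x) (V x))
    (hl : 0 < l) (p : M) :
    ∃ (U : Set M) (s : Fin d → ∀ x : M, S.H x) (ξ : Fin l → ∀ x : M, V x),
      p ∈ U ∧ IsAdaptedFrame hdl S V Ω U s ξ := by
  obtain ⟨W, hW, hpW, ζ₀, hζ₀, hspan⟩ := hV p
  have hmem : ∀ j, ∀ x ∈ W, ζ₀ j x ∈ V x := fun j x hx => by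
    rw [← (hspan x hx).2]
    exact Submodule.subset_span ⟨j, rfl⟩
  set ζ : Fin l → ∀ x : M, V x := fun j x => if h : ζ₀ j x ∈ V x then ⟨ζ₀ j x, h⟩ else 0 with hζ
  have hζe : ∀ j, ∀ x ∈ W, vf (ζ j) x = ζ₀ j x := fun j x hx => by
    simp [vf, hζ, hmem j x hx]
  have hζs : ∀ j, SmoothVF (vf (ζ j)) W := fun j =>
    ContMDiffOn.congr (hζ₀ j) fun x hx => by rw [hζe j x hx]
  set s := P.frame (P.indexAt p)
  have hs' := P.isOrthonormalFrame (P.indexAt p)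
  set U := P.baseSet (P.indexAt p) ∩ W with hUdef
  have hU : IsOpen U := hs'.isOpen.inter hW
  have hs : IsOrthonormalFrame S U s := hs'.mono hU Set.inter_subset_left
  have hζU : ∀ j, SmoothVF (vf (ζ j)) U := fun j => (hζs j).mono Set.inter_subset_right
  set f : M → ℝ := fun y => Ω.toFun y fun k => joinFrame hdl s ζ k y with hf
  have hfs : ContMDiffOn (𝓡 n) 𝓘(ℝ, ℝ) ∞ f U := Ω.smooth U (joinFrame hdl s ζ) hU <|
    forall_fin_split hdl (fun i => by rw [joinFrame_left]; exact hs.smooth i)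
      (fun j => by rw [joinFrame_right]; exact hζU j)
  have hf0 : ∀ y ∈ U, f y ≠ 0 := by
    intro y hy
    have hfr : Module.finrank ℝ (TangentSpace (𝓡 n) y) = n :=
      (finrank_euclideanSpace_fin : Module.finrank ℝ (Eu n) = n)
    have htop : ⊤ ≤ Submodule.span ℝ (Set.range fun k => joinFrame hdl s ζ k y) := by
      rw [← (hc y).sup_eq_top]
      refine sup_le (fun v hv => ?_) ?_
      · have h := congrArg (Subtype.val) (hs.sum_smul hy ⟨v, hv⟩)
        simp only [Submodule.coe_sum, Submodule.coe_smul] at h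
        rw [← h]
        refine Submodule.sum_mem _ fun i _ => Submodule.smul_mem _ _ (Submodule.subset_span
          ⟨Fin.cast hdl (Fin.castAdd l i), ?_⟩)
        exact congrFun (joinFrame_left hdl s ζ i) y
      · rw [← (hspan y hy.2).2, Submodule.span_le]
        rintro _ ⟨j, rfl⟩
        refine Submodule.subset_span ⟨Fin.cast hdl (Fin.natAdd d j), ?_⟩
        exact (congrFun (joinFrame_right hdl s ζ j) y).trans (hζe j y hy.2)
    have hli := linearIndependent_of_top_le_span_of_card_eq_finrank htop
      (by rw [hfr, Fintype.card_fin])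
    have h := ((Ω.toFun y).map_basis_ne_zero_iff (Module.Basis.mk hli htop)).2 (Ω.ne_zero y)
    rwa [Module.Basis.coe_mk] at h
  set j₀ : Fin l := ⟨0, hl⟩
  set ξ : Fin l → ∀ x : M, V x := fun j x => (if j = j₀ then (f x)⁻¹ else 1) • ζ j x with hξ
  refine ⟨U, s, ξ, ⟨P.mem_baseSet_at p, hpW⟩, hs, fun j => ?_, fun x hx => ?_⟩
  · refine SmoothVF.smul (f := fun x => if j = j₀ then (f x)⁻¹ else 1) ?_ (hζU j)
    split_ifs
    · exact ContMDiffOn.inv₀ hfs hf0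
    · exact contMDiffOn_const
  · have h1 : (fun k => joinFrame hdl s ξ k x) =
        Function.update (fun k => joinFrame hdl s ζ k x) (Fin.cast hdl (Fin.natAdd d j₀))
          ((f x)⁻¹ • joinFrame hdl s ζ (Fin.cast hdl (Fin.natAdd d j₀)) x) := by
      funext k
      refine forall_fin_split hdl (p := fun k => joinFrame hdl s ξ k x =
        Function.update (fun k => joinFrame hdl s ζ k x) (Fin.cast hdl (Fin.natAdd d j₀))
          ((f x)⁻¹ • joinFrame hdl s ζ (Fin.cast hdl (Fin.natAdd d j₀)) x) k) (fun i => ?_)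
        (fun j => ?_) k
      · rw [Function.update_of_ne, joinFrame_left, joinFrame_left]
        intro h3
        have := congrArg Fin.val h3
        simp only [Fin.val_cast, Fin.val_natAdd, Fin.val_castAdd] at this
        omega
      · by_cases hj : j = j₀
        · subst hj
          rw [Function.update_self, joinFrame_right, joinFrame_right]
          simp [vf, hξ]
        · rw [Function.update_of_ne (by simpa using hj), joinFrame_right, joinFrame_right]
          simp [vf, hξ, hj]
    change (Ω.toFun x fun k => joinFrame hdl s ξ k x) = 1
    rw [h1, (Ω.toFun x).map_update_smul, Function.update_eq_self _ fun k => joinFrame hdl s ζ k x]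
    exact inv_mul_cancel₀ (hf0 x hx)

end AdaptedFrames

end SubDirac

end

/-! ### Assembly: every condition is equivalent to the vanishing of the defect -/

theorem mainTheorem3 {n d : ℕ} {M : Type*} [TopologicalSpace M] [ChartedSpace (Eu n) M]
    [IsManifold (𝓡 n) ∞ M] [T2Space M] [SecondCountableTopology M]
    [MeasurableSpace M] [BorelSpace M]
    (S : SubRiemannianStructure n M d) (hS : S.IsRegular) (Ω : VolumeForm n M)
    (C : MetricConnection S) {ι : Type*} (P : SpinStructure S ι)
    {Δ : Type*} [NormedAddCommGroup Δ] [InnerProductSpace ℂ Δ] [FiniteDimensional ℂ Δ]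
    (γ : SpinorModule d Δ) :
    -- symmetry is equivalent to the divergence condition, for all and for one local frame
    ((DiracIsSymmetric Ω C P γ ↔ ∀ U s, IsOrthonormalFrame S U s → DivCondition Ω C U s) ∧
      (DiracIsSymmetric Ω C P γ ↔
        ∀ p : M, ∃ U s, p ∈ U ∧ IsOrthonormalFrame S U s ∧ DivCondition Ω C U s)) ∧
    -- the connection defined by a complement `V` of rank `l`
    ∀ (l : ℕ) (_ : 0 < l) (hdl : d + l = n) (V : ∀ x : M, Submodule ℝ (TangentSpace (𝓡 n) x))
      (_ : IsSmoothDistribution V l) (hc : ∀ x, IsCompl (S.H x) (V x)), C.IsKoszul hc →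
      (((∀ U s, IsOrthonormalFrame S U s → DivCondition Ω C U s) ↔
          ∀ U s (ξ : Fin l → ∀ x, V x), IsAdaptedFrame hdl S V Ω U s ξ →
            BracketTraceCondition S U ξ) ∧
        ((∀ U s, IsOrthonormalFrame S U s → DivCondition Ω C U s) ↔
          ∀ p : M, ∃ U s, ∃ ξ : Fin l → ∀ x, V x, p ∈ U ∧ IsAdaptedFrame hdl S V Ω U s ξ ∧
            BracketTraceCondition S U ξ)) ∧
      -- codimension one
      ∀ h1 : l = 1,
        ((DiracIsSymmetric Ω C P γ ↔
          ∀ U s (ξ : Fin l → ∀ x, V x), IsAdaptedFrame hdl S V Ω U s ξ →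
            BracketPreserves S U (ξ (Fin.cast h1.symm 0))) ∧
        (DiracIsSymmetric Ω C P γ ↔
          ∀ p : M, ∃ U s, ∃ ξ : Fin l → ∀ x, V x, p ∈ U ∧ IsAdaptedFrame hdl S V Ω U s ξ ∧
            BracketPreserves S U (ξ (Fin.cast h1.symm 0)))) := by
  refine ⟨⟨(diracIsSymmetric_iff C Ω).trans (forall_divCondition_iff C Ω P).symm,
    (diracIsSymmetric_iff C Ω).trans (exists_divCondition_iff C Ω P).symm⟩, ?_⟩
  intro l hl hdl V hV hc hK
  -- Existence of adapted frames around every point is what lets the universal condition imply zero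
  -- defect, and zero defect imply the existential condition in `hex`.
  have hall : (∀ X : ∀ x, S.H x, SmoothVF (vf X) Set.univ → ∀ x, defect C Ω X x = 0) ↔
      ∀ U s (ξ : Fin l → ∀ x, V x), IsAdaptedFrame hdl S V Ω U s ξ →
        BracketTraceCondition S U ξ := by
    refine ⟨fun h U s ξ hA => (hA.bracketTraceCondition_iff hV hK).2 fun X hX x _ => h X hX x,
      fun h X hX x => ?_⟩
    obtain ⟨U, s, ξ, hx, hA⟩ := exists_isAdaptedFrame P Ω hdl hV hc hl x
    exact (hA.bracketTraceCondition_iff hV hK).1 (h U s ξ hA) X hX x hx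
  have hex : (∀ X : ∀ x, S.H x, SmoothVF (vf X) Set.univ → ∀ x, defect C Ω X x = 0) ↔
      ∀ p : M, ∃ U s, ∃ ξ : Fin l → ∀ x, V x, p ∈ U ∧ IsAdaptedFrame hdl S V Ω U s ξ ∧
        BracketTraceCondition S U ξ := by
    refine ⟨fun h p => ?_, fun h X hX x => ?_⟩
    · obtain ⟨U, s, ξ, hp, hA⟩ := exists_isAdaptedFrame P Ω hdl hV hc hl p
      exact ⟨U, s, ξ, hp, hA, (hA.bracketTraceCondition_iff hV hK).2 fun X hX x _ => h X hX x⟩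
    · obtain ⟨U, s, ξ, hx, hA, hB⟩ := h x
      exact (hA.bracketTraceCondition_iff hV hK).1 hB X hX x hx
  refine ⟨⟨(forall_divCondition_iff C Ω P).trans hall, (forall_divCondition_iff C Ω P).trans hex⟩,
    fun h1 => ?_⟩
  subst h1
  refine ⟨(diracIsSymmetric_iff C Ω).trans (hall.trans ?_),
    (diracIsSymmetric_iff C Ω).trans (hex.trans ?_)⟩
  · exact forall₃_congr fun U s ξ => forall_congr' fun hA => (hA.bracketPreserves_iff hV hc).symm
  · refine forall_congr' fun p => exists_congr fun U => exists_congr fun s => exists_congr fun ξ =>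
      and_congr_right fun _ => and_congr_right fun hA => (hA.bracketPreserves_iff hV hc).symm
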